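/- Let $K$ be a number field, $S$ a finite set of places of $K$ containing all archimedean places, and $\mathcal O_S$ the ring of $S$-integers. Let $\mathcal X_1\subset\mathbb P^3_{\mathcal O_S}$ be a cubic surface, $\mathcal D_1\subset\mathcal X_1$ a hyperplane section and $\mathcal L_1\subset\mathcal X_1$ a line not contained in $\mathcal D_1$, all flat over $\mathrm{Spec}(\mathcal O_S)$; write $\mathfrak q_1=\mathcal D_1\cap\mathcal L_1$, and $X_1,D_1,L_1,q_1$ for the generic fibres, so that $q_1$ is a $K$-rational point. An $\mathcal O_S$-integral point of a pair $(\mathcal X,\mathcal Z)$ is a section $\mathrm{Spec}(\mathcal O_S)\to\mathcal X$ which does not meet $\mathcal Z$. Let $X=\mathrm{Bl}_{L_1}X_1$, let $\phi:X\to\mathbb P^1$ be the morphism induced by projection from $L_1$ (the fibre over a plane containing $L_1$ is the conic residual to $L_1$), let $L\subset X$ be the proper transform of $L_1$, and let $C$ be the irreducible component (over $K$) of the total transform of $D_1$ that dominates $\mathbb P^1$ (unique by GA1--GA3). Assume that $\phi|_L$ is finite, i.e. that no plane is tangent to $X_1$ along all of $L_1$, and that the following hold. * GA1: $D_1$ is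 reduced, and nonsingular at $q_1$. * GA2: $X_1$ has (geometrically) only rational double points as singularities, at most one of them on $L_1$. * GA3: $D_1$ is not the union of a line and a (possibly reducible) conic containing $q_1$, both defined over $K$. * AA1: $(\mathcal L_1,\mathfrak q_1)$ has an $\mathcal O_S$-integral point. At least one of the following holds. * GA4a: the branch loci of the normalization of $C\to\mathbb P^1$ and of $L\to\mathbb P^1$ do not coincide. * GA4b: $C$ has (geometric) genus one, i.e. $D_1$ is nonsingular. * GA4c: $X_1$ has a singularity on $L_1$. At least one of the following holds. * AA2a: $D_1$ is irreducible over $K$ and $q_1$ is not a flex of $D_1$. * AA2b: $D_1$ is irreducible over $K$ and $X_1$ has a singularity on $L_1$. * AA2c: $D_1$ is irreducible over $K$, $q_1$ is a flex of $D_1$, and the plane $H$ containing $L_1$ and the flex line satisfies $H\cap X_1=L_1\cup M$ with $M$ a smooth conic. * AA2d: $D_1$ is irreducible over $K$, $q_1$ is a flex of $D_1$ with flex line $F$, and the plane $H$ containing $L_1$ and $F$ meets $X_1$ in three lines $L_1\cup M_1\cup M_2$ through $q_1$; if $x,y$ are linear coordinates on $H$ over $K$ with $L_1=\{x=0\}$,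 $F=\{y=0\}$ and $M_1\cup M_2=\{ax^2+cxy+by^2=0\}$, then $ab$ is a square in $K_v$ for some $v\in S$. * AA2e: $D_1$ consists of a line and a conic irreducible over $K$, which meet in two distinct points, both defined over $K_v$ for some $v\in S$. Then the $\mathcal O_S$-integral points of $(\mathcal X_1,\mathcal D_1)$ are Zariski dense in $\mathcal X_1$. -/

import Mathlib

open MvPolynomial NumberField IsDedekindDomain

noncomputable section

namespace CubicDensity

universe u

/-! ### Generic fibres: a cubic surface, a plane section and a line in `ℙ³` over `K`

Points of projective space are represented by nonzero coordinate vectors, linear subspaces by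
submodules of `K⁴`. -/

/-- A cubic surface `X₁ = {f = 0} ⊂ ℙ³_K`, a plane `{h = 0}` cutting out `D₁ = X₁ ∩ {h = 0}`,
a line `L₁ ⊂ X₁` (a two-dimensional `L ⊂ K⁴`) not contained in `D₁`, and (a coordinate vector of)
the point `q₁ = L₁ ∩ D₁`. -/
structure CubicWithLine (K : Type u) [Field K] where
  f : MvPolynomial (Fin 4) K
  f_hom : f.IsHomogeneous 3
  f_ne : f ≠ 0
  h : MvPolynomial (Fin 4) K
  h_hom : h.IsHomogeneous 1
  h_ne : h ≠ 0
  L : Submodule K (Fin 4 → K)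
  L_rank : Module.finrank K L = 2
  L_sub : ∀ x ∈ L, aeval x f = 0
  L_not_sub : ∃ x ∈ L, aeval x h ≠ 0
  q : Fin 4 → K
  q_ne : q ≠ 0
  q_mem : q ∈ L
  q_plane : aeval q h = 0

/-- The derivative `∑ᵢ ∂ᵢf(x) wᵢ` of `f` at `x` in the direction `w`. -/
def dirDeriv {K : Type*} [Field K] {A : Type*} [CommRing A] [Algebra K A]
    (f : MvPolynomial (Fin 4) K) (x w : Fin 4 → A) : A :=
  ∑ i, aeval x (pderiv i f) * w i

/-! ### Rational double points -/

/-- The normal forms of the rational double points (Du Val singularities) `Aₙ, Dₙ, E₆, E₇, E₈`. -/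
inductive IsDuValForm {F : Type*} [Field F] : MvPowerSeries (Fin 3) F → Prop
  | A (n : ℕ) (hn : 1 ≤ n) : IsDuValForm
      (MvPowerSeries.X 0 ^ 2 + MvPowerSeries.X 1 ^ 2 + MvPowerSeries.X 2 ^ (n + 1))
  | D (n : ℕ) (hn : 4 ≤ n) : IsDuValForm
      (MvPowerSeries.X 0 ^ 2 + MvPowerSeries.X 1 ^ 2 * MvPowerSeries.X 2
        + MvPowerSeries.X 2 ^ (n - 1))
  | E6 : IsDuValForm
      (MvPowerSeries.X 0 ^ 2 + MvPowerSeries.X 1 ^ 3 + MvPowerSeries.X 2 ^ 4)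
  | E7 : IsDuValForm
      (MvPowerSeries.X 0 ^ 2 + MvPowerSeries.X 1 ^ 3
        + MvPowerSeries.X 1 * MvPowerSeries.X 2 ^ 3)
  | E8 : IsDuValForm
      (MvPowerSeries.X 0 ^ 2 + MvPowerSeries.X 1 ^ 3 + MvPowerSeries.X 2 ^ 5)

/-- The surface germ `{g = 0}` at the origin is a rational double point: after a formal change of
coordinates, `g` is a unit times one of the normal forms. -/
def IsRationalDoubleGerm {F : Type*} [Field F] (g : MvPowerSeries (Fin 3) F) : Prop :=
  ∃ (e : MvPowerSeries (Fin 3) F ≃ₐ[F] MvPowerSeries (Fin 3) F) (c : (MvPowerSeries (Fin 3) F)ˣ)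
    (N : MvPowerSeries (Fin 3) F), IsDuValForm N ∧ e g = c * N

/-- The local equation of `{f = 0}` at `p` in the affine chart `xᵢ = pᵢ`, with coordinates
centred at `p`. -/
def localEquation {K : Type*} [Field K] {F : Type*} [Field F] [Algebra K F]
    (f : MvPolynomial (Fin 4) K) (p : Fin 4 → F) (i : Fin 4) : MvPolynomial (Fin 3) F :=
  aeval (fun j => C (p j) + (i.insertNth 0 (fun k => X k) : Fin 4 → MvPolynomial (Fin 3) F) j) f

/-- `p` is (a coordinate vector of) a singular point of the surface `{f = 0}`. -/
def IsSingularPoint {K : Type*} [Field K] {F : Type*} [Field F] [Algebra K F]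
    (f : MvPolynomial (Fin 4) K) (p : Fin 4 → F) : Prop :=
  p ≠ 0 ∧ aeval p f = 0 ∧ ∀ i, aeval p (pderiv i f) = 0

/-- `p` is a rational double point of the surface `{f = 0}`. -/
def IsRationalDoublePoint {K : Type*} [Field K] {F : Type*} [Field F] [Algebra K F]
    (f : MvPolynomial (Fin 4) K) (p : Fin 4 → F) : Prop :=
  ∃ i, p i ≠ 0 ∧ IsRationalDoubleGerm (localEquation f p i : MvPowerSeries (Fin 3) F)

/-! ### Branch loci -/

/-- The branch locus, in `ℙ¹(K̄)`, of the (normalized) double cover of `ℙ¹` given by a family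
`a X² + b X Y + c Y² = 0` of binary quadratic forms whose coefficients `a, b, c` are binary forms
in the coordinates of `ℙ¹`: the points where the discriminant `Δ = b² - 4 a c` vanishes to odd
order. It is a set of coordinate vectors. -/
def branchLocus {K : Type*} [Field K] (a b c : MvPolynomial (Fin 2) K) :
    Set (Fin 2 → AlgebraicClosure K) :=
  {p | p ≠ 0 ∧ ∃ k : ℕ, Odd k ∧
    emultiplicity (C (p 1) * X 0 - C (p 0) * X 1)
      (MvPolynomial.map (algebraMap K (AlgebraicClosure K)) (b ^ 2 - 4 * a * c)) = k}

namespace CubicWithLine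

variable {K : Type u} [Field K] (T : CubicWithLine K)

/-- The `K̄`-points of `L₁` (with the zero vector). -/
def lineBar : Submodule (AlgebraicClosure K) (Fin 4 → AlgebraicClosure K) :=
  Submodule.span _ ((fun x i => algebraMap K (AlgebraicClosure K) (x i)) '' (T.L : Set (Fin 4 → K)))

/-- The homogeneous ideal of `D₁`. -/
def boundaryIdeal : Ideal (MvPolynomial (Fin 4) K) := Ideal.span {T.f, T.h}

/-- `D₁` is nonsingular at `x`: the differential of `f` does not vanish on the plane `{h = 0}`. -/
def BoundaryNonsingularAt {F : Type*} [Field F] [Algebra K F] (x : Fin 4 → F) : Prop :=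
  ∃ w : Fin 4 → F, aeval w T.h = 0 ∧ dirDeriv T.f x w ≠ 0

/-- `D₁` is reduced, and nonsingular at `q₁`. -/
def GA1 : Prop := T.boundaryIdeal.IsRadical ∧ T.BoundaryNonsingularAt T.q

/-- `X₁` has only rational double points as singularities, with at most one singularity
along `L₁`. -/
def GA2 : Prop :=
  (∀ p : Fin 4 → AlgebraicClosure K, IsSingularPoint T.f p → IsRationalDoublePoint T.f p) ∧
  ∀ p ∈ T.lineBar, ∀ p' ∈ T.lineBar, IsSingularPoint T.f p → IsSingularPoint T.f p' →
    ∃ c : AlgebraicClosure K, p' = c • p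

/-- `D₁` is not the union of a line and a (possibly reducible) conic containing `q₁`, both
defined over `K`. -/
def GA3 : Prop :=
  ¬ ∃ l c : MvPolynomial (Fin 4) K, l.IsHomogeneous 1 ∧ c.IsHomogeneous 2 ∧
    T.f - l * c ∈ Ideal.span {T.h} ∧ aeval T.q c = 0

/-- The projection `φ` from `L₁` is finite on (the proper transform `L` of) `L₁`. On `L` the map
`φ` sends `x` to the plane through `L₁` tangent to `X₁` at `x`; so this says that no plane
`L₁ + ⟨w⟩` is tangent to `X₁` at all points of `L₁`. -/
def FiniteOnLine : Prop := ∀ w : Fin 4 → K, w ∉ T.L → ∃ x ∈ T.L, dirDeriv T.f x w ≠ 0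

/-- `X₁` has a singularity along `L₁`. -/
def SingularAlongLine : Prop := ∃ p ∈ T.lineBar, IsSingularPoint T.f p

/-- A basis `q₁, u, m, n` of `K⁴` with `L₁ = ⟨q₁, u⟩` and `{h = 0} = ⟨q₁, m, n⟩`. The pencil of
planes through `L₁` is then `⟨q₁, u, s m + t n⟩`, `(s : t) ∈ ℙ¹`. -/
def IsFrame (u m n : Fin 4 → K) : Prop :=
  LinearIndependent K ![T.q, u, m, n] ∧ u ∈ T.L ∧ aeval m T.h = 0 ∧ aeval n T.h = 0

/-- A vector of `K⁴` as a constant vector over `K[s, t]`. -/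
def const (x : Fin 4 → K) : Fin 4 → MvPolynomial (Fin 2) K := fun i => C (x i)

/-- The vector `s m + t n` over `K[s, t]`. -/
def pencil (m n : Fin 4 → K) : Fin 4 → MvPolynomial (Fin 2) K :=
  fun i => C (m i) * X 0 + C (n i) * X 1

/-- The branch locus of `L → ℙ¹`. With `w = s m + t n`, the residual conic of `L₁` in the plane
`⟨q₁, u, w⟩` meets `L₁` in the points `α q₁ + β u` with `df_{α q₁ + β u}(w) = 0`, a quadratic form
in `(α, β)`. -/
def branchLine (u m n : Fin 4 → K) : Set (Fin 2 → AlgebraicClosure K) :=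
  let w := pencil m n
  let a := dirDeriv T.f (const T.q) w
  let c := dirDeriv T.f (const u) w
  branchLocus a (dirDeriv T.f (const (T.q + u)) w - a - c) c

/-- The branch locus of `C → ℙ¹`, where `C` is the part of `D₁` dominating `ℙ¹` (taken
normalized). With `w = s m + t n`, the line `⟨q₁, w⟩` meets `D₁` in `q₁` and in the points
`α q₁ + γ w` with `α² df_{q₁}(w) + α γ df_w(q₁) + γ² f(w) = 0`. -/
def branchBoundary (m n : Fin 4 → K) : Set (Fin 2 → AlgebraicClosure K) :=
  let w := pencil m n
  branchLocus (dirDeriv T.f (const T.q) w) (dirDeriv T.f w (const T.q)) (aeval w T.f)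

/-- The branch loci of `C → ℙ¹` and `L → ℙ¹` do not coincide. -/
def GA4a : Prop := ∃ u m n, T.IsFrame u m n ∧ T.branchBoundary m n ≠ T.branchLine u m n

/-- The curve `C` has genus one. As `C` is a component of the plane cubic `D₁`, this means that
`D₁` is nonsingular. -/
def GA4b : Prop :=
  ∀ x : Fin 4 → AlgebraicClosure K, x ≠ 0 → aeval x T.f = 0 → aeval x T.h = 0 →
    T.BoundaryNonsingularAt x

/-- `X₁` has a singularity along `L₁`. -/
def GA4c : Prop := T.SingularAlongLine

/-- `D₁` is irreducible over `K` (used for reduced `D₁`). -/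
def BoundaryIrreducible : Prop := T.boundaryIdeal.IsPrime

/-- The tangent line `F` of `D₁` at `q₁`. -/
def tangentLine : Set (Fin 4 → K) := {w | aeval w T.h = 0 ∧ dirDeriv T.f T.q w = 0}

/-- `q₁` is a flex of `D₁`: the tangent line at `q₁` meets `D₁` there with multiplicity at
least three. -/
def IsFlex : Prop :=
  ∀ w ∈ T.tangentLine,
    (Polynomial.X : Polynomial K) ^ 3 ∣
      aeval (fun i => Polynomial.C (T.q i) + Polynomial.C (w i) * Polynomial.X) T.f

/-- `q₁, u, w` is a basis of the plane spanned by `L₁ = ⟨q₁, u⟩` and the tangent line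
`F = ⟨q₁, w⟩`. -/
def IsPlaneFrame (u w : Fin 4 → K) : Prop :=
  LinearIndependent K ![T.q, u, w] ∧ u ∈ T.L ∧ w ∈ T.tangentLine

/-- The equation of `X₁` restricted to the plane with coordinates `X₀ q₁ + X₁ u + X₂ w`. -/
def planeRestriction (u w : Fin 4 → K) : MvPolynomial (Fin 3) K :=
  aeval (fun i => C (T.q i) * X 0 + C (u i) * X 1 + C (w i) * X 2) T.f

/-- `D₁` is irreducible over `K` and `q₁` is not a flex of `D₁`. -/
def AA2a : Prop := T.BoundaryIrreducible ∧ ¬ T.IsFlex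

/-- `D₁` is irreducible over `K` and `X₁` has a singularity along `L₁`. -/
def AA2b : Prop := T.BoundaryIrreducible ∧ T.SingularAlongLine

/-- `D₁` is irreducible over `K`, `q₁` is a flex of `D₁`, and the plane containing `L₁` and the
flex line meets `X₁` in `L₁ ∪ M` with `M` a smooth conic. -/
def AA2c : Prop :=
  T.BoundaryIrreducible ∧ T.IsFlex ∧ ∃ u w, T.IsPlaneFrame u w ∧
    ∃ M : MvPolynomial (Fin 3) K, M.IsHomogeneous 2 ∧ T.planeRestriction u w = X 2 * M ∧
      ∀ x : Fin 3 → AlgebraicClosure K, x ≠ 0 → aeval x M = 0 → ∃ i, aeval x (pderiv i M) ≠ 0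

/-- `D₁` is irreducible over `K`, `q₁` is a flex of `D₁`, and the plane containing `L₁` and the
flex line `F` meets `X₁` in three lines through `q₁`: with coordinates `x = X₂`, `y = X₁` on the
plane (so `L₁ = {x = 0}`, `F = {y = 0}`) it has the equation `x (a x² + c x y + b y²) = 0`; and
`a b` is a square in the extension `E` of `K`. -/
def AA2d (E : Type u) [Field E] [Algebra K E] : Prop :=
  T.BoundaryIrreducible ∧ T.IsFlex ∧ ∃ u w, T.IsPlaneFrame u w ∧
    ∃ a b c : K, T.planeRestriction u w =
        X 2 * (C a * X 2 ^ 2 + C c * (X 2 * X 1) + C b * X 1 ^ 2) ∧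
      IsSquare (algebraMap K E (a * b))

/-- `D₁` consists of a line and a conic irreducible over `K`, which meet in two distinct points,
both defined over the extension `E` of `K`. -/
def AA2e (E : Type u) [Field E] [Algebra K E] : Prop :=
  ∃ l c : MvPolynomial (Fin 4) K, l.IsHomogeneous 1 ∧ c.IsHomogeneous 2 ∧
    T.f - l * c ∈ Ideal.span {T.h} ∧ (Ideal.span {c, T.h}).IsPrime ∧
    ∃ x y : Fin 4 → E, LinearIndependent E ![x, y] ∧
      (aeval x T.h = 0 ∧ aeval x l = 0 ∧ aeval x c = 0) ∧
      (aeval y T.h = 0 ∧ aeval y l = 0 ∧ aeval y c = 0)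

end CubicWithLine

/-! ### Integral models and integral points

`S` is the set of finite places in question; the archimedean places are always understood to be
included. A closed subscheme of `ℙ³` over the ring `𝒪_S` is given by a homogeneous ideal of
`𝒪_S[x₀, …, x₃]`. A closed subscheme flat over `𝒪_S` is the closure of its generic fibre, so it is
given by the polynomials over `𝒪_S` which lie in the ideal of the generic fibre. -/

section Integral

/-- The closed subscheme of `ℙ³_R` given by the ideal `I` is flat over `R`, stated for its
homogeneous coordinate ring. -/
def IsFlatIdeal {R : Type*} [CommRing R] (I : Ideal (MvPolynomial (Fin 4) R)) : Prop :=
  Module.Flat R (MvPolynomial (Fin 4) R ⧸ I)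

variable {K : Type u} [Field K] [NumberField K] (S : Set (HeightOneSpectrum (𝓞 K)))

/-- The ideal of the flat model over `𝒪_S` of the closed subscheme of `ℙ³_K` with ideal `I`. -/
def flatModel (I : Ideal (MvPolynomial (Fin 4) K)) : Ideal (MvPolynomial (Fin 4) (S.integer K)) :=
  I.comap (MvPolynomial.map (algebraMap (S.integer K) K))

/-- The coordinate vector `x` is primitive at `v`: its entries are `v`-integral, and do not all
reduce to zero. -/
def IsPrimitiveAt (v : HeightOneSpectrum (𝓞 K)) (x : Fin 4 → K) : Prop :=
  (∀ i, v.valuation K (x i) ≤ 1) ∧ ∃ i, v.valuation K (x i) = 1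

/-- `x` represents an `S`-integral point of `(𝒳, 𝒵)`, where `𝒳, 𝒵 ⊂ ℙ³` over `𝒪_S` have ideals
`I, J`: a `K`-point, equivalently a section over `Spec 𝒪_S`, of `𝒳`, such that for every prime
`v ∉ S` its reduction at `v`, computed from primitive coordinates, does not lie on `𝒵`. -/
def IsIntegralPoint (I J : Ideal (MvPolynomial (Fin 4) (S.integer K))) (x : Fin 4 → K) : Prop :=
  x ≠ 0 ∧ (∀ G ∈ I, aeval x G = 0) ∧
    ∀ v ∉ S, ∃ c : K, IsPrimitiveAt v (c • x) ∧ ∃ G ∈ J, v.valuation K (aeval (c • x) G) = 1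

/-- A property of completions holds for `K_v`, for some place `v` which is archimedean or in
`S`. -/
def AtSomePlace (P : ∀ (E : Type u) [Field E] [Algebra K E], Prop) : Prop :=
  (∃ v : InfinitePlace K, P v.Completion) ∨ ∃ v ∈ S, P (v.adicCompletion K)

namespace CubicWithLine

variable (T : CubicWithLine K)

/-- The ideal of `𝒳₁`. -/
def surfaceModel : Ideal (MvPolynomial (Fin 4) (S.integer K)) := flatModel S (Ideal.span {T.f})

/-- The ideal of the plane section `𝒟₁` of `𝒳₁`. -/
def boundaryModel : Ideal (MvPolynomial (Fin 4) (S.integer K)) :=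
  T.surfaceModel S ⊔ flatModel S (Ideal.span {T.h})

/-- The ideal of `𝓛₁`. -/
def lineModel : Ideal (MvPolynomial (Fin 4) (S.integer K)) :=
  flatModel S (⨅ x ∈ T.L, RingHom.ker (aeval x : MvPolynomial (Fin 4) K →ₐ[K] K))

/-- `𝒟₁` is flat over `𝒪_S`. -/
def BoundaryFlat : Prop := IsFlatIdeal (T.boundaryModel S)

/-- `(𝓛₁, 𝔮₁)` has an `𝒪_S`-integral point, where `𝔮₁ = 𝒟₁ ∩ 𝓛₁`. -/
def AA1 : Prop := ∃ x, IsIntegralPoint S (T.lineModel S) (T.boundaryModel S ⊔ T.lineModel S) x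

/-- The `𝒪_S`-integral points of `(𝒳₁, 𝒟₁)` are Zariski dense: a form over `K` vanishing at all of
them vanishes on `X₁`. -/
def IntegralPointsDense : Prop :=
  ∀ (d : ℕ) (g : MvPolynomial (Fin 4) K), g.IsHomogeneous d →
    (∀ x, IsIntegralPoint S (T.surfaceModel S) (T.boundaryModel S) x → aeval x g = 0) →
    ∀ y : Fin 4 → AlgebraicClosure K, aeval y T.f = 0 → aeval y g = 0

end CubicWithLine

end Integral

end CubicDensity

end

/-! The surface is fibred into conics by the planes through L₁, and infinitely many fibres are shown
to carry infinitely many integral points. Take coordinates with q₁ = (1:0:0:0), L₁ = {X₂ = X₃ = 0}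
and boundary plane {X₁ = 0}, in which X₃ = 0 is the tangent line of D₁ at q₁; the second basis
vector is the integral point supplied by AA1 (`exists_adaptedFrame`). In the chart X₁ = 1 the plane
X₂ = xX₃ cuts out L₁ and the conic X₀² + (b + βy)X₀ + (c + γy + κy²) = 0, where y = X₃ and b, β, c,
γ, κ are polynomials in x. Its points at infinity lie on D₁ and are conjugate over K(√(β² - 4κ)). It
passes through the point t of L₁ exactly when A(t)x + B(t) = 0, where A and B are the partial
derivatives of the cubic along L₁ with respect to X₂ and X₃.

Every S-integral t divisible by a fixed N gives a conic with an integral point on it. If β² - 4κ is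
not a square in K but splits at a place in S or at infinity, the norm-one group of K(√(β² - 4κ)) has
S-units of infinite order, and a Pell equation moves this point to infinitely many others congruent
to it (`infinite_pell`, `infinite_integral_points_conic`). Congruence to the point from AA1 makes
them integral for the given models (`isIntegralPoint_of_congruent`).

After multiplication by A⁴, the discriminant as a function of t is the polynomial `LineCubic.disc`.
Suitable t exist if this polynomial is not a square and has odd degree or a leading coefficient that
splits at a place in S or at infinity (`infinite_nonsquare_values`). If it were a square, the
discriminant of C → ℙ¹ would become a square in the function field of L, hence would be a square or
agree with the discriminant of L → ℙ¹ up to squares (`isSquare_boundaryDisc_or`). GA3 excludes the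
first case and each form of GA4 the second (`not_isSquare_disc`). The condition at infinity is what
AA2 provides (`disc_degree`): t = ∞ is q₁, so the leading term depends on how D₁ and the fibre meet
there.

Finally, pseudo-division by the cubic, as a quadratic in X₀, leaves a remainder linear in X₀.
Vanishing at infinitely many points of a conic with no rational point at infinity kills it on that
conic, and infinitely many conics kill it altogether (`form_dvd_of_vanishing`). -/

namespace CubicDensity

/-! ### Solutions of Pell equations from powers of α/σ(α) -/

section Pell

variable {K : Type*} [Field K] [NumberField K]

/-- Finitely many elements of a number field have a common denominator. -/
lemma exists_common_denominator (s : Set K) (hs : s.Finite) :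
    ∃ b : K, IsIntegral ℤ b ∧ b ≠ 0 ∧ ∀ x ∈ s, IsIntegral ℤ (b * x) := by
  obtain ⟨b, hb⟩ := IsLocalization.exist_integer_multiples_of_finset (nonZeroDivisors (𝓞 K))
    hs.toFinset
  refine ⟨algebraMap (𝓞 K) K b, RingOfIntegers.isIntegral_coe _, ?_, fun x hx => ?_⟩
  · simp
  · obtain ⟨a, ha⟩ := hb x (by simpa using hx)
    have : algebraMap (𝓞 K) K b * x = algebraMap (𝓞 K) K a := by rw [ha]; rfl
    rw [this]; exact RingOfIntegers.isIntegral_coe _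

lemma mem_integer_of_isIntegral (S : Set (HeightOneSpectrum (𝓞 K))) {x : K} (hx : IsIntegral ℤ x) :
    x ∈ S.integer K :=
  (S.integer K).algebraMap_mem (⟨x, hx⟩ : 𝓞 K)

/-- The powers of an algebraic integer `α` stabilize modulo `N ≠ 0`. -/
lemma exists_pow_mul_pow_sub_one_eq {α N : K} (hα : IsIntegral ℤ α) (hN : IsIntegral ℤ N)
    (hN0 : N ≠ 0) :
    ∃ i k : ℕ, 1 ≤ k ∧ ∀ j : ℕ, ∃ y, IsIntegral ℤ y ∧ α ^ i * (α ^ (k * j) - 1) = N * y := by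
  let α' : 𝓞 K := ⟨α, hα⟩
  let N' : 𝓞 K := ⟨N, hN⟩
  have hfin : Finite (𝓞 K ⧸ Ideal.span {N'}) :=
    Ideal.finiteQuotientOfFreeOfNeBot _ (by
      simp only [ne_eq, Ideal.span_singleton_eq_bot]
      intro h
      exact hN0 (congrArg (algebraMap (𝓞 K) K) h))
  -- α need not be a unit modulo N, so its powers are only eventually periodic; this is why a factor
  -- α^i remains.
  obtain ⟨i, j, hij, h⟩ := Finite.exists_ne_map_eq_of_infinite
    (fun n : ℕ => Ideal.Quotient.mk (Ideal.span {N'}) (α' ^ n))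
  wlog hlt : i < j generalizing i j
  · exact this j i hij.symm h.symm (by omega)
  refine ⟨i, j - i, by omega, fun l => ?_⟩
  have h1 : N' ∣ α' ^ i * (α' ^ (j - i) - 1) := by
    rw [← Ideal.mem_span_singleton, ← Ideal.Quotient.eq_zero_iff_mem]
    have : α' ^ i * (α' ^ (j - i) - 1) = α' ^ j - α' ^ i := by
      rw [mul_sub, ← pow_add, mul_one]; congr 2; omega
    rw [this, map_sub, sub_eq_zero]; exact h.symm
  have h2 : N' ∣ α' ^ i * (α' ^ ((j - i) * l) - 1) := by
    refine h1.trans (mul_dvd_mul_left _ ?_)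
    rw [pow_mul]
    simpa using sub_dvd_pow_sub_pow (α' ^ (j - i)) 1 l
  obtain ⟨y, hy⟩ := h2
  refine ⟨algebraMap (𝓞 K) K y, RingOfIntegers.isIntegral_coe _, ?_⟩
  have := congrArg (algebraMap (𝓞 K) K) hy
  simp only [map_mul, map_pow, map_sub, map_one] at this
  exact this

variable {E : Type*} [Field E] [NumberField E] [Algebra K E]

/-- Norm-one elements `α ^ k / σ (α ^ k)` congruent to one, in coordinates with respect to a
square root `ω` of `Δ`. -/
lemma infinite_pell_of_sunit (S : Set (HeightOneSpectrum (𝓞 K))) (σ : E ≃ₐ[K] E) (Δ : K)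
    (hΔ : Δ ≠ 0) (ω : E) (hω : ω ^ 2 = algebraMap K E Δ) (hσω : σ ω = -ω)
    (hdec : ∀ z : E, ∃ r i : K, z = algebraMap K E r + algebraMap K E i * ω)
    (α : E) (hαint : IsIntegral ℤ α) (ν : K) (hν : algebraMap K E ν = α * σ α) (hν0 : ν ≠ 0)
    (hνS : ν⁻¹ ∈ S.integer K) (hα : ∀ k : ℕ, 1 ≤ k → α ^ k ≠ (σ α) ^ k)
    (N : K) (hN : N ≠ 0) :
    {e : K × K | e.1 ^ 2 - Δ * e.2 ^ 2 = 1 ∧ (e.1 - 1) / N ∈ S.integer K ∧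
      e.2 / N ∈ S.integer K}.Infinite := by
  have hinj := (algebraMap K E).injective
  have h2 : algebraMap K E 2 = 2 := map_ofNat _ 2
  have hω0 : ω ≠ 0 := by
    rintro rfl
    exact hΔ (hinj (by rw [← hω]; simp))
  -- d makes dω integral, so that the ω-coordinate of an integral element can be recovered from a
  -- trace.
  obtain ⟨d, hdint, hd0, hd⟩ := exists_common_denominator {Δ} (Set.finite_singleton _)
  have hdΔ : IsIntegral ℤ (d * Δ) := hd Δ rfl
  -- For z = r + sω integral only 2r and 2dΔs are known to be integral. A congruence modulo n
  -- therefore absorbs these factors as well as N.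
  obtain ⟨n, hnint, hn0, hn⟩ := exists_common_denominator {1 / (2 * N), 1 / (2 * d * Δ * N)}
    (Set.toFinite _)
  have hn₁ := hn (1 / (2 * N)) (by simp)
  have hn₂ := hn (1 / (2 * d * Δ * N)) (by simp)
  have hint_alg : ∀ a : K, IsIntegral ℤ a → IsIntegral ℤ (algebraMap K E a) := fun a ha =>
    (isIntegral_algebraMap_iff hinj).mpr ha
  obtain ⟨i, k, hk, hdvd⟩ := exists_pow_mul_pow_sub_one_eq hαint (hint_alg n hnint)
    (by simpa using hn0)
  have hσint : ∀ z : E, IsIntegral ℤ z → IsIntegral ℤ (σ z) := fun z hz =>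
    hz.map (σ.toAlgHom.restrictScalars ℤ)
  have hσ2 : ∀ z : E, σ (σ z) = z := by
    intro z
    obtain ⟨r, s, rfl⟩ := hdec z
    simp [hσω]
  have hα0 : α ≠ 0 := by
    rintro h
    rw [h, zero_mul, map_eq_zero] at hν
    exact hν0 hν
  have hσα0 : σ α ≠ 0 := by simpa using hα0
  have hdωint : IsIntegral ℤ (algebraMap K E d * ω) := by
    refine IsIntegral.of_pow (n := 2) (by norm_num) ?_
    have : (algebraMap K E d * ω) ^ 2 = algebraMap K E (d * (d * Δ)) := by
      rw [mul_pow, hω]; simp only [map_mul]; ring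
    rw [this]; exact hint_alg _ (hdint.mul hdΔ)
  -- coordinates of integral elements
  have hcoord : ∀ (z : E) (r s : K), IsIntegral ℤ z → z = algebraMap K E r + algebraMap K E s * ω →
      IsIntegral ℤ (2 * r) ∧ IsIntegral ℤ (2 * d * Δ * s) := by
    intro z r s hz hzrs
    constructor
    · rw [← isIntegral_algebraMap_iff hinj]
      have : algebraMap K E (2 * r) = z + σ z := by
        rw [hzrs]; simp [hσω, h2]; ring
      rw [this]; exact hz.add (hσint z hz)
    · rw [← isIntegral_algebraMap_iff hinj]
      have hz2 : IsIntegral ℤ (algebraMap K E d * ω * z) := hdωint.mul hz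
      have : algebraMap K E (2 * d * Δ * s) =
          algebraMap K E d * ω * z + σ (algebraMap K E d * ω * z) := by
        rw [hzrs]; simp [hσω, ← hω, h2]; ring
      rw [this]; exact hz2.add (hσint _ hz2)
  have hνpow : ∀ l : ℕ, (ν ^ l)⁻¹ ∈ S.integer K := fun l => by
    rw [← inv_pow]; exact pow_mem hνS l
  -- α/σ(α) has norm one, and its denominator divides ν = ασ(α), which is invertible outside S. The
  -- exponents kj force the congruence to 1.
  have main : ∀ j : ℕ, ∃ e : K × K, algebraMap K E e.1 + algebraMap K E e.2 * ω =
        (α / σ α) ^ (k * j) ∧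
      (e.1 ^ 2 - Δ * e.2 ^ 2 = 1 ∧ (e.1 - 1) / N ∈ S.integer K ∧ e.2 / N ∈ S.integer K) := by
    intro j
    obtain ⟨U, V, hUV⟩ := hdec ((α / σ α) ^ (k * j))
    refine ⟨(U, V), hUV.symm, ?_, ?_⟩
    · apply hinj
      have h1 : algebraMap K E (U ^ 2 - Δ * V ^ 2) =
          (α / σ α) ^ (k * j) * σ ((α / σ α) ^ (k * j)) := by
        rw [hUV]; simp [hσω, ← hω]; ring
      rw [h1, map_one, map_pow, map_div₀, hσ2, ← mul_pow]
      have : α / σ α * (σ α / α) = 1 := by field_simp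
      rw [this, one_pow]
    · obtain ⟨y, hyint, hyE⟩ := hdvd j
      have hyσ : σ α ^ i * (σ α ^ (k * j) - 1) = algebraMap K E n * σ y := by
        have := congrArg σ hyE
        simpa using this
      -- This combination of the congruence for α and its conjugate cancels the common term of the
      -- two, leaving ν^(i+kj)((α/σα)^(kj) - 1) = nz.
      set z : E := (σ α ^ i * y - α ^ i * σ y) * α ^ (k * j) with hz
      have hzint : IsIntegral ℤ z := by
        have hσα := (hσint _ hαint).pow i
        exact ((hσα.mul hyint).sub ((hαint.pow i).mul (hσint _ hyint))).mul (hαint.pow _)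
      have key : algebraMap K E (ν ^ (i + k * j)) * ((α / σ α) ^ (k * j) - 1) =
          algebraMap K E n * z := by
        have e1 : algebraMap K E n * z =
            (σ α ^ i * (algebraMap K E n * y) - α ^ i * (algebraMap K E n * σ y)) *
              α ^ (k * j) := by rw [hz]; ring
        rw [e1, ← hyE, ← hyσ, map_pow, hν, div_pow]
        field_simp
        ring
      obtain ⟨r, s, hrs⟩ := hdec z
      obtain ⟨ha, hb⟩ := hcoord z r s hzint hrs
      have key2 : algebraMap K E (ν ^ (i + k * j) * (U - 1)) +
          algebraMap K E (ν ^ (i + k * j) * V) * ω =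
          algebraMap K E (n * r) + algebraMap K E (n * s) * ω := by
        have e1 : algebraMap K E (n * r) + algebraMap K E (n * s) * ω = algebraMap K E n * z := by
          rw [hrs]; simp only [map_mul]; ring
        rw [e1, ← key, hUV]; simp only [map_mul, map_sub, map_one]; ring
      -- Adding and subtracting the conjugate equation separates the coordinates.
      have key3 := congrArg σ key2
      rw [map_add, map_add, map_mul σ, map_mul σ, AlgEquiv.commutes, AlgEquiv.commutes,
        AlgEquiv.commutes, AlgEquiv.commutes, hσω] at key3
      have k1 : ν ^ (i + k * j) * (U - 1) = n * r := by
        apply hinj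
        linear_combination (key2 + key3) / 2
      have k2 : ν ^ (i + k * j) * V = n * s := by
        apply hinj
        apply mul_right_cancel₀ hω0
        linear_combination (key2 - key3) / 2
      have hνl : ν ^ (i + k * j) ≠ 0 := pow_ne_zero _ hν0
      constructor
      · have : (U - 1) / N = (ν ^ (i + k * j))⁻¹ * ((n * (1 / (2 * N))) * (2 * r)) := by
          field_simp; linear_combination k1
        rw [this]
        exact mul_mem (hνpow _) (mem_integer_of_isIntegral S (hn₁.mul ha))
      · have : V / N = (ν ^ (i + k * j))⁻¹ * ((n * (1 / (2 * d * Δ * N))) * (2 * d * Δ * s)) := by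
          field_simp; linear_combination k2
        rw [this]
        exact mul_mem (hνpow _) (mem_integer_of_isIntegral S (hn₂.mul hb))
  choose e he heq using main
  refine Set.infinite_of_injective_forall_mem (f := e) ?_ heq
  -- Two equal solutions would make a positive power of α/σ(α) equal to 1.
  intro j₁ j₂ hj
  by_contra hne
  wlog hlt : j₁ < j₂ generalizing j₁ j₂
  · exact this hj.symm (Ne.symm hne) (by omega)
  have h1 : (α / σ α) ^ (k * j₁) = (α / σ α) ^ (k * j₂) := by
    rw [← he, ← he, hj]
  have h2 : (α / σ α) ^ (k * j₂ - k * j₁) = 1 := by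
    have hle : k * j₁ ≤ k * j₂ := Nat.mul_le_mul_left _ hlt.le
    rw [pow_sub₀ _ (div_ne_zero hα0 hσα0) hle, h1, mul_inv_cancel₀]
    exact pow_ne_zero _ (div_ne_zero hα0 hσα0)
  have h3 : 1 ≤ k * j₂ - k * j₁ := by
    have : k * j₁ < k * j₂ := Nat.mul_lt_mul_of_pos_left hlt (by omega)
    omega
  rw [div_pow, div_eq_one_iff_eq (pow_ne_zero _ hσα0)] at h2
  exact hα _ h3 h2

end Pell

end CubicDensity

namespace CubicDensity

/-! ### Elements of infinite order modulo conjugation, from a split place -/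

section Split

variable {K : Type*} [Field K] [NumberField K]

/-- Some place of `K` in `S` or at infinity splits in `K(√Δ)`, in elementary terms. -/
def SplitsAtPlace (S : Set (HeightOneSpectrum (𝓞 K))) (Δ : K) : Prop :=
  (∃ φ : K →+* ℂ, ¬ ComplexEmbedding.IsReal φ ∨ 0 < (φ Δ).re) ∨
    ∃ v ∈ S, ∃ x : K, v.valuation K (x ^ 2 - Δ) < v.valuation K (4 * Δ)

variable {E : Type*} [Field E] [NumberField E] [Algebra K E]

lemma isIntegral_mul_conj_inv {K E : Type*} [Field K] [Field E] [Algebra K E] {σ : E ≃ₐ[K] E} {u : E}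
    (hu : IsIntegral ℤ u⁻¹) {ν : K} (hν : algebraMap K E ν = u * σ u) : IsIntegral ℤ ν⁻¹ := by
  rw [← isIntegral_algebraMap_iff (algebraMap K E).injective, map_inv₀, hν, mul_inv, ← map_inv₀]
  exact hu.mul (hu.map (σ.toAlgHom.restrictScalars ℤ))

/-- A unit of `E` no power of which is fixed by the nontrivial automorphism, if some infinite place
splits in `E`. -/
lemma exists_unit_pow_ne_conj (σ : E ≃ₐ[K] E) (Δ : K) (hΔ : Δ ≠ 0) (ω : E)
    (hω : ω ^ 2 = algebraMap K E Δ) (hσω : σ ω = -ω) (φ : K →+* ℂ)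
    (hφ : ¬ ComplexEmbedding.IsReal φ ∨ 0 < (φ Δ).re) :
    ∃ u : E, IsIntegral ℤ u ∧ IsIntegral ℤ u⁻¹ ∧ u ≠ 0 ∧
      ∀ k : ℕ, 1 ≤ k → u ^ k ≠ (σ u) ^ k := by
  have hω0 : ω ≠ 0 := by
    rintro rfl
    exact hΔ ((algebraMap K E).injective (by rw [← hω]; simp))
  let : Algebra K ℂ := φ.toAlgebra
  have : Algebra.IsAlgebraic K E := Algebra.IsAlgebraic.tower_top (K := ℚ) K
  let ψ : E →ₐ[K] ℂ := IsAlgClosed.lift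
  have hψ : ∀ x : K, ψ (algebraMap K E x) = φ x := fun x => ψ.commutes x
  let ψ₁ : E →+* ℂ := ψ
  let ψ₂ : E →+* ℂ := ψ₁.comp (σ : E →+* E)
  -- The two extensions of φ define different places. If they were complex conjugate, φ would be
  -- real and ψ₁(ω) purely imaginary, so φ(Δ) ≤ 0.
  have hne : InfinitePlace.mk ψ₂ ≠ InfinitePlace.mk ψ₁ := by
    intro h
    rw [InfinitePlace.mk_eq_iff] at h
    have h2 : ψ₂ ω = - ψ₁ ω := by simp [ψ₂, hσω]
    have h10 : ψ₁ ω ≠ 0 := by simpa using hω0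
    rcases h with h | h
    · rw [h] at h2
      exact h10 (by linear_combination h2 / 2)
    · have hK : ComplexEmbedding.IsReal φ := by
        rw [ComplexEmbedding.isReal_iff]
        ext x
        have := congrArg (fun g : E →+* ℂ => g (algebraMap K E x)) h
        simpa [ψ₂, ψ₁, hψ, ComplexEmbedding.conjugate_coe_eq] using this
      rcases hφ with hφ | hφ
      · exact hφ hK
      have hc : star (ψ₁ ω) = - ψ₁ ω := by
        have := congrArg (fun g : E →+* ℂ => g ω) h
        simp only [ComplexEmbedding.conjugate_coe_eq, h2, map_neg] at this
        change (starRingEnd ℂ) (ψ₁ ω) = _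
        linear_combination -this
      have hre : (ψ₁ ω).re = 0 := by
        have := congrArg Complex.re hc
        simp at this
        linarith
      have hsq : (ψ₁ ω) ^ 2 = φ Δ := by rw [← map_pow, hω]; exact hψ Δ
      have := congrArg Complex.re hsq
      rw [sq, Complex.mul_re, hre] at this
      nlinarith [sq_nonneg (ψ₁ ω).im]
  -- u is small at every infinite place except ψ₁. If u^k were fixed by σ, it would be as small at
  -- ψ₁ as at ψ₂, hence small everywhere, against the product formula.
  obtain ⟨u, hu⟩ := NumberField.Units.dirichletUnitTheorem.exists_unit E (InfinitePlace.mk ψ₁)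
  have hu0 : ((u : 𝓞 E) : E) ≠ 0 := by simp
  refine ⟨((u : 𝓞 E) : E), RingOfIntegers.isIntegral_coe _, ?_, hu0, ?_⟩
  · have : ((u : 𝓞 E) : E)⁻¹ = ((u⁻¹ : (𝓞 E)ˣ) : 𝓞 E) := by simp
    rw [this]; exact RingOfIntegers.isIntegral_coe _
  · intro k hk heq
    have h12 : InfinitePlace.mk ψ₁ (u : E) = InfinitePlace.mk ψ₂ (u : E) := by
      have := congrArg (fun z => ‖ψ₁ z‖) heq
      simp only [map_pow, norm_pow] at this
      rw [InfinitePlace.apply, InfinitePlace.apply]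
      exact (pow_left_inj₀ (norm_nonneg _) (norm_nonneg _) (by omega)).mp this
    have hall : ∀ w : InfinitePlace E, Real.log (w u) < 0 := by
      intro w
      by_cases hw : w = InfinitePlace.mk ψ₁
      · rw [hw, h12]; exact hu _ hne
      · exact hu w hw
    have hsum := NumberField.Units.sum_mult_mul_log u
    have : ∑ w : InfinitePlace E, (w.mult : ℝ) * Real.log (w u) < 0 := by
      apply Finset.sum_neg
      · intro w _
        exact mul_neg_of_pos_of_neg (by exact_mod_cast InfinitePlace.mult_pos) (hall w)
      · exact ⟨InfinitePlace.mk ψ₁, Finset.mem_univ _⟩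
    linarith

/-- By finiteness of the class group, the class number works as exponent. The generator serves as a
substitute for a uniformizer that is a unit at all other primes. -/
lemma exists_pow_eq_span (w : HeightOneSpectrum (𝓞 K)) :
    ∃ h : ℕ, 1 ≤ h ∧ ∃ α : 𝓞 K, w.asIdeal ^ h = Ideal.span {α} := by
  classical
  have hmem : w.asIdeal ∈ nonZeroDivisors (Ideal (𝓞 K)) := by simpa using w.ne_bot
  refine ⟨Fintype.card (ClassGroup (𝓞 K)), Fintype.card_pos, ?_⟩
  have h1 : ClassGroup.mk0 (⟨w.asIdeal, hmem⟩ ^ Fintype.card (ClassGroup (𝓞 K))) = 1 := by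
    rw [map_pow, pow_card_eq_one]
  have h2 := (ClassGroup.mk0_eq_one_iff (pow_mem hmem _)).mp h1
  obtain ⟨α, hα⟩ := h2
  exact ⟨α, hα⟩

/-- An automorphism carrying w into itself carries each power of w into itself, which gives the
bound on integers; a rational integer denominator is fixed by σ. -/
lemma valuation_map_le (w : HeightOneSpectrum (𝓞 E)) (σ : E ≃+* E)
    (hσ : ∀ z ∈ w.asIdeal, RingOfIntegers.mapRingEquiv σ z ∈ w.asIdeal) (z : E) :
    w.valuation E (σ z) ≤ w.valuation E z := by
  have hint : ∀ z : 𝓞 E,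
      w.intValuation (RingOfIntegers.mapRingEquiv σ z) ≤ w.intValuation z := by
    intro z
    rcases eq_or_ne z 0 with rfl | hz
    · simp
    rw [HeightOneSpectrum.intValuation_eq_exp_neg_multiplicity w hz,
      HeightOneSpectrum.intValuation_le_pow_iff_mem]
    set n := multiplicity w.asIdeal (Ideal.span {z})
    have hz' : z ∈ w.asIdeal ^ n := by
      rw [← HeightOneSpectrum.intValuation_le_pow_iff_mem,
        HeightOneSpectrum.intValuation_eq_exp_neg_multiplicity w hz]
    have h1 : (w.asIdeal ^ n).map (RingOfIntegers.mapRingEquiv σ : 𝓞 E →+* 𝓞 E) ≤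
        w.asIdeal ^ n := by
      rw [Ideal.map_pow]
      exact Ideal.pow_right_mono (Ideal.map_le_iff_le_comap.mpr hσ) n
    exact h1 (Ideal.mem_map_of_mem _ hz')
  have : Algebra.IsAlgebraic ℤ E :=
    (IsFractionRing.comap_isAlgebraic_iff (A := ℤ) (K := ℚ)).mpr inferInstance
  obtain ⟨m, hm, hmz⟩ := (Algebra.IsAlgebraic.isAlgebraic (R := ℤ) z).exists_integral_multiple
  have hm' : w.valuation E (m : E) ≠ 0 := by simpa using hm
  obtain ⟨a, ha⟩ : ∃ a : 𝓞 E, algebraMap (𝓞 E) E a = m • z := ⟨⟨m • z, hmz⟩, rfl⟩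
  have key := hint a
  rw [← HeightOneSpectrum.valuation_of_algebraMap (K := E),
    ← HeightOneSpectrum.valuation_of_algebraMap (K := E)] at key
  change w.valuation E (σ (algebraMap (𝓞 E) E a)) ≤ w.valuation E (algebraMap (𝓞 E) E a) at key
  rw [ha, zsmul_eq_mul, map_mul, map_mul, map_intCast, map_mul] at key
  exact (mul_le_mul_iff_right₀ (zero_lt_iff.mpr hm')).mp key

/-- An integer of `E`, a unit outside `v`, no power of which is fixed by the nontrivial
automorphism, if the finite place `v` splits in `E`. -/
lemma exists_sunit_pow_ne_conj (σ : E ≃ₐ[K] E) (Δ : K) (ω : E)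
    (hω : ω ^ 2 = algebraMap K E Δ) (hσω : σ ω = -ω) (v : HeightOneSpectrum (𝓞 K)) (x : K)
    (hx : v.valuation K (x ^ 2 - Δ) < v.valuation K (4 * Δ)) :
    ∃ α : E, IsIntegral ℤ α ∧ α ≠ 0 ∧ (∀ k : ℕ, 1 ≤ k → α ^ k ≠ (σ α) ^ k) ∧
      ∀ ν : K, algebraMap K E ν = α * σ α → ∀ v' ≠ v, v'.valuation K ν⁻¹ ≤ 1 := by
  obtain ⟨Q, hQ, hQv⟩ := Ideal.exists_maximal_ideal_liesOver_of_isIntegral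
    (S := 𝓞 E) v.asIdeal
  have hQ0 : Q ≠ ⊥ := Ideal.ne_bot_of_liesOver_of_ne_bot v.ne_bot Q
  let w : HeightOneSpectrum (𝓞 E) := ⟨Q, hQ.isPrime, hQ0⟩
  have : w.asIdeal.LiesOver v.asIdeal := hQv
  obtain ⟨h, hh, α, hα⟩ := exists_pow_eq_span w
  have hα0 : α ≠ 0 := by
    rintro rfl
    rw [Ideal.span_singleton_eq_bot.mpr rfl] at hα
    exact hQ0 (pow_eq_zero_iff (n := h) (by omega) |>.mp hα)
  let τ := RingOfIntegers.mapRingEquiv (σ : E ≃+* E)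
  have hτ : ∀ z : 𝓞 E, algebraMap (𝓞 E) E (τ z) = σ (algebraMap (𝓞 E) E z) := fun z => rfl
  have hα0' : algebraMap (𝓞 E) E α ≠ 0 :=
    (map_ne_zero_iff _ (FaithfulSMul.algebraMap_injective (𝓞 E) E)).mpr hα0
  refine ⟨algebraMap (𝓞 E) E α, RingOfIntegers.isIntegral_coe _, hα0', ?_, ?_⟩
  · intro k hk heq
    have hαw : α ∈ w.asIdeal := by
      have : α ∈ w.asIdeal ^ h := by rw [hα]; exact Ideal.mem_span_singleton_self α
      exact Ideal.pow_le_self (by omega) this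
    have h1 : τ α ∈ w.asIdeal := by
      have h2 : α ^ k = (τ α) ^ k := by
        apply FaithfulSMul.algebraMap_injective (𝓞 E) E
        rw [map_pow, map_pow, hτ]; exact heq
      refine w.isPrime.mem_of_pow_mem k ?_
      rw [← h2]
      exact Ideal.pow_mem_of_mem _ hαw k (by omega)
    -- Since α generates w^h, knowing σ(α) ∈ w is enough to see that σ preserves w.
    have h3 : ∀ z ∈ w.asIdeal, τ z ∈ w.asIdeal := by
      intro z hz
      have h4 : z ^ h ∈ Ideal.span {α} := by rw [← hα]; exact Ideal.pow_mem_pow hz h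
      obtain ⟨y, hy⟩ := Ideal.mem_span_singleton.mp h4
      refine w.isPrime.mem_of_pow_mem h ?_
      rw [← map_pow, hy, map_mul]
      exact Ideal.mul_mem_right _ _ h1
    have hW := valuation_map_le w (σ : E ≃+* E) h3
    set W := w.valuation E
    set xE := algebraMap K E x
    have hσx : σ xE = xE := σ.commutes x
    -- A σ-stable w contradicts splitting: x + ω and x - ω would have equal value, whose square is
    -- W(x² - Δ), while 4Δ is the square of their difference.
    have hWy : W (xE + ω) = W (xE - ω) := by
      apply le_antisymm
      · have := hW (xE - ω)
        simpa [hσx, hσω] using this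
      · have := hW (xE + ω)
        simpa [hσx, hσω, sub_eq_add_neg] using this
    have e1 : W (algebraMap K E (x ^ 2 - Δ)) = W (xE - ω) ^ 2 := by
      have : algebraMap K E (x ^ 2 - Δ) = (xE + ω) * (xE - ω) := by
        rw [map_sub, map_pow, ← hω]; ring
      rw [this, map_mul, hWy, sq]
    have e2 : W (algebraMap K E (4 * Δ)) ≤ W (xE - ω) ^ 2 := by
      have h5 : algebraMap K E (4 * Δ) = ((xE + ω) - (xE - ω)) ^ 2 := by
        rw [map_mul, ← hω, map_ofNat]; ring
      rw [h5, map_pow]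
      refine pow_le_pow_left₀ zero_le ?_ 2
      refine (W.map_sub _ _).trans ?_
      rw [hWy, max_self]
    have e3 : W (algebraMap K E (x ^ 2 - Δ)) < W (algebraMap K E (4 * Δ)) := by
      rw [← HeightOneSpectrum.valuation_liesOver E v w, ← HeightOneSpectrum.valuation_liesOver E v w]
      exact pow_lt_pow_left₀ hx zero_le
        (Ideal.IsDedekindDomain.ramificationIdx'_ne_zero_of_liesOver w.asIdeal v.ne_bot)
    exact absurd (e1 ▸ e2) (not_le.mpr e3)
  · intro ν hν v' hv'
    -- As a^h is a multiple αβ of α, the quotient a^(2h)/ν = βσ(β) is integral. Since a is a unit at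
    -- v', so is every power of it, and ν⁻¹ is integral at v'.
    obtain ⟨a, hav, hav'⟩ : ∃ a ∈ v.asIdeal, a ∉ v'.asIdeal := by
      by_contra hcon
      push Not at hcon
      have : v.asIdeal = v'.asIdeal := v.isMaximal.eq_of_le v'.isPrime.ne_top hcon
      exact hv' (HeightOneSpectrum.ext this.symm)
    have haw : algebraMap (𝓞 K) (𝓞 E) a ∈ w.asIdeal := by
      have := (Ideal.liesOver_iff w.asIdeal v.asIdeal).mp this
      rw [this] at hav
      exact hav
    have hah : algebraMap (𝓞 K) (𝓞 E) a ^ h ∈ Ideal.span {α} := by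
      rw [← hα]; exact Ideal.pow_mem_pow haw h
    obtain ⟨β, hβ⟩ := Ideal.mem_span_singleton.mp hah
    have hβ1 : algebraMap K E (algebraMap (𝓞 K) K a ^ h) =
        algebraMap (𝓞 E) E α * algebraMap (𝓞 E) E β := by
      have := congrArg (algebraMap (𝓞 E) E) hβ
      rw [map_pow, map_mul] at this
      rw [map_pow, ← this]
      rfl
    have hβ2 := congrArg σ hβ1
    rw [σ.commutes, map_mul] at hβ2
    have hν0 : ν ≠ 0 := by
      rintro rfl
      rw [map_zero, eq_comm, mul_eq_zero] at hν
      simp [hα0'] at hν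
    have hβ3 : algebraMap K E (algebraMap (𝓞 K) K a ^ h * algebraMap (𝓞 K) K a ^ h / ν) =
        algebraMap (𝓞 E) E β * σ (algebraMap (𝓞 E) E β) := by
      rw [map_div₀, map_mul, div_eq_iff (by simpa using hν0), hν]
      nth_rewrite 1 [hβ1]
      rw [hβ2]; ring
    have hint : IsIntegral ℤ (algebraMap (𝓞 K) K a ^ h * algebraMap (𝓞 K) K a ^ h / ν) := by
      rw [← isIntegral_algebraMap_iff (algebraMap K E).injective, hβ3]
      exact (RingOfIntegers.isIntegral_coe _).mul
        ((RingOfIntegers.isIntegral_coe β).map (σ.toAlgHom.restrictScalars ℤ))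
    have hle := v'.valuation_le_one (K := K) ⟨_, hint⟩
    change v'.valuation K (algebraMap (𝓞 K) K a ^ h * algebraMap (𝓞 K) K a ^ h / ν) ≤ 1 at hle
    have ha1 : v'.valuation K (algebraMap (𝓞 K) K a) = 1 :=
      (v'.valuation_eq_one_iff_notMem (K := K)).mpr hav'
    simpa [ha1, map_mul, map_pow, map_div₀] using hle

end Split

/-! ### The Pell equation over a number field -/

section Pell

variable {K : Type*} [Field K] [NumberField K]

/-- The Pell equation `U² - Δ V² = 1` has infinitely many `S`-integral solutions congruent to
`(1, 0)` modulo `N`, if some place in `S` or at infinity splits in the quadratic extension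
`K(√Δ)`. -/
theorem infinite_pell (S : Set (HeightOneSpectrum (𝓞 K))) {Δ : K} (hΔ : ¬ IsSquare Δ)
    (hS : SplitsAtPlace S Δ) {N : K} (hN : N ≠ 0) :
    {e : K × K | e.1 ^ 2 - Δ * e.2 ^ 2 = 1 ∧ (e.1 - 1) / N ∈ S.integer K ∧
      e.2 / N ∈ S.integer K}.Infinite := by
  have : Fact (∀ r : K, r ^ 2 ≠ Δ + 0 * r) := ⟨fun r hr => hΔ ⟨r, by rw [← sq, hr]; ring⟩⟩
  have : NumberField (QuadraticAlgebra K Δ 0) :=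
    { to_charZero := inferInstance
      to_finiteDimensional := Module.Finite.trans K (QuadraticAlgebra K Δ 0) }
  have hΔ0 : Δ ≠ 0 := by rintro rfl; exact hΔ ⟨0, by simp⟩
  let σ : (QuadraticAlgebra K Δ 0) ≃ₐ[K] (QuadraticAlgebra K Δ 0) := AlgEquiv.ofRingEquiv (f := (starRingAut : (QuadraticAlgebra K Δ 0) ≃+* (QuadraticAlgebra K Δ 0))) (by
    intro r; ext <;> simp [QuadraticAlgebra.algebraMap_eq])
  have hσ : ∀ z : (QuadraticAlgebra K Δ 0), σ z = star z := fun z => rfl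
  let ω : (QuadraticAlgebra K Δ 0) := ⟨0, 1⟩
  have hω : ω ^ 2 = algebraMap K (QuadraticAlgebra K Δ 0) Δ := by
    ext <;> simp [ω, sq, QuadraticAlgebra.algebraMap_eq]
  have hσω : σ ω = -ω := by
    rw [hσ]; ext <;> simp [ω]
  have hdec : ∀ z : (QuadraticAlgebra K Δ 0), ∃ r i : K, z = algebraMap K (QuadraticAlgebra K Δ 0) r + algebraMap K (QuadraticAlgebra K Δ 0) i * ω := fun z =>
    ⟨z.re, z.im, by ext <;> simp [ω, QuadraticAlgebra.algebraMap_eq]⟩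
  have hnorm : ∀ z : (QuadraticAlgebra K Δ 0), ∃ ν : K, algebraMap K (QuadraticAlgebra K Δ 0) ν = z * σ z := fun z =>
    ⟨QuadraticAlgebra.norm z, QuadraticAlgebra.algebraMap_norm_eq_mul_star z⟩
  have hν0 : ∀ {z : (QuadraticAlgebra K Δ 0)} {ν : K}, z ≠ 0 → algebraMap K (QuadraticAlgebra K Δ 0) ν = z * σ z → ν ≠ 0 := by
    rintro z ν hz hν rfl
    rw [map_zero, eq_comm, mul_eq_zero] at hν
    simp [hz] at hν
  rcases hS with ⟨φ, hφ⟩ | ⟨v, hv, x, hx⟩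
  · obtain ⟨u, hu1, hu2, hu0, hu⟩ := exists_unit_pow_ne_conj σ Δ hΔ0 ω hω hσω φ hφ
    obtain ⟨ν, hν⟩ := hnorm u
    exact infinite_pell_of_sunit S σ Δ hΔ0 ω hω hσω hdec u hu1 ν hν (hν0 hu0 hν)
      (mem_integer_of_isIntegral S (isIntegral_mul_conj_inv hu2 hν)) hu N hN
  · obtain ⟨α, hα1, hα0, hα, hαν⟩ := exists_sunit_pow_ne_conj σ Δ ω hω hσω v x hx
    obtain ⟨ν, hν⟩ := hnorm α
    refine infinite_pell_of_sunit S σ Δ hΔ0 ω hω hσω hdec α hα1 ν hν (hν0 hα0 hν) ?_ hα N hN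
    intro v' hv'
    exact hαν ν hν v' (by rintro rfl; exact hv' hv)

end Pell

end CubicDensity

namespace CubicDensity

/-! ### Nonsquare values of polynomials -/

section Values

variable {K : Type*} [Field K] [NumberField K]

lemma valuation_le_one_of_isIntegral (v : HeightOneSpectrum (𝓞 K)) {x : K} (hx : IsIntegral ℤ x) :
    v.valuation K x ≤ 1 :=
  v.valuation_le_one (⟨x, hx⟩ : 𝓞 K)

lemma exists_ne_zero_valuation_lt_one (B : Set (HeightOneSpectrum (𝓞 K))) (hB : B.Finite) :
    ∃ M : K, IsIntegral ℤ M ∧ M ≠ 0 ∧ ∀ v ∈ B, v.valuation K M < 1 := by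
  induction B, hB using Set.Finite.induction_on with
  | empty => exact ⟨1, isIntegral_one, one_ne_zero, by simp⟩
  | @insert v B hv hB ih =>
    obtain ⟨M, hM, hM0, hMB⟩ := ih
    obtain ⟨a, ha, ha0⟩ := Submodule.exists_mem_ne_zero_of_ne_bot v.ne_bot
    have hav : v.valuation K (algebraMap (𝓞 K) K a) < 1 := (v.valuation_lt_one_iff_mem a).mpr ha
    refine ⟨algebraMap (𝓞 K) K a * M, (RingOfIntegers.isIntegral_coe a).mul hM,
      mul_ne_zero ((map_ne_zero_iff _ (FaithfulSMul.algebraMap_injective (𝓞 K) K)).mpr ha0) hM0, ?_⟩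
    rintro w (rfl | hw)
    · rw [map_mul]
      exact mul_lt_one_of_lt_of_le hav (valuation_le_one_of_isIntegral _ hM)
    · rw [map_mul]
      rw [mul_comm]
      exact mul_lt_one_of_lt_of_le (hMB w hw) (w.valuation_le_one a)

lemma isIntegral_natCast {K : Type*} [Field K] (n : ℕ) : IsIntegral ℤ (n : K) := by
  simpa using isIntegral_algebraMap (R := ℤ) (A := K) (x := (n : ℤ))

/-- If a polynomial is not constant, its values at large natural numbers have absolute value
greater than one at every infinite place. -/
lemma exists_nat_one_lt_infinitePlace (W : Polynomial K) (hW : 0 < W.degree) :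
    ∃ n : ℕ, ∀ w : InfinitePlace K, 1 < w (W.eval (n : K)) := by
  have h1 : ∀ w : InfinitePlace K, ∀ᶠ n : ℕ in Filter.atTop, 1 < w (W.eval (n : K)) := by
    intro w
    have hdeg : 0 < (W.map w.embedding).degree := by rwa [Polynomial.degree_map]
    have hz : Filter.Tendsto (fun n : ℕ => ‖(n : ℂ)‖) Filter.atTop Filter.atTop := by
      simpa using tendsto_natCast_atTop_atTop (R := ℝ)
    filter_upwards [(Polynomial.tendsto_norm_atTop _ hdeg hz).eventually_gt_atTop 1] with n hn
    rw [← InfinitePlace.norm_embedding_eq w]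
    rwa [Polynomial.eval_natCast_map] at hn
  exact (Filter.eventually_all.mpr h1).exists

/-- The values of a nonconstant polynomial at algebraic integers are divisible by infinitely many
primes. -/
lemma exists_prime_dividing_value (R : Polynomial K) (hR : 0 < R.degree)
    (B : Set (HeightOneSpectrum (𝓞 K))) (hB : B.Finite) :
    ∃ v ∉ B, ∃ n : K, IsIntegral ℤ n ∧ v.valuation K (R.eval n) < 1 := by
  have hR0 : R ≠ 0 := by rintro rfl; simp at hR
  obtain ⟨n₀, hn₀⟩ : ∃ n₀ : ℕ, R.eval (n₀ : K) ≠ 0 := by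
    by_contra hcon
    push Not at hcon
    exact hR0 (Polynomial.eq_zero_of_infinite_isRoot R
      (Set.infinite_of_injective_forall_mem (f := fun n : ℕ => (n : K)) Nat.cast_injective hcon))
  set c := R.eval (n₀ : K) with hc
  obtain ⟨M₀, hM₀, hM₀0, hMB⟩ := exists_ne_zero_valuation_lt_one B hB
  obtain ⟨M₁, hM₁, hM₁0, hM₁c⟩ := exists_common_denominator {c} (Set.finite_singleton c)
  -- Normalized so that T(0) = 1. Values at multiples of bM are then 1 modulo M, hence prime to B
  -- and to the denominator of c.
  set T := Polynomial.C c⁻¹ * Polynomial.taylor (n₀ : K) R with hT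
  have hTeval : ∀ z, T.eval z = R.eval (n₀ + z) / c := by
    intro z
    rw [hT, Polynomial.eval_mul, Polynomial.eval_C, Polynomial.taylor_eval, add_comm z]
    field_simp
  obtain ⟨b, hb, hb0, hbT⟩ := exists_common_denominator
    (Set.range (fun i : Fin (T.natDegree + 1) => T.coeff i)) (Set.finite_range _)
  set M := M₀ * M₁ with hMdef
  have hM : IsIntegral ℤ M := hM₀.mul hM₁
  have hM0 : M ≠ 0 := mul_ne_zero hM₀0 hM₁0
  have hT1 : T.coeff 0 = 1 := by
    rw [Polynomial.coeff_zero_eq_eval_zero, hTeval, add_zero]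
    exact div_self hn₀
  -- the values of `T` at multiples of `b * M`
  have hval : ∀ y : K, IsIntegral ℤ y → ∃ s, IsIntegral ℤ s ∧ T.eval (b * M * y) = 1 + M * s := by
    intro y hy
    refine ⟨∑ i ∈ Finset.range T.natDegree, b * T.coeff (i + 1) * (b ^ i * M ^ i * y ^ (i + 1)),
      IsIntegral.sum _ fun i hi => ?_, ?_⟩
    · have h1 : IsIntegral ℤ (b * T.coeff (i + 1)) :=
        hbT _ ⟨⟨i + 1, by simpa using hi⟩, rfl⟩
      exact h1.mul (((hb.pow i).mul (hM.pow i)).mul (hy.pow _))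
    · rw [Polynomial.eval_eq_sum_range, Finset.sum_range_succ', hT1, Finset.mul_sum]
      rw [pow_zero, mul_one, add_comm]
      congr 1
      refine Finset.sum_congr rfl fun i _ => ?_
      ring
  set W := T.comp (Polynomial.C (b * M) * Polynomial.X) with hWdef
  have hWeval : ∀ y, W.eval y = T.eval (b * M * y) := fun y => by simp [hWdef]
  have hWdeg : 0 < W.degree := by
    rw [← Polynomial.natDegree_pos_iff_degree_pos] at hR ⊢
    rw [hWdef, Polynomial.natDegree_comp, Polynomial.natDegree_C_mul_X _ (mul_ne_zero hb0 hM0), hT,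
      Polynomial.natDegree_C_mul (inv_ne_zero hn₀), Polynomial.natDegree_taylor, mul_one]
    exact hR
  obtain ⟨n, hn⟩ := exists_nat_one_lt_infinitePlace W hWdeg
  obtain ⟨s, hs, hWs⟩ := hval n (isIntegral_natCast n)
  rw [← hWeval] at hWs
  have hWint : IsIntegral ℤ (W.eval (n : K)) := by
    rw [hWs]; exact isIntegral_one.add (hM.mul hs)
  obtain ⟨a, ha⟩ : ∃ a : 𝓞 K, algebraMap (𝓞 K) K a = W.eval (n : K) := ⟨⟨_, hWint⟩, rfl⟩
  -- An algebraic integer larger than 1 at every infinite place violates the product formula for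
  -- units, so some prime divides it.
  have hnu : a ∈ nonunits (𝓞 K) := by
    rintro ⟨u, hu⟩
    have hsum := NumberField.Units.sum_mult_mul_log u
    have : 0 < ∑ w : InfinitePlace K, (w.mult : ℝ) * Real.log (w (algebraMap (𝓞 K) K u)) := by
      apply Finset.sum_pos
      · intro w _
        refine mul_pos (by exact_mod_cast InfinitePlace.mult_pos) (Real.log_pos ?_)
        rw [hu, ha]; exact hn w
      · exact Finset.univ_nonempty
    exact absurd hsum this.ne'
  obtain ⟨I, hI, haI⟩ := exists_max_ideal_of_mem_nonunits hnu
  let v : HeightOneSpectrum (𝓞 K) :=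
    ⟨I, hI.isPrime, Ring.ne_bot_of_isMaximal_of_not_isField hI (RingOfIntegers.not_isField K)⟩
  have hvW : v.valuation K (W.eval (n : K)) < 1 := by
    rw [← ha]; exact (v.valuation_lt_one_iff_mem a).mpr haI
  have hvM : v.valuation K M = 1 := by
    refine le_antisymm (valuation_le_one_of_isIntegral v hM) (not_lt.mp fun hlt => ?_)
    have h1 : v.valuation K (M * s) < 1 := by
      rw [map_mul]; exact mul_lt_one_of_lt_of_le hlt (valuation_le_one_of_isIntegral v hs)
    have h2 : v.valuation K (W.eval (n : K)) = 1 := by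
      rw [hWs, (v.valuation K).map_add_eq_of_lt_left (by simpa using h1), map_one]
    exact hvW.ne h2
  have hvM01 : v.valuation K M₀ = 1 ∧ v.valuation K M₁ = 1 := by
    rw [hMdef, map_mul] at hvM
    have h0 := valuation_le_one_of_isIntegral v hM₀
    have h1 := valuation_le_one_of_isIntegral v hM₁
    constructor
    · exact le_antisymm h0 (not_lt.mp fun h => (mul_lt_one_of_lt_of_le h h1).ne hvM)
    · rw [mul_comm] at hvM
      exact le_antisymm h1 (not_lt.mp fun h => (mul_lt_one_of_lt_of_le h h0).ne hvM)
  refine ⟨v, fun hv => (hMB v hv).ne hvM01.1, n₀ + b * M * n, ?_, ?_⟩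
  · exact (isIntegral_natCast _).add ((hb.mul hM).mul (isIntegral_natCast _))
  · have h1 : R.eval (n₀ + b * M * n) = c * W.eval (n : K) := by
      rw [hWeval, hTeval]; field_simp
    have h2 : v.valuation K c ≤ 1 := by
      have := valuation_le_one_of_isIntegral v (hM₁c c rfl)
      rwa [map_mul, hvM01.2, one_mul] at this
    rw [h1, map_mul, mul_comm]
    exact mul_lt_one_of_lt_of_le hvW h2

/-- If `n` is a simple root of `R` modulo `v`, then on a residue class modulo `v²` all values of
`R` have valuation one. -/
lemma exists_residue_class_uniformizer (v : HeightOneSpectrum (𝓞 K)) (R : Polynomial K)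
    (hR : ∀ i, v.valuation K (R.coeff i) ≤ 1) (n π : K) (hn : v.valuation K n ≤ 1)
    (hπ : v.valuation K π = WithZero.exp (-1)) (hRn : v.valuation K (R.eval n) < 1)
    (hR'n : v.valuation K (R.derivative.eval n) = 1) :
    ∃ e : K, (e = n ∨ e = n + π) ∧ ∀ y, v.valuation K y ≤ 1 →
      v.valuation K (R.eval (e + π ^ 2 * y)) = WithZero.exp (-1) := by
  let A := (v.valuation K).valuationSubring
  have hAmem : ∀ x : K, v.valuation K x ≤ 1 → ∃ a : A, algebraMap A K a = x := fun x hx =>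
    ⟨⟨x, hx⟩, rfl⟩
  have hAle : ∀ a : A, v.valuation K (algebraMap A K a) ≤ 1 := fun a => a.2
  obtain ⟨R', hR'⟩ := (Polynomial.mem_lifts R).mp
    ((Polynomial.lifts_iff_coeff_lifts (f := algebraMap A K) R).mpr fun i => hAmem _ (hR i))
  have hexp1 : (WithZero.exp (-1) : WithZero (Multiplicative ℤ)) < 1 := by
    rw [← WithZero.exp_zero]; exact WithZero.exp_lt_exp.mpr (by norm_num)
  have hlt_le : ∀ x : WithZero (Multiplicative ℤ), x < 1 → x ≤ WithZero.exp (-1) := by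
    intro x hx
    rw [← WithZero.exp_zero] at hx
    rcases eq_or_ne x 0 with rfl | hx0
    · exact zero_le
    · rw [← WithZero.exp_log hx0, WithZero.exp_lt_exp] at hx
      rw [← WithZero.exp_log hx0, WithZero.exp_le_exp]
      omega
  have hexp0 : (WithZero.exp (-1) : WithZero (Multiplicative ℤ)) ≠ 0 := WithZero.exp_ne_zero
  -- Taylor expansion to second order with v-integral remainder.
  have hexpand : ∀ z, v.valuation K z ≤ 1 → ∃ k, v.valuation K k ≤ 1 ∧
      R.eval (n + π * z) = R.eval n + R.derivative.eval n * (π * z) + k * (π * z) ^ 2 := by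
    intro z hz
    obtain ⟨n', hn'⟩ := hAmem n hn
    obtain ⟨p', hp'⟩ := hAmem (π * z) (by
      rw [map_mul, hπ]; exact mul_le_one' hexp1.le hz)
    obtain ⟨k, hk⟩ := R'.binomExpansion n' p'
    refine ⟨algebraMap A K k, hAle k, ?_⟩
    have heval : ∀ (P : Polynomial A) (a : A),
        algebraMap A K (P.eval a) = (P.map (algebraMap A K)).eval (algebraMap A K a) := fun P a => by
      rw [Polynomial.eval_map, Polynomial.eval₂_hom]
    have := congrArg (algebraMap A K) hk
    rw [map_add, map_add, map_mul, map_mul, map_pow, heval, heval, heval, map_add, hn', hp',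
      ← Polynomial.derivative_map, hR'] at this
    exact this
  have hπz : ∀ z, v.valuation K z ≤ 1 → v.valuation K (π ^ 2 * z) < WithZero.exp (-1) := by
    intro z hz
    rw [map_mul, map_pow, hπ]
    calc _ ≤ (WithZero.exp (-1) : WithZero (Multiplicative ℤ)) ^ 2 := mul_le_of_le_one_right' hz
      _ < _ := by
        rw [← WithZero.exp_nsmul]; exact WithZero.exp_lt_exp.mpr (by norm_num)
  -- If v divides R(n) exactly once, n itself works. Otherwise v² divides R(n), and moving n by π
  -- adds R'(n)π, which has valuation exactly one.
  rcases (hlt_le _ hRn).lt_or_eq with hlt | heq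
  · refine ⟨n + π, Or.inr rfl, fun y hy => ?_⟩
    have hz1 : v.valuation K (π * y) < 1 := by
      rw [map_mul, hπ]; exact mul_lt_one_of_lt_of_le hexp1 hy
    have hz : v.valuation K (1 + π * y) = 1 := by
      rw [(v.valuation K).map_add_eq_of_lt_left (by simpa using hz1), map_one]
    obtain ⟨k, hk, hRk⟩ := hexpand (1 + π * y) hz.le
    have e1 : n + π + π ^ 2 * y = n + π * (1 + π * y) := by ring
    have e2 : R.eval n + R.derivative.eval n * (π * (1 + π * y)) + k * (π * (1 + π * y)) ^ 2 =
        R.derivative.eval n * (π * (1 + π * y)) +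
          (R.eval n + π ^ 2 * (k * (1 + π * y) ^ 2)) := by ring
    have hmain : v.valuation K (R.derivative.eval n * (π * (1 + π * y))) = WithZero.exp (-1) := by
      rw [map_mul, map_mul, hR'n, hπ, hz]; simp
    rw [e1, hRk, e2, (v.valuation K).map_add_eq_of_lt_left, hmain]
    rw [hmain]
    refine (v.valuation K).map_add_lt hlt (hπz _ ?_)
    rw [map_mul, map_pow, hz]; simpa using hk
  · refine ⟨n, Or.inl rfl, fun y hy => ?_⟩
    have hz : v.valuation K (π * y) ≤ 1 := by
      rw [map_mul, hπ]; exact mul_le_one' hexp1.le hy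
    obtain ⟨k, hk, hRk⟩ := hexpand (π * y) hz
    have e1 : n + π ^ 2 * y = n + π * (π * y) := by ring
    have e2 : R.eval n + R.derivative.eval n * (π * (π * y)) + k * (π * (π * y)) ^ 2 =
        R.eval n + π ^ 2 * (R.derivative.eval n * y + k * (π * y) ^ 2) := by ring
    rw [e1, hRk, e2, (v.valuation K).map_add_eq_of_lt_left, heq]
    rw [heq]
    refine hπz _ ((v.valuation K).map_add_le ?_ ?_)
    · rw [map_mul, hR'n, one_mul]; exact hy
    · rw [map_mul, map_pow]; exact mul_le_one' hk (pow_le_one' hz 2)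

lemma not_isSquare_of_valuation_eq (v : HeightOneSpectrum (𝓞 K)) {x : K}
    (hx : v.valuation K x = WithZero.exp (-1)) : ¬ IsSquare x := by
  rintro ⟨y, rfl⟩
  rw [map_mul] at hx
  have hy0 : v.valuation K y ≠ 0 := by
    intro h; rw [h, zero_mul] at hx; exact WithZero.exp_ne_zero hx.symm
  rw [← WithZero.exp_log hy0, ← WithZero.exp_add, WithZero.exp_inj] at hx
  omega

/-- A polynomial over a field is a squarefree polynomial times a square. -/
lemma exists_eq_squarefree_mul_sq {F : Type*} [Field F] (Q : Polynomial F) (hQ : Q ≠ 0) :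
    ∃ R U : Polynomial F, Squarefree R ∧ U ≠ 0 ∧ Q = R * U ^ 2 := by
  induction hn : Q.natDegree using Nat.strong_induction_on generalizing Q with
  | _ n ih =>
    by_cases hsq : Squarefree Q
    · exact ⟨Q, 1, hsq, one_ne_zero, by simp⟩
    · unfold Squarefree at hsq
      push Not at hsq
      obtain ⟨x, ⟨y, hy⟩, hx⟩ := hsq
      have hx0 : x ≠ 0 := by rintro rfl; simp at hy; exact hQ hy
      have hy0 : y ≠ 0 := by rintro rfl; simp at hy; exact hQ hy
      have hxdeg : 0 < x.natDegree := by
        rw [Nat.pos_iff_ne_zero]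
        intro h
        exact hx ((Polynomial.isUnit_iff_degree_eq_zero).mpr
          ((Polynomial.degree_eq_iff_natDegree_eq hx0).mpr h))
      have hdeg : y.natDegree < n := by
        rw [← hn, hy, Polynomial.natDegree_mul (mul_ne_zero hx0 hx0) hy0,
          Polynomial.natDegree_mul hx0 hx0]
        omega
      obtain ⟨R, U, hR, hU, hyRU⟩ := ih _ hdeg y hy0 rfl
      exact ⟨R, x * U, hR, mul_ne_zero hx0 hU, by rw [hy, hyRU]; ring⟩

/-- The values of a polynomial which is not a square are not squares along some arithmetic
progression, up to finitely many exceptions. -/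
lemma exists_progression_not_isSquare (S : Set (HeightOneSpectrum (𝓞 K))) (hS : S.Finite)
    (Q : Polynomial K) (hQ : ¬ IsSquare Q) :
    ∃ e b : K, IsIntegral ℤ e ∧ IsIntegral ℤ b ∧ b ≠ 0 ∧ ∃ F : Set K, F.Finite ∧
      ∀ y ∈ S.integer K, e + b * y ∉ F → ¬ IsSquare (Q.eval (e + b * y)) := by
  have hQ0 : Q ≠ 0 := by rintro rfl; exact hQ ⟨0, by simp⟩
  obtain ⟨R, U, hR, hU, hRU⟩ := exists_eq_squarefree_mul_sq Q hQ0
  have hred : ∀ t, U.eval t ≠ 0 → IsSquare (Q.eval t) → IsSquare (R.eval t) := by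
    rintro t ht ⟨z, hz⟩
    refine ⟨z / U.eval t, ?_⟩
    rw [hRU, Polynomial.eval_mul, Polynomial.eval_pow] at hz
    field_simp
    linear_combination hz
  have hFfin : {t | U.IsRoot t}.Finite := Polynomial.finite_setOfPred_isRoot hU
  -- A constant squarefree part is not a square in K, because Q is not a square, so every value
  -- outside the zeros of U works.
  by_cases hdeg : R.natDegree = 0
  · refine ⟨0, 1, isIntegral_zero, isIntegral_one, one_ne_zero, {t | U.IsRoot t}, hFfin, ?_⟩
    intro y _ hyF hsq
    obtain ⟨z, hz⟩ := hred _ hyF hsq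
    rw [Polynomial.eq_C_of_natDegree_eq_zero hdeg, Polynomial.eval_C] at hz
    refine hQ ⟨Polynomial.C z * U, ?_⟩
    rw [hRU, Polynomial.eq_C_of_natDegree_eq_zero hdeg, hz, Polynomial.C_mul]
    ring
  -- Where the Bézout coefficients and R are integral, v cannot divide both R(n) and R'(n). Hence
  -- the roots modulo v are simple.
  · obtain ⟨a, b, hab⟩ := PerfectField.separable_iff_squarefree.mpr hR
    have hbad : ∀ P : Polynomial K, {v : HeightOneSpectrum (𝓞 K) |
        ∃ i, 1 < v.valuation K (P.coeff i)}.Finite := by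
      intro P
      refine (Set.Finite.biUnion (Finset.finite_toSet P.support)
        (fun i _ => HeightOneSpectrum.Support.finite (𝓞 K) (P.coeff i))).subset ?_
      rintro v ⟨i, hi⟩
      refine Set.mem_biUnion (x := i) ?_ hi
      simp only [Finset.mem_coe, Polynomial.mem_support_iff]
      intro h0
      rw [h0] at hi
      simp at hi
    obtain ⟨v, hvB, n, hn, hvn⟩ := exists_prime_dividing_value R
      (Polynomial.natDegree_pos_iff_degree_pos.mp (Nat.pos_of_ne_zero hdeg)) _
      (hS.union ((hbad R).union ((hbad a).union (hbad b))))
    simp only [Set.mem_union, Set.mem_ofPred_eq, not_or, not_exists, not_lt] at hvB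
    obtain ⟨hvS, hvR, hva, hvb⟩ := hvB
    have hvn1 := valuation_le_one_of_isIntegral v hn
    have hevle : ∀ P : Polynomial K, (∀ i, v.valuation K (P.coeff i) ≤ 1) →
        v.valuation K (P.eval n) ≤ 1 := by
      intro P hP
      rw [Polynomial.eval_eq_sum_range]
      refine (v.valuation K).map_sum_le fun i _ => ?_
      rw [map_mul, map_pow]
      exact mul_le_one' (hP i) (pow_le_one' hvn1 i)
    have hder : v.valuation K (R.derivative.eval n) = 1 := by
      have hle : v.valuation K (R.derivative.eval n) ≤ 1 := by
        refine hevle _ fun i => ?_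
        rw [Polynomial.coeff_derivative, map_mul]
        refine mul_le_one' (hvR _) ?_
        have := valuation_le_one_of_isIntegral v (isIntegral_natCast (K := K) (i + 1))
        simpa using this
      refine le_antisymm hle (not_lt.mp fun hlt => ?_)
      have h1 := congrArg (fun P => v.valuation K (Polynomial.eval n P)) hab
      simp only [Polynomial.eval_add, Polynomial.eval_mul, Polynomial.eval_one, map_one] at h1
      have h2 : v.valuation K (a.eval n * R.eval n + b.eval n * R.derivative.eval n) < 1 := by
        refine (v.valuation K).map_add_lt ?_ ?_
        · rw [map_mul, mul_comm]; exact mul_lt_one_of_lt_of_le hvn (hevle a hva)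
        · rw [map_mul, mul_comm]; exact mul_lt_one_of_lt_of_le hlt (hevle b hvb)
      exact h2.ne h1
    obtain ⟨p, hp⟩ := v.intValuation_exists_uniformizer
    rw [← HeightOneSpectrum.valuation_of_algebraMap (K := K)] at hp
    change v.valuation K (algebraMap (𝓞 K) K p) = _ at hp
    set π : K := algebraMap (𝓞 K) K p with hπ
    have hπint : IsIntegral ℤ π := RingOfIntegers.isIntegral_coe p
    have hπ0 : π ≠ 0 := by
      intro h; rw [h, map_zero] at hp; exact WithZero.exp_ne_zero hp.symm
    obtain ⟨e, he, hey⟩ := exists_residue_class_uniformizer v R hvR n π hvn1 hp hvn hder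
    refine ⟨e, π ^ 2, ?_, hπint.pow 2, pow_ne_zero _ hπ0, {t | U.IsRoot t}, hFfin, ?_⟩
    · rcases he with rfl | rfl
      · exact hn
      · exact hn.add hπint
    · intro y hy hyF hsq
      exact not_isSquare_of_valuation_eq v (hey y (hy v hvS)) (hred _ hyF hsq)

end Values

end CubicDensity

namespace CubicDensity

/-! ### Values of polynomials that split at a place in S or at infinity -/

section SplitValues

variable {K : Type*} [Field K] [NumberField K]

lemma SplitsAtPlace.sq_mul {S : Set (HeightOneSpectrum (𝓞 K))} {Δ : K} (h : SplitsAtPlace S Δ)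
    {c : K} (hc : c ≠ 0) : SplitsAtPlace S (c ^ 2 * Δ) := by
  rcases h with ⟨φ, hφ⟩ | ⟨v, hv, x, hx⟩
  · left
    refine ⟨φ, ?_⟩
    by_cases hr : ComplexEmbedding.IsReal φ
    · right
      have hφ' : 0 < (φ Δ).re := hφ.resolve_left (not_not.mpr hr)
      rw [← hr.coe_embedding_apply, Complex.ofReal_re] at hφ' ⊢
      rw [map_mul, map_pow]
      have : hr.embedding c ≠ 0 := by simpa using hc
      positivity
    · exact Or.inl hr
  · right
    refine ⟨v, hv, c * x, ?_⟩
    have e1 : (c * x) ^ 2 - c ^ 2 * Δ = c ^ 2 * (x ^ 2 - Δ) := by ring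
    have e2 : 4 * (c ^ 2 * Δ) = c ^ 2 * (4 * Δ) := by ring
    rw [e1, e2, map_mul, map_mul (v.valuation K) (c ^ 2)]
    refine (mul_lt_mul_iff_right₀ (zero_lt_iff.mpr ?_)).mpr hx
    simpa using hc

/-- An element of `K` which is a square in the completion at a place in `S` or at infinity. -/
lemma splitsAtPlace_of_atSomePlace {K : Type*} [Field K] [NumberField K]
    (S : Set (HeightOneSpectrum (𝓞 K))) {Δ : K} (hΔ : Δ ≠ 0)
    (h : AtSomePlace S (fun E _ _ => IsSquare (algebraMap K E Δ))) : SplitsAtPlace S Δ := by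
  rcases h with ⟨v, y, hy⟩ | ⟨v, hv, y, hy⟩
  · left
    refine ⟨v.embedding, ?_⟩
    by_cases hr : InfinitePlace.IsReal v
    · right
      have h1 := congrArg (InfinitePlace.Completion.extensionEmbedding v) hy
      have hr' := congrArg (InfinitePlace.Completion.extensionEmbeddingOfIsReal hr) hy
      have e1 : InfinitePlace.Completion.extensionEmbeddingOfIsReal hr
          (algebraMap K v.Completion Δ) = InfinitePlace.embedding_of_isReal hr Δ := by
        exact InfinitePlace.Completion.extensionEmbeddingOfIsReal_coe hr _
      rw [e1, map_mul] at hr'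
      rw [← InfinitePlace.embedding_of_isReal_apply hr, Complex.ofReal_re, hr']
      refine mul_self_pos.mpr fun h0 => hΔ ?_
      rw [h0, mul_zero, map_eq_zero] at hr'
      exact hr'
    · left
      rwa [← InfinitePlace.isReal_iff]
  · right
    refine ⟨v, hv, ?_⟩
    have hy0 : y ≠ 0 := by
      rintro rfl
      rw [mul_zero, map_eq_zero] at hy
      exact hΔ hy
    have hvK : ∀ k : K, Valued.v (algebraMap K (v.adicCompletion K) k) = v.valuation K k :=
      fun k => HeightOneSpectrum.adicCompletion.valued_coe K v k
    have h4K : algebraMap K (v.adicCompletion K) 4 = 4 := map_ofNat _ 4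
    have h40 : (4 : v.adicCompletion K) ≠ 0 := by
      rw [← h4K, ne_eq, map_eq_zero]; norm_num
    have hle : ∀ n : ℕ, Valued.v ((n : v.adicCompletion K)) ≤ 1 := fun n => by
      rw [← map_natCast (algebraMap K (v.adicCompletion K)), hvK]
      exact valuation_le_one_of_isIntegral v (isIntegral_natCast n)
    -- K is dense in K_v. From |y - x| < |4y| follows |x² - y²| < |4y|·|y| = |4Δ|, the inequality in
    -- `SplitsAtPlace`.
    obtain ⟨x, hx⟩ : ∃ x : K, Valued.v (y - algebraMap K (v.adicCompletion K) x) <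
        Valued.v (4 * y) := by
      let U : Set (v.adicCompletion K) := {z | Valued.v.restrict (y - z) < Valued.v.restrict (4 * y)}
      have hU : IsOpen U :=
        (Valued.isOpen_ball (v.adicCompletion K) (Valued.v.restrict (4 * y))).preimage
          (continuous_const.sub continuous_id)
      have hyU : y ∈ U := by
        change Valued.v.restrict (y - y) < _
        rw [Valuation.restrict_lt_iff, sub_self, map_zero, zero_lt_iff, ne_eq, Valuation.zero_iff]
        exact mul_ne_zero h40 hy0
      obtain ⟨x, hxU⟩ := (HeightOneSpectrum.denseRange_algebraMap K v).exists_mem_open hU ⟨y, hyU⟩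
      exact ⟨x, (Valuation.restrict_lt_iff _).mp hxU⟩
    refine ⟨x, ?_⟩
    set x' := algebraMap K (v.adicCompletion K) x
    rw [← hvK, ← hvK, map_sub, map_pow, map_mul, h4K, hy]
    have e1 : x' ^ 2 - y * y = (y - x') * ((y - x') - 2 * y) := by ring
    have e2 : 4 * (y * y) = (4 * y) * y := by ring
    have h4 : Valued.v (4 * y) ≤ Valued.v y := by
      rw [map_mul]; exact mul_le_of_le_one_left' (by simpa using hle 4)
    have h2 : Valued.v (2 * y) ≤ Valued.v y := by
      rw [map_mul]; exact mul_le_of_le_one_left' (by simpa using hle 2)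
    have h3 : Valued.v ((y - x') - 2 * y) ≤ Valued.v y :=
      (Valuation.map_sub _ _ _).trans (max_le (hx.le.trans h4) h2)
    rw [e1, e2, map_mul, map_mul Valued.v (4 * y)]
    refine lt_of_le_of_lt (mul_le_mul_right h3 _) ?_
    refine (mul_lt_mul_iff_left₀ (zero_lt_iff.mpr ?_)).mpr hx
    rwa [ne_eq, Valuation.zero_iff]

/-- The values of a polynomial `Q` at suitable `S`-integers are squares locally at a place in `S` or
at infinity. -/
lemma infinite_splitsAtPlace_values (S : Set (HeightOneSpectrum (𝓞 K))) (Q : Polynomial K)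
    (h : Odd Q.natDegree ∨ Even Q.natDegree ∧ SplitsAtPlace S Q.leadingCoeff) :
    {y | y ∈ S.integer K ∧ SplitsAtPlace S (Q.eval y)}.Infinite := by
  have hnat : ∀ n : ℕ, (n : K) ∈ S.integer K := fun n =>
    mem_integer_of_isIntegral S (isIntegral_natCast n)
  -- a real place at which the leading coefficient is positive
  have hreal : ∀ (P : Polynomial K) (φ : K →+* ℂ), 0 < (φ P.leadingCoeff).re →
      ComplexEmbedding.IsReal φ → ∃ n₀ : ℕ, ∀ n : ℕ, n₀ ≤ n → 0 < (φ (P.eval (n : K))).re := by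
    intro P φ hφ hr
    have hlc : 0 < hr.embedding P.leadingCoeff := by
      rwa [← hr.coe_embedding_apply, Complex.ofReal_re] at hφ
    have hlc' : 0 < (P.map hr.embedding).leadingCoeff := by rwa [Polynomial.leadingCoeff_map]
    have hev : ∀ n : ℕ, (φ (P.eval (n : K))).re = (P.map hr.embedding).eval (n : ℝ) := by
      intro n
      rw [← hr.coe_embedding_apply, Complex.ofReal_re, Polynomial.eval_natCast_map]
    simp_rw [hev]
    rcases eq_or_ne (P.map hr.embedding).natDegree 0 with h0 | h0
    · refine ⟨0, fun n _ => ?_⟩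
      rw [Polynomial.eq_C_of_natDegree_eq_zero h0, Polynomial.eval_C]
      rwa [Polynomial.leadingCoeff, h0] at hlc'
    · have ht := (Polynomial.tendsto_atTop_of_leadingCoeff_nonneg _
        (Polynomial.natDegree_pos_iff_degree_pos.mp (Nat.pos_of_ne_zero h0)) hlc'.le).comp
        (tendsto_natCast_atTop_atTop (R := ℝ))
      exact Filter.eventually_atTop.mp (ht.eventually_gt_atTop 0)
  have hinf : ∀ (n₀ : ℕ) (g : K), g ≠ 0 → (∀ n : ℕ, n₀ ≤ n → g * n ∈ S.integer K ∧
      SplitsAtPlace S (Q.eval (g * n))) →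
      {y | y ∈ S.integer K ∧ SplitsAtPlace S (Q.eval y)}.Infinite := by
    intro n₀ g hg hn
    refine Set.infinite_of_injective_forall_mem (f := fun n : ℕ => g * ((n₀ + n : ℕ) : K)) ?_
      (fun n => hn _ (by omega))
    intro a b hab
    have := Nat.cast_injective (R := K) (mul_left_cancel₀ hg hab)
    omega
  -- At a nonreal place every value splits.
  have hnonreal : ∀ φ : K →+* ℂ, ¬ ComplexEmbedding.IsReal φ →
      {y | y ∈ S.integer K ∧ SplitsAtPlace S (Q.eval y)}.Infinite := fun φ hφ =>
    hinf 0 1 one_ne_zero fun n _ => ⟨by simp, Or.inl ⟨φ, Or.inl hφ⟩⟩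
  rcases h with hodd | ⟨heven, ⟨φ, hφ⟩ | ⟨v, hv, x, hx⟩⟩
  · obtain ⟨φ⟩ : Nonempty (K →+* ℂ) := inferInstance
    by_cases hr : ComplexEmbedding.IsReal φ
    · have hQ0 : Q ≠ 0 := by rintro rfl; simp at hodd
      have hlc0 : (φ Q.leadingCoeff).re ≠ 0 := by
        rw [← hr.coe_embedding_apply, Complex.ofReal_re]
        simpa using hQ0
      -- In odd degree the sign of the leading coefficient can be corrected by using negative
      -- integers.
      rcases lt_or_gt_of_ne hlc0 with hneg | hpos
      · have hcomp : 0 < (φ (Q.comp (-Polynomial.X)).leadingCoeff).re := by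
          rw [Polynomial.leadingCoeff_comp (by simp)]
          simp only [Polynomial.leadingCoeff_neg, Polynomial.leadingCoeff_X, hodd.neg_one_pow]
          simpa using hneg
        obtain ⟨n₀, hn₀⟩ := hreal _ φ hcomp hr
        refine hinf n₀ (-1) (by norm_num) fun n hn => ⟨?_, Or.inl ⟨φ, Or.inr ?_⟩⟩
        · exact mul_mem (neg_mem (one_mem _)) (hnat n)
        · simpa using hn₀ n hn
      · obtain ⟨n₀, hn₀⟩ := hreal Q φ hpos hr
        refine hinf n₀ 1 one_ne_zero fun n hn => ⟨by simp, Or.inl ⟨φ, Or.inr ?_⟩⟩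
        simpa using hn₀ n hn
    · exact hnonreal φ hr
  · by_cases hr : ComplexEmbedding.IsReal φ
    · obtain ⟨n₀, hn₀⟩ := hreal Q φ (hφ.resolve_left (not_not.mpr hr)) hr
      refine hinf n₀ 1 one_ne_zero fun n hn => ⟨by simp, Or.inl ⟨φ, Or.inr ?_⟩⟩
      simpa using hn₀ n hn
    · exact hnonreal φ hr
  · obtain ⟨k, hk⟩ := heven
    set V := v.valuation K with hV
    set p := Q.leadingCoeff with hp
    -- The inverse of this generator is an S-integer with a pole only at v. Its powers tend to
    -- infinity v-adically, like large integers at a real place.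
    obtain ⟨h, hh, ϖ, hϖ⟩ := exists_pow_eq_span v
    have hϖ0 : ϖ ≠ 0 := by
      rintro rfl
      rw [Ideal.span_singleton_eq_bot.mpr rfl] at hϖ
      exact v.ne_bot (pow_eq_zero_iff (n := h) (by omega) |>.mp hϖ)
    set π : K := algebraMap (𝓞 K) K ϖ with hπ
    have hπ0 : π ≠ 0 := (map_ne_zero_iff _ (FaithfulSMul.algebraMap_injective (𝓞 K) K)).mpr hϖ0
    have hVπ : V π < 1 := by
      refine (v.valuation_lt_one_iff_mem ϖ).mpr ?_
      have : ϖ ∈ v.asIdeal ^ h := by rw [hϖ]; exact Ideal.mem_span_singleton_self ϖ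
      exact Ideal.pow_le_self (by omega) this
    have hVπ0 : V π ≠ 0 := by simpa using hπ0
    have hπS : π⁻¹ ∈ S.integer K := by
      intro w hw
      have hwv : w ≠ v := by rintro rfl; exact hw hv
      have : w.valuation K π = 1 := by
        refine (w.valuation_eq_one_iff_notMem (K := K)).mpr fun hmem => hwv ?_
        have h1 : v.asIdeal ^ h ≤ w.asIdeal := by
          rw [hϖ, Ideal.span_singleton_le_iff_mem]; exact hmem
        have h2 := Ideal.IsPrime.le_of_pow_le h1
        exact HeightOneSpectrum.ext (v.isMaximal.eq_of_le w.isPrime.ne_top h2).symm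
      rw [map_inv₀, this, inv_one]
    have h4p : V (4 * p) ≠ 0 := (zero_le.trans_lt hx).ne'
    have h4p_le : V (4 * p) ≤ V p := by
      rw [map_mul]
      refine mul_le_of_le_one_left' ?_
      simpa using valuation_le_one_of_isIntegral v (isIntegral_natCast (K := K) 4)
    -- the lower order terms are small
    obtain ⟨n₀, hn₀⟩ : ∃ n₀ : ℕ, ∀ n, n₀ ≤ n → ∀ i ∈ Q.support, V (Q.coeff i) * V π ^ n <
        V (4 * p) := by
      have h1 : ∀ i ∈ Q.support, ∃ n₀ : ℕ, ∀ n, n₀ ≤ n → V (Q.coeff i) * V π ^ n < V (4 * p) := by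
        intro i hi
        have hqi : V (Q.coeff i) ≠ 0 := by
          rw [ne_eq, Valuation.zero_iff]; exact Polynomial.mem_support_iff.mp hi
        obtain ⟨n₀, hn₀⟩ := exists_pow_lt₀ hVπ
          (Units.mk0 (V (4 * p) / V (Q.coeff i)) (div_ne_zero h4p hqi))
        refine ⟨n₀, fun n hn => ?_⟩
        rw [mul_comm, ← lt_div_iff₀ (zero_lt_iff.mpr hqi)]
        exact (pow_le_pow_right_of_le_one' hVπ.le hn).trans_lt hn₀
      choose! N hN using h1
      exact ⟨Q.support.sup N, fun n hn i hi => hN i hi n ((Finset.le_sup hi).trans hn)⟩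
    refine Set.infinite_of_injective_forall_mem (f := fun n : ℕ => π⁻¹ ^ (n₀ + n)) ?_ ?_
    · intro a b hab
      have h1 : V π ^ (n₀ + a) = V π ^ (n₀ + b) := by
        have := congrArg V hab
        simpa using this
      have := (pow_right_strictAnti₀ (zero_lt_iff.mpr hVπ0) hVπ).injective h1
      omega
    · intro n
      refine ⟨pow_mem hπS _, Or.inr ⟨v, hv, x * (π⁻¹ ^ (n₀ + n)) ^ k, ?_⟩⟩
      set y := π⁻¹ ^ (n₀ + n) with hy
      have hy0 : y ≠ 0 := pow_ne_zero _ (inv_ne_zero hπ0)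
      have hVy0 : V y ≠ 0 := by simpa using hy0
      have hVy1 : 1 ≤ V y := by
        rw [hy, map_pow, map_inv₀]
        exact one_le_pow_of_one_le' ((one_le_inv₀ (zero_lt_iff.mpr hVπ0)).mpr hVπ.le) _
      have hVyπ : V y * V π ^ (n₀ + n) = 1 := by
        rw [hy, map_pow, map_inv₀, ← mul_pow, inv_mul_cancel₀ hVπ0, one_pow]
      set y2 := V y ^ (k + k) with hy2
      have hy20 : y2 ≠ 0 := pow_ne_zero _ hVy0
      -- For large y the value Q(y) is so close to py^(2k) that xy^k remains an approximate square
      -- root of it.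
      have hsmall : V (Q.eval y - p * y ^ (k + k)) < V (4 * p) * y2 := by
        have e1 : Q.eval y - p * y ^ (k + k) = Q.eraseLead.eval y := by
          conv_lhs => rw [← Polynomial.eraseLead_add_C_mul_X_pow Q]
          simp [hp, hk]
        rw [e1, Polynomial.eval_eq_sum, Polynomial.sum_def]
        refine V.map_sum_lt (mul_ne_zero h4p hy20) fun i hi => ?_
        have hi' : i ∈ Q.support ∧ i < k + k := by
          constructor
          · rw [Polynomial.eraseLead_support] at hi
            exact Finset.mem_of_mem_erase hi
          · rw [← hk]; exact Polynomial.lt_natDegree_of_mem_eraseLead_support hi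
        rw [Polynomial.eraseLead_coeff_of_ne i (by omega), map_mul, map_pow]
        obtain ⟨j, hj⟩ : ∃ j, k + k = i + 1 + j := ⟨k + k - i - 1, by omega⟩
        calc V (Q.coeff i) * V y ^ i
            = V (Q.coeff i) * V π ^ (n₀ + n) * V y ^ (i + 1) := by
              have hcomm : ∀ a b c d : WithZero (Multiplicative ℤ),
                  a * d * (b * c) = a * c * (d * b) := fun a b c d => by ac_rfl
              rw [pow_succ (V y) i, ← hcomm, hVyπ, mul_one]
          _ ≤ V (Q.coeff i) * V π ^ (n₀ + n) * y2 := by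
              refine mul_le_mul_right ?_ _
              rw [hy2, hj]
              exact pow_le_pow_right' hVy1 (by omega)
          _ < V (4 * p) * y2 :=
              (mul_lt_mul_iff_left₀ (zero_lt_iff.mpr hy20)).mpr (hn₀ _ (by omega) i hi'.1)
      have hVp : V (p * y ^ (k + k)) = V p * y2 := by rw [map_mul, map_pow]
      have hVQ : V (Q.eval y) = V p * y2 := by
        have e : Q.eval y = p * y ^ (k + k) + (Q.eval y - p * y ^ (k + k)) := by ring
        rw [e, V.map_add_eq_of_lt_left, hVp]
        rw [hVp]
        exact hsmall.trans_le (mul_le_mul_left h4p_le _)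
      have hV4Q : V (4 * Q.eval y) = V (4 * p) * y2 := by
        rw [map_mul, hVQ, map_mul, mul_assoc]
      have e : (x * y ^ k) ^ 2 - Q.eval y =
          (x ^ 2 - p) * y ^ (k + k) - (Q.eval y - p * y ^ (k + k)) := by ring
      rw [hV4Q, e]
      refine (V.map_sub _ _).trans_lt (max_lt ?_ hsmall)
      rw [map_mul, map_pow]
      exact (mul_lt_mul_iff_left₀ (zero_lt_iff.mpr hy20)).mpr hx

/-- A polynomial which is not a square has infinitely many nonsquare values at multiples of `N`
which are squares locally at a place in `S` or at infinity. -/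
theorem infinite_nonsquare_values (S : Set (HeightOneSpectrum (𝓞 K))) (hS : S.Finite)
    (Q : Polynomial K) (hQ : ¬ IsSquare Q)
    (h : Odd Q.natDegree ∨ Even Q.natDegree ∧ SplitsAtPlace S Q.leadingCoeff) {N : K} (hN : N ≠ 0) :
    {t | t / N ∈ S.integer K ∧ ¬ IsSquare (Q.eval t) ∧ SplitsAtPlace S (Q.eval t)}.Infinite := by
  set Q₁ := Q.comp (Polynomial.C N * Polynomial.X) with hQ₁
  have hQ₁sq : ¬ IsSquare Q₁ := by
    rintro ⟨W, hW⟩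
    refine hQ ⟨W.comp (Polynomial.C N⁻¹ * Polynomial.X), ?_⟩
    rw [← Polynomial.mul_comp, ← hW, hQ₁, Polynomial.comp_assoc]
    have : (Polynomial.C N * Polynomial.X).comp (Polynomial.C N⁻¹ * Polynomial.X) =
        Polynomial.X := by
      rw [Polynomial.mul_comp, Polynomial.C_comp, Polynomial.X_comp, ← mul_assoc, ← Polynomial.C_mul,
        mul_inv_cancel₀ hN, Polynomial.C_1, one_mul]
    rw [this, Polynomial.comp_X]
  obtain ⟨e, b, he, hb, hb0, F, hF, hy⟩ := exists_progression_not_isSquare S hS Q₁ hQ₁sq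
  -- Restricting to the nonsquare progression multiplies the leading coefficient by (Nb)^deg Q, a
  -- square when the degree is even, so the splitting condition survives.
  set Q₂ := Q.comp (Polynomial.C (N * b) * Polynomial.X + Polynomial.C (N * e)) with hQ₂
  have hNb : N * b ≠ 0 := mul_ne_zero hN hb0
  have hlin := Polynomial.natDegree_linear (a := N * b) (b := N * e) hNb
  have hdeg : Q₂.natDegree = Q.natDegree := by rw [hQ₂, Polynomial.natDegree_comp, hlin, mul_one]
  have hlc : Q₂.leadingCoeff = Q.leadingCoeff * (N * b) ^ Q.natDegree := by
    rw [hQ₂, Polynomial.leadingCoeff_comp (by rw [hlin]; exact one_ne_zero),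
      Polynomial.leadingCoeff_linear hNb]
  have hQ₂split : Odd Q₂.natDegree ∨ Even Q₂.natDegree ∧ SplitsAtPlace S Q₂.leadingCoeff := by
    rw [hdeg]
    refine h.imp_right fun ⟨h1, h2⟩ => ⟨h1, ?_⟩
    obtain ⟨k, hk⟩ := h1
    rw [hlc, hk, ← two_mul, mul_comm 2, pow_mul, mul_comm]
    exact h2.sq_mul (pow_ne_zero k hNb)
  have hinf := infinite_splitsAtPlace_values S Q₂ hQ₂split
  have hinj : Function.Injective (fun y : K => N * (e + b * y)) := by
    intro y z hyz
    exact mul_left_cancel₀ hb0 (add_left_cancel (mul_left_cancel₀ hN hyz))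
  have hinf2 : ({y | y ∈ S.integer K ∧ SplitsAtPlace S (Q₂.eval y)} \
      (fun y => e + b * y) ⁻¹' F).Infinite := by
    refine hinf.sdiff (hF.preimage ?_)
    exact fun y _ z _ hyz => hinj (congrArg (N * ·) hyz)
  refine (hinf2.image hinj.injOn).mono ?_
  rintro _ ⟨y, ⟨⟨hyS, hysp⟩, hyF⟩, rfl⟩
  have hQ₁e : Q₁.eval (e + b * y) = Q.eval (N * (e + b * y)) := by simp [hQ₁]
  have hQ₂e : Q₂.eval y = Q.eval (N * (e + b * y)) := by
    simp only [hQ₂, Polynomial.eval_comp, Polynomial.eval_add, Polynomial.eval_mul,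
      Polynomial.eval_C, Polynomial.eval_X]
    congr 1; ring
  refine ⟨?_, ?_, ?_⟩
  · rw [mul_div_cancel_left₀ _ hN]
    exact add_mem (mem_integer_of_isIntegral S he) (mul_mem (mem_integer_of_isIntegral S hb) hyS)
  · rw [← hQ₁e]; exact hy y hyS hyF
  · rw [← hQ₂e]; exact hysp

end SplitValues

end CubicDensity

namespace CubicDensity

/-! ### Integral points on an affine conic -/

section Conic

variable {K : Type*} [Field K] [NumberField K]

/-- An affine conic through the origin, smooth there, with two conjugate points at infinity which
are rational at a place in `S` or at infinity, has infinitely many `S`-integral points. -/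
theorem infinite_integral_points_conic (S : Set (HeightOneSpectrum (𝓞 K))) {a b c d e N : K}
    (hΔ : ¬ IsSquare (b ^ 2 - 4 * a * c)) (hS : SplitsAtPlace S (b ^ 2 - 4 * a * c)) (hd : d ≠ 0)
    (hN : N ≠ 0) :
    {z : K × K | z.1 / N ∈ S.integer K ∧ z.2 / N ∈ S.integer K ∧
      a * z.1 ^ 2 + b * z.1 * z.2 + c * z.2 ^ 2 + d * z.1 + e * z.2 = 0}.Infinite := by
  set Δ := b ^ 2 - 4 * a * c with hΔdef
  have hΔ0 : Δ ≠ 0 := by intro h; rw [h] at hΔ; exact hΔ ⟨0, by simp⟩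
  -- (-α, -γ) is the centre of the conic.
  obtain ⟨α, hα⟩ : ∃ α, α = (b * e - 2 * c * d) / Δ := ⟨_, rfl⟩
  obtain ⟨γ, hγ⟩ : ∃ γ, γ = (b * d - 2 * a * e) / Δ := ⟨_, rfl⟩
  have hαΔ : α * Δ = b * e - 2 * c * d := by rw [hα]; field_simp
  have hγΔ : γ * Δ = b * d - 2 * a * e := by rw [hγ]; field_simp
  have h1 : 2 * a * α + b * γ = d := by
    apply mul_right_cancel₀ hΔ0
    linear_combination 2 * a * hαΔ + b * hγΔ - d * hΔdef
  have h2 : b * α + 2 * c * γ = e := by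
    apply mul_right_cancel₀ hΔ0
    linear_combination b * hαΔ + 2 * c * hγΔ - e * hΔdef
  obtain ⟨M, hM, hM0, hMint⟩ := exists_common_denominator {α / N, γ / N, d / N, e / N}
    (Set.toFinite _)
  have hM' : ∀ x ∈ ({α, γ, d, e} : Set K), M * (x / N) ∈ S.integer K := by
    intro x hx
    refine mem_integer_of_isIntegral S (hMint _ ?_)
    rcases hx with rfl | rfl | rfl | rfl <;> simp
  have hinf := infinite_pell S hΔ hS hM0
  -- Otherwise (e, -d) is a nonzero rational zero of the quadratic part, whose discriminant Δ would
  -- then be a square.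
  have hdet : α * d + e * γ ≠ 0 := by
    intro h0
    refine hΔ ⟨(b * d - 2 * a * e) / d, ?_⟩
    have h3 : (α * d + e * γ) * Δ = 0 := by rw [h0, zero_mul]
    have h4 : a * e ^ 2 - b * d * e + c * d ^ 2 = 0 := by
      have h5 : (2 : K) * (a * e ^ 2 - b * d * e + c * d ^ 2) = 0 := by
        linear_combination d * hαΔ + e * hγΔ - h3
      simpa using h5
    field_simp
    rw [hΔdef]
    linear_combination (-4 * a) * h4
  -- Seen from the centre, the origin is (α, γ), and the Pell solution (U, V) moves it to U(α, γ) +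
  -- V(-e, d). The identity solution (1, 0) fixes it, so solutions near (1, 0) modulo M give points
  -- near the origin modulo N.
  refine (hinf.image (f := fun z => ((z.1 - 1) * α - z.2 * e, (z.1 - 1) * γ + z.2 * d)) ?_).mono ?_
  · rintro ⟨U, V⟩ _ ⟨U', V'⟩ _ h
    simp only [Prod.mk.injEq] at h
    obtain ⟨e1, e2⟩ := h
    have hU : U = U' := by
      have : (α * d + e * γ) * (U - U') = 0 := by linear_combination d * e1 + e * e2
      rcases mul_eq_zero.mp this with h | h
      · exact absurd h hdet
      · exact sub_eq_zero.mp h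
    have hV : V = V' := by
      have : (α * d + e * γ) * (V - V') = 0 := by linear_combination α * e2 - γ * e1
      rcases mul_eq_zero.mp this with h | h
      · exact absurd h hdet
      · exact sub_eq_zero.mp h
    rw [hU, hV]
  · rintro _ ⟨⟨U, V⟩, ⟨hUV, hU, hV⟩, rfl⟩
    simp only at hUV hU hV
    refine ⟨?_, ?_, ?_⟩
    · have : ((U - 1) * α - V * e) / N = (U - 1) / M * (M * (α / N)) - V / M * (M * (e / N)) := by
        field_simp
      simp only
      rw [this]
      exact sub_mem (mul_mem hU (hM' _ (by simp))) (mul_mem hV (hM' _ (by simp)))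
    · have : ((U - 1) * γ + V * d) / N = (U - 1) / M * (M * (γ / N)) + V / M * (M * (d / N)) := by
        field_simp
      simp only
      rw [this]
      exact add_mem (mul_mem hU (hM' _ (by simp))) (mul_mem hV (hM' _ (by simp)))
    · simp only
      rw [← h1, ← h2]
      rw [hΔdef] at hUV
      linear_combination (a * α ^ 2 + b * α * γ + c * γ ^ 2) * hUV

end Conic

/-! ### Forms vanishing at many points of many conics -/

section Vanishing

variable {K : Type*} [Field K]

/-- A function `ρ₁(y) x + ρ₀(y)` vanishing at infinitely many points of a conic without rational
points at infinity is zero. -/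
lemma eq_zero_of_vanishing_on_conic [CharZero K] {b β c γ κ : K} (hΔ : ¬ IsSquare (β ^ 2 - 4 * κ))
    (ρ₁ ρ₀ : Polynomial K) (Z : Set (K × K)) (hZ : Z.Infinite)
    (hconic : ∀ z ∈ Z, z.1 ^ 2 + (b + β * z.2) * z.1 + (c + γ * z.2 + κ * z.2 ^ 2) = 0)
    (hρ : ∀ z ∈ Z, ρ₁.eval z.2 * z.1 + ρ₀.eval z.2 = 0) : ρ₁ = 0 ∧ ρ₀ = 0 := by
  -- Each y carries at most two points of the conic.
  have hsnd : (Prod.snd '' Z).Infinite := by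
    intro hfin
    refine hZ ((Set.Finite.of_finite_fibers Prod.snd hfin fun y _ => ?_))
    have hroots : {x : K | (Polynomial.X ^ 2 + Polynomial.C (b + β * y) * Polynomial.X +
        Polynomial.C (c + γ * y + κ * y ^ 2)).IsRoot x}.Finite := by
      refine Polynomial.finite_setOfPred_isRoot (Polynomial.Monic.ne_zero ?_)
      monicity!
    refine (hroots.image (fun x => (x, y))).subset ?_
    rintro ⟨x, y'⟩ ⟨hz, rfl⟩
    refine ⟨x, ?_, rfl⟩
    have := hconic _ hz
    simpa [Polynomial.IsRoot] using this
  have hzero : ∀ P : Polynomial K, (∀ z ∈ Z, P.eval z.2 = 0) → P = 0 := by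
    intro P hP
    refine Polynomial.eq_zero_of_infinite_isRoot P (hsnd.mono ?_)
    rintro _ ⟨z, hz, rfl⟩
    exact hP z hz
  set L : Polynomial K := Polynomial.C b + Polynomial.C β * Polynomial.X with hL
  set M : Polynomial K := Polynomial.C c + Polynomial.C γ * Polynomial.X +
    Polynomial.C κ * Polynomial.X ^ 2 with hM
  set D : Polynomial K := Polynomial.C (β ^ 2 - 4 * κ) * Polynomial.X ^ 2 +
    Polynomial.C (2 * b * β - 4 * γ) * Polynomial.X + Polynomial.C (b ^ 2 - 4 * c) with hD
  have hΔ0 : β ^ 2 - 4 * κ ≠ 0 := by intro h; rw [h] at hΔ; exact hΔ ⟨0, by simp⟩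
  have hDLM : D = L ^ 2 - 4 * M := by
    rw [hD, hL, hM]
    simp only [map_sub, map_mul, map_pow, map_ofNat]
    ring
  -- Eliminating x between the conic and ρ₁x + ρ₀ = 0 turns the vanishing into an identity in y. As
  -- D has nonsquare leading coefficient, comparing leading terms forces ρ₁ = 0.
  have hident : (2 * ρ₀ - L * ρ₁) ^ 2 - ρ₁ ^ 2 * D = 0 := by
    apply hzero
    intro z hz
    have h1 := hconic z hz
    have h2 := hρ z hz
    rw [hDLM]
    simp only [hL, hM, Polynomial.eval_sub, Polynomial.eval_add, Polynomial.eval_mul,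
      Polynomial.eval_pow, Polynomial.eval_C, Polynomial.eval_X, Polynomial.eval_ofNat]
    have h3 : ρ₀.eval z.2 = - (ρ₁.eval z.2 * z.1) := by linear_combination h2
    rw [h3]
    linear_combination 4 * (ρ₁.eval z.2) ^ 2 * h1
  have hρ₁ : ρ₁ = 0 := by
    by_contra hne
    have hlc := congrArg Polynomial.leadingCoeff (sub_eq_zero.mp hident)
    rw [Polynomial.leadingCoeff_pow, Polynomial.leadingCoeff_mul, Polynomial.leadingCoeff_pow, hD,
      Polynomial.leadingCoeff_quadratic hΔ0] at hlc
    have hlc0 : ρ₁.leadingCoeff ≠ 0 := Polynomial.leadingCoeff_ne_zero.mpr hne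
    refine hΔ ⟨(2 * ρ₀ - L * ρ₁).leadingCoeff / ρ₁.leadingCoeff, ?_⟩
    field_simp
    linear_combination -hlc
  refine ⟨hρ₁, hzero _ fun z hz => ?_⟩
  simpa [hρ₁] using hρ z hz

/-- Pseudo-division by a quadratic polynomial. -/
lemma exists_pseudo_division {R : Type*} [CommRing R] (l b c : R) (G : Polynomial R) :
    ∃ (k : ℕ) (A : Polynomial R) (r₁ r₀ : R), Polynomial.C l ^ k * G =
      (Polynomial.C l * Polynomial.X ^ 2 + Polynomial.C b * Polynomial.X + Polynomial.C c) * A +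
        Polynomial.C r₁ * Polynomial.X + Polynomial.C r₀ := by
  induction G using Polynomial.induction_on' with
  | add p q hp hq =>
    obtain ⟨k, A, r₁, r₀, h⟩ := hp
    obtain ⟨k', A', r₁', r₀', h'⟩ := hq
    refine ⟨k + k', Polynomial.C l ^ k' * A + Polynomial.C l ^ k * A',
      l ^ k' * r₁ + l ^ k * r₁', l ^ k' * r₀ + l ^ k * r₀', ?_⟩
    simp only [map_add, map_mul, map_pow]
    linear_combination Polynomial.C l ^ k' * h + Polynomial.C l ^ k * h'
  | monomial n a =>
    have hX : ∃ (k : ℕ) (A : Polynomial R) (r₁ r₀ : R), Polynomial.C l ^ k * Polynomial.X ^ n =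
      (Polynomial.C l * Polynomial.X ^ 2 + Polynomial.C b * Polynomial.X + Polynomial.C c) * A +
        Polynomial.C r₁ * Polynomial.X + Polynomial.C r₀ := by
      induction n with
      | zero => exact ⟨0, 0, 0, 1, by simp⟩
      | succ n ih =>
        obtain ⟨k, A, r₁, r₀, h⟩ := ih
        refine ⟨k + 1, Polynomial.C l * A * Polynomial.X + Polynomial.C r₁, l * r₀ - r₁ * b,
          - (r₁ * c), ?_⟩
        simp only [map_sub, map_mul, map_neg]
        linear_combination Polynomial.C l * Polynomial.X * h
    obtain ⟨k, A, r₁, r₀, h⟩ := hX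
    refine ⟨k, Polynomial.C a * A, a * r₁, a * r₀, ?_⟩
    rw [← Polynomial.C_mul_X_pow_eq_monomial]
    simp only [map_mul]
    linear_combination Polynomial.C a * h

/-- A polynomial in three variables vanishing at `(λ, λ x y, λ y)` for all `λ ≠ 0`, all `y` and
infinitely many `x` is zero. -/
lemma eq_zero_of_vanishing_on_pencil [Infinite K] (r : MvPolynomial (Fin 3) K) (Z : Set K)
    (hZ : Z.Infinite)
    (h : ∀ x ∈ Z, ∀ y l : K, l ≠ 0 → MvPolynomial.eval ![l, l * (x * y), l * y] r = 0) : r = 0 := by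
  have h1 : ∀ v : Fin 3 → K, v 0 ≠ 0 → v 2 ≠ 0 → MvPolynomial.eval v r = 0 := by
    intro v hv0 hv2
    let P : Polynomial K := MvPolynomial.aeval
      ![Polynomial.C (v 0), Polynomial.X, Polynomial.C (v 2)] r
    have hP : ∀ s, P.eval s = MvPolynomial.eval ![v 0, s, v 2] r := by
      intro s
      have : (Polynomial.aeval s : Polynomial K →ₐ[K] K) P =
          MvPolynomial.aeval ![v 0, s, v 2] r := by
        rw [← AlgHom.comp_apply, MvPolynomial.comp_aeval]
        congr 2
        funext i
        fin_cases i <;> simp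
      simpa [Polynomial.coe_aeval_eq_eval, MvPolynomial.aeval_eq_eval] using this
    have hP0 : P = 0 := by
      refine Polynomial.eq_zero_of_infinite_isRoot P
        ((hZ.image (f := fun x => x * v 2) ?_).mono ?_)
      · exact fun x _ y _ hxy => mul_right_cancel₀ hv2 hxy
      · rintro _ ⟨x, hx, rfl⟩
        change P.eval _ = 0
        rw [hP]
        have := h x hx (v 2 / v 0) (v 0) hv0
        convert this using 3
        field_simp
    have := hP (v 1)
    rw [hP0, Polynomial.eval_zero] at this
    rw [this]
    congr 2
    funext i
    fin_cases i <;> rfl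
  have h2 : r * (X 0 * X 2) = 0 := by
    apply MvPolynomial.funext
    intro v
    simp only [map_mul, MvPolynomial.eval_X, map_zero]
    by_cases hv0 : v 0 = 0
    · simp [hv0]
    by_cases hv2 : v 2 = 0
    · simp [hv2]
    rw [h1 v hv0 hv2, zero_mul]
  exact (mul_eq_zero.mp h2).resolve_right (mul_ne_zero (X_ne_zero 0) (X_ne_zero 2))

lemma dvd_of_dvd_prime_pow_mul {R : Type*} [CommRing R] [IsDomain R] {p f g : R} (hp : Prime p)
    (hpf : ¬ p ∣ f) (k : ℕ) (h : f ∣ p ^ k * g) : f ∣ g := by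
  induction k with
  | zero => simpa using h
  | succ k ih =>
    obtain ⟨a, ha⟩ := h
    have hpa : p ∣ a := by
      have : p ∣ f * a := ⟨p ^ k * g, by rw [← ha]; ring⟩
      exact (hp.dvd_or_dvd this).resolve_left hpf
    obtain ⟨a', rfl⟩ := hpa
    refine ih ⟨a', mul_left_cancel₀ hp.ne_zero ?_⟩
    linear_combination ha

end Vanishing

end CubicDensity

/-! ### Cubic forms containing a line, and the density criterion -/

namespace CubicDensity

lemma aeval_smul_of_isHomogeneous {R A σ : Type*} [CommSemiring R] [CommSemiring A] [Algebra R A]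
    {n : ℕ} {g : MvPolynomial σ R} (hg : g.IsHomogeneous n) (l : A) (x : σ → A) :
    MvPolynomial.aeval (l • x) g = l ^ n * MvPolynomial.aeval x g := by
  rw [MvPolynomial.aeval_def, MvPolynomial.aeval_def, MvPolynomial.eval₂_eq, MvPolynomial.eval₂_eq,
    Finset.mul_sum]
  refine Finset.sum_congr rfl fun d hd => ?_
  have h := hg (MvPolynomial.mem_support_iff.mp hd)
  rw [Finsupp.weight_apply] at h
  simp only [Pi.one_apply, smul_eq_mul, mul_one, Finsupp.sum] at h
  simp only [Pi.smul_apply, smul_eq_mul, mul_pow, Finset.prod_mul_distrib, Finset.prod_pow_eq_pow_sum,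
    h]
  ring

/-- The coefficients of a cubic form in coordinates `X₀, …, X₃` which vanishes on the line
`X₂ = X₃ = 0` and has leading coefficient `X₃` in `X₀`. -/
structure LineCubic (K : Type*) where
  (b₂ b₃ c₂ c₃ β₀ β₁ β₂ γ₀ γ₁ γ₂ κ₀ κ₁ κ₂ κ₃ : K)

namespace LineCubic

section Form

variable {K : Type*} [CommRing K] (D : LineCubic K) {A : Type*} [CommRing A] [Algebra K A]

/-- The cubic form with given coefficients. -/
def form (x : Fin 4 → A) : A :=
  x 3 * x 0 ^ 2
    + x 0 * x 1 * (algebraMap K A D.b₂ * x 2 + algebraMap K A D.b₃ * x 3)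
    + x 0 * (algebraMap K A D.β₀ * x 2 ^ 2 + algebraMap K A D.β₁ * x 2 * x 3
        + algebraMap K A D.β₂ * x 3 ^ 2)
    + x 1 ^ 2 * (algebraMap K A D.c₂ * x 2 + algebraMap K A D.c₃ * x 3)
    + x 1 * (algebraMap K A D.γ₀ * x 2 ^ 2 + algebraMap K A D.γ₁ * x 2 * x 3
        + algebraMap K A D.γ₂ * x 3 ^ 2)
    + algebraMap K A D.κ₀ * x 2 ^ 3 + algebraMap K A D.κ₁ * x 2 ^ 2 * x 3
    + algebraMap K A D.κ₂ * x 2 * x 3 ^ 2 + algebraMap K A D.κ₃ * x 3 ^ 3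

lemma map_form {B : Type*} [CommRing B] [Algebra K B] (φ : A →ₐ[K] B) (x : Fin 4 → A) :
    φ (D.form x) = D.form (fun i => φ (x i)) := by
  simp only [form, map_add, map_mul, map_pow, AlgHom.commutes]

/-- The linear form `A` on the line, with inhomogeneous coordinate `t`. -/
noncomputable def lineA : Polynomial K := Polynomial.C D.b₂ * Polynomial.X + Polynomial.C D.c₂

/-- The quadratic form `B` on the line, with inhomogeneous coordinate `t`. -/
noncomputable def lineB : Polynomial K :=
  Polynomial.X ^ 2 + Polynomial.C D.b₃ * Polynomial.X + Polynomial.C D.c₃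

/-- The discriminant of the pair of boundary points on the fibre through the point `t` of the
line. -/
noncomputable def disc : Polynomial K :=
  (Polynomial.C D.β₀ * D.lineB ^ 2 - Polynomial.C D.β₁ * D.lineA * D.lineB
      + Polynomial.C D.β₂ * D.lineA ^ 2) ^ 2
    - 4 * D.lineA * (-(Polynomial.C D.κ₀ * D.lineB ^ 3) + Polynomial.C D.κ₁ * D.lineB ^ 2 * D.lineA
      - Polynomial.C D.κ₂ * D.lineB * D.lineA ^ 2 + Polynomial.C D.κ₃ * D.lineA ^ 3)

end Form

section Field

variable {K : Type*} [Field K] (D : LineCubic K)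

/-- Prepares the pseudo-division by `form` in the variable X₀, where its leading coefficient is X₃.
-/
lemma finSuccEquiv_form : MvPolynomial.finSuccEquiv K 3 (D.form MvPolynomial.X) =
    Polynomial.C (X 2) * Polynomial.X ^ 2
    + Polynomial.C (X 0 * (C D.b₂ * X 1 + C D.b₃ * X 2) + (C D.β₀ * X 1 ^ 2 + C D.β₁ * X 1 * X 2
        + C D.β₂ * X 2 ^ 2)) * Polynomial.X
    + Polynomial.C (X 0 ^ 2 * (C D.c₂ * X 1 + C D.c₃ * X 2)
        + X 0 * (C D.γ₀ * X 1 ^ 2 + C D.γ₁ * X 1 * X 2 + C D.γ₂ * X 2 ^ 2)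
        + C D.κ₀ * X 1 ^ 3 + C D.κ₁ * X 1 ^ 2 * X 2
        + C D.κ₂ * X 1 * X 2 ^ 2 + C D.κ₃ * X 2 ^ 3) := by
  have h0 := MvPolynomial.finSuccEquiv_X_zero (R := K) (n := 3)
  have h1 := MvPolynomial.finSuccEquiv_X_succ (R := K) (n := 3) (j := 0)
  have h2 := MvPolynomial.finSuccEquiv_X_succ (R := K) (n := 3) (j := 1)
  have h3 := MvPolynomial.finSuccEquiv_X_succ (R := K) (n := 3) (j := 2)
  have hc : ∀ a : K, algebraMap K (Polynomial (MvPolynomial (Fin 3) K)) a =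
      Polynomial.C (C a) := fun a => rfl
  have e := D.map_form (MvPolynomial.finSuccEquiv K 3).toAlgHom MvPolynomial.X
  change MvPolynomial.finSuccEquiv K 3 _ = D.form (fun i => MvPolynomial.finSuccEquiv K 3 (X i)) at e
  rw [e]
  change _ = Polynomial.C (X 0) at h1
  change _ = Polynomial.C (X 1) at h2
  change _ = Polynomial.C (X 2) at h3
  change MvPolynomial.finSuccEquiv K 3 (X 1) = _ at h1
  change MvPolynomial.finSuccEquiv K 3 (X 2) = _ at h2
  change MvPolynomial.finSuccEquiv K 3 (X 3) = _ at h3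
  simp only [form, h0, h1, h2, h3, hc, map_add, map_mul, map_pow]
  ring

/-- Modulo X₃ the form still contains b₂X₀X₁X₂ + c₂X₁²X₂; the five chosen points isolate these two
coefficients. This allows powers of X₃ to be cancelled after pseudo-division. -/
lemma not_X_dvd_form [CharZero K] (h : D.b₂ ≠ 0 ∨ D.c₂ ≠ 0) :
    ¬ (X 3 : MvPolynomial (Fin 4) K) ∣ D.form MvPolynomial.X := by
  rintro ⟨G, hG⟩
  have key : ∀ s t : K, D.form ![s, 1, t, 0] = 0 := by
    intro s t
    have h1 := congrArg (MvPolynomial.aeval (![s, 1, t, 0] : Fin 4 → K)) hG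
    rw [D.map_form, map_mul] at h1
    simp only [MvPolynomial.aeval_X] at h1
    rw [h1]; simp
  have k1 := key 0 1
  have k2 := key 0 (-1)
  have k3 := key 0 2
  have k4 := key 1 1
  have k5 := key 1 (-1)
  simp only [form, Algebra.algebraMap_self, RingHom.id_apply, Matrix.cons_val] at k1 k2 k3 k4 k5
  have hb : D.b₂ = 0 := by linear_combination (k4 - k1 - k5 + k2) / 2
  have hc : D.c₂ = 0 := by linear_combination k1 - k2 / 3 - k3 / 6
  rcases h with h | h
  · exact h hb
  · exact h hc

/-- x = -B/A is the plane whose residual conic passes through the point t of the line. Up to a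
square, `disc` is thus the discriminant of that conic at infinity. -/
lemma eval_disc (t x : K) (hA : D.lineA.eval t ≠ 0) (hx : x = - D.lineB.eval t / D.lineA.eval t) :
    D.disc.eval t = (D.lineA.eval t ^ 2) ^ 2 *
      ((D.β₀ * x ^ 2 + D.β₁ * x + D.β₂) ^ 2
        - 4 * (D.κ₀ * x ^ 3 + D.κ₁ * x ^ 2 + D.κ₂ * x + D.κ₃)) := by
  simp only [disc, Polynomial.eval_add, Polynomial.eval_sub, Polynomial.eval_mul,
    Polynomial.eval_pow, Polynomial.eval_C, Polynomial.eval_neg, Polynomial.eval_ofNat]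
  rw [hx]
  field_simp
  ring

end Field

section Density

variable {K : Type*} [Field K] [NumberField K] (D : LineCubic K)

/-- If the discriminant `D.disc` is not a square and takes values which are locally squares, then
the `S`-integral points of the affine surface `D.form = 0`, `X₁ = 1` are dense. -/
theorem form_dvd_of_vanishing (S : Set (HeightOneSpectrum (𝓞 K))) (hS : S.Finite)
    (hbc : D.b₂ ≠ 0 ∨ D.c₂ ≠ 0) (hsq : ¬ IsSquare D.disc)
    (hdeg : Odd D.disc.natDegree ∨ Even D.disc.natDegree ∧ SplitsAtPlace S D.disc.leadingCoeff)
    {N : K} (hN : N ≠ 0) {n : ℕ} (g : MvPolynomial (Fin 4) K) (hg : g.IsHomogeneous n)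
    (hvan : ∀ X₀ X₂ X₃ : K, X₀ / N ∈ S.integer K → X₂ / N ∈ S.integer K → X₃ / N ∈ S.integer K →
      D.form ![X₀, 1, X₂, X₃] = 0 → MvPolynomial.eval ![X₀, 1, X₂, X₃] g = 0) :
    D.form MvPolynomial.X ∣ g := by
  set T := {t | t / N ∈ S.integer K ∧ ¬ IsSquare (D.disc.eval t) ∧
    SplitsAtPlace S (D.disc.eval t)} with hT
  have hTinf : T.Infinite := infinite_nonsquare_values S hS D.disc hsq hdeg hN
  -- the points of the line at which the fibre is tangent to it
  set W : Polynomial K := Polynomial.C (-D.b₂) * Polynomial.X ^ 2 +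
    Polynomial.C (-2 * D.c₂) * Polynomial.X + Polynomial.C (D.b₂ * D.c₃ - D.b₃ * D.c₂) with hW
  have hW0 : W ≠ 0 := by
    intro h0
    have h2 := congrArg (fun P => Polynomial.coeff P 2) h0
    have h1 := congrArg (fun P => Polynomial.coeff P 1) h0
    simp [hW, Polynomial.coeff_C] at h1 h2
    rcases hbc with h | h
    · exact h h2
    · exact h h1
  set T' := T \ {t | W.IsRoot t} with hT'
  have hT'inf : T'.Infinite := hTinf.sdiff (Polynomial.finite_setOfPred_isRoot hW0)
  -- At a zero of A the discriminant is the square (β₀B²)².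
  have hA : ∀ t ∈ T, D.lineA.eval t ≠ 0 := by
    rintro t ⟨-, ht, -⟩ h0
    apply ht
    refine ⟨D.β₀ * D.lineB.eval t ^ 2, ?_⟩
    simp only [disc, Polynomial.eval_add, Polynomial.eval_sub, Polynomial.eval_mul,
      Polynomial.eval_pow, Polynomial.eval_C, Polynomial.eval_neg, Polynomial.eval_ofNat, h0]
    ring
  set ξ : K → K := fun t => - D.lineB.eval t / D.lineA.eval t with hξ
  -- The plane x meets the line residually in at most two points t, the roots of B + xA, so
  -- infinitely many t give infinitely many planes.
  have hξinf : (ξ '' T').Infinite := by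
    intro hfin
    refine hT'inf (Set.Finite.of_finite_fibers ξ hfin fun x _ => ?_)
    have hroots : {t : K | (Polynomial.X ^ 2 + Polynomial.C (D.b₃ + x * D.b₂) * Polynomial.X +
        Polynomial.C (D.c₃ + x * D.c₂)).IsRoot t}.Finite := by
      refine Polynomial.finite_setOfPred_isRoot (Polynomial.Monic.ne_zero ?_)
      monicity!
    refine hroots.subset ?_
    rintro t ⟨ht, rfl⟩
    have hAt := hA t ht.1
    have hAx : D.lineA.eval t * ξ t + D.lineB.eval t = 0 := by
      rw [hξ]; field_simp; ring
    simp only [Set.mem_ofPred_eq, Polynomial.IsRoot, Polynomial.eval_add, Polynomial.eval_mul,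
      Polynomial.eval_pow, Polynomial.eval_C, Polynomial.eval_X]
    generalize ξ t = z at hAx
    simp only [lineA, lineB, Polynomial.eval_add, Polynomial.eval_mul,
      Polynomial.eval_pow, Polynomial.eval_C, Polynomial.eval_X] at hAx
    linear_combination hAx
  -- X₃^k g = form · A + r₁X₀ + r₀. It remains to show that r₁ and r₀ vanish.
  obtain ⟨k, A, r₁, r₀, hpd⟩ := exists_pseudo_division
    (X 2 : MvPolynomial (Fin 3) K)
    (X 0 * (C D.b₂ * X 1 + C D.b₃ * X 2) + (C D.β₀ * X 1 ^ 2 + C D.β₁ * X 1 * X 2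
        + C D.β₂ * X 2 ^ 2))
    (X 0 ^ 2 * (C D.c₂ * X 1 + C D.c₃ * X 2)
        + X 0 * (C D.γ₀ * X 1 ^ 2 + C D.γ₁ * X 1 * X 2 + C D.γ₂ * X 2 ^ 2)
        + C D.κ₀ * X 1 ^ 3 + C D.κ₁ * X 1 ^ 2 * X 2
        + C D.κ₂ * X 1 * X 2 ^ 2 + C D.κ₃ * X 2 ^ 3)
    (MvPolynomial.finSuccEquiv K 3 g)
  rw [← D.finSuccEquiv_form] at hpd
  -- the remainder vanishes at the integral points
  have hrem : ∀ (l X₀ X₂ X₃ : K), X₀ / N ∈ S.integer K → X₂ / N ∈ S.integer K →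
      X₃ / N ∈ S.integer K → D.form ![X₀, 1, X₂, X₃] = 0 →
      MvPolynomial.eval ![l, l * X₂, l * X₃] r₁ * (l * X₀) +
        MvPolynomial.eval ![l, l * X₂, l * X₃] r₀ = 0 := by
    intro l X₀ X₂ X₃ h0 h2 h3 hf
    have hg0 := hvan X₀ X₂ X₃ h0 h2 h3 hf
    have hcons : (Fin.cons (l * X₀) ![l, l * X₂, l * X₃] : Fin 4 → K) =
        l • (![X₀, 1, X₂, X₃] : Fin 4 → K) := by
      funext i
      fin_cases i <;> simp
    have hgl : MvPolynomial.eval (l • (![X₀, 1, X₂, X₃] : Fin 4 → K)) g = 0 := by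
      have := aeval_smul_of_isHomogeneous hg l (![X₀, 1, X₂, X₃] : Fin 4 → K)
      rw [MvPolynomial.aeval_eq_eval, MvPolynomial.aeval_eq_eval] at this
      exact this.trans (by rw [hg0, mul_zero])
    have hfl : MvPolynomial.eval (l • (![X₀, 1, X₂, X₃] : Fin 4 → K)) (D.form MvPolynomial.X) = 0 := by
      have h1 := D.map_form (MvPolynomial.aeval (l • (![X₀, 1, X₂, X₃] : Fin 4 → K)))
        MvPolynomial.X
      simp only [MvPolynomial.aeval_X] at h1
      rw [MvPolynomial.aeval_eq_eval] at h1
      refine h1.trans ?_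
      have h2 : D.form (fun i => (l • (![X₀, 1, X₂, X₃] : Fin 4 → K)) i) =
          l ^ 3 * D.form ![X₀, 1, X₂, X₃] := by
        simp only [form, Pi.smul_apply, smul_eq_mul, Matrix.cons_val]
        ring
      rw [h2, hf, mul_zero]
    rw [← hcons, MvPolynomial.eval_eq_eval_mv_eval'] at hgl hfl
    have h4 := congrArg (fun P => Polynomial.eval (l * X₀)
      (Polynomial.map (MvPolynomial.eval ![l, l * X₂, l * X₃]) P)) hpd
    simp only [Polynomial.map_mul, Polynomial.map_add, Polynomial.map_pow, Polynomial.map_C,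
      Polynomial.map_X, Polynomial.eval_mul, Polynomial.eval_add, Polynomial.eval_pow,
      Polynomial.eval_C, Polynomial.eval_X, hgl, hfl] at h4
    linear_combination -h4
  have hrzero : ∀ x ∈ ξ '' T', ∀ y l : K, l ≠ 0 →
      MvPolynomial.eval ![l, l * (x * y), l * y] r₁ = 0 ∧
      MvPolynomial.eval ![l, l * (x * y), l * y] r₀ = 0 := by
    rintro x ⟨t, ⟨htT, htW⟩, rfl⟩ y l hl
    have hAt := hA t htT
    obtain ⟨htN, htsq, htsp⟩ := htT
    obtain ⟨x, hx⟩ : ∃ x, x = ξ t := ⟨_, rfl⟩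
    rw [← hx]
    obtain ⟨b, hb⟩ : ∃ b, b = D.b₂ * x + D.b₃ := ⟨_, rfl⟩
    obtain ⟨β, hβ⟩ : ∃ β, β = D.β₀ * x ^ 2 + D.β₁ * x + D.β₂ := ⟨_, rfl⟩
    obtain ⟨c, hc⟩ : ∃ c, c = D.c₂ * x + D.c₃ := ⟨_, rfl⟩
    obtain ⟨γ, hγ⟩ : ∃ γ, γ = D.γ₀ * x ^ 2 + D.γ₁ * x + D.γ₂ := ⟨_, rfl⟩
    obtain ⟨κ, hκ⟩ : ∃ κ, κ = D.κ₀ * x ^ 3 + D.κ₁ * x ^ 2 + D.κ₂ * x + D.κ₃ := ⟨_, rfl⟩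
    have hdisc : D.disc.eval t = (D.lineA.eval t ^ 2) ^ 2 * (β ^ 2 - 4 * κ) := by
      rw [D.eval_disc t x hAt hx, hβ, hκ]
    have hΔsq : ¬ IsSquare (β ^ 2 - 4 * κ) := by
      rintro ⟨z, hz⟩
      exact htsq ⟨D.lineA.eval t ^ 2 * z, by rw [hdisc, hz]; ring⟩
    have hΔsp : SplitsAtPlace S (β ^ 2 - 4 * κ) := by
      have : β ^ 2 - 4 * κ = ((D.lineA.eval t ^ 2)⁻¹) ^ 2 * D.disc.eval t := by
        rw [hdisc]; field_simp
      rw [this]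
      exact htsp.sq_mul (inv_ne_zero (pow_ne_zero 2 hAt))
    have hAx : D.lineA.eval t * x + D.lineB.eval t = 0 := by
      rw [hx, hξ]; field_simp; ring
    simp only [lineA, lineB, Polynomial.eval_add, Polynomial.eval_mul,
      Polynomial.eval_pow, Polynomial.eval_C, Polynomial.eval_X] at hAx hAt
    have htbc : t ^ 2 + b * t + c = 0 := by rw [hb, hc]; linear_combination hAx
    -- Nonvanishing of W says that the conic is transverse to the line at t, which is the smoothness
    -- needed at the base point.
    have hd : 2 * t + b ≠ 0 := by
      intro h0
      apply htW
      simp only [Set.mem_ofPred_eq, Polynomial.IsRoot, hW, Polynomial.eval_add, Polynomial.eval_mul,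
        Polynomial.eval_pow, Polynomial.eval_C, Polynomial.eval_X]
      rw [hb] at h0
      linear_combination D.b₂ * hAx - (D.b₂ * t + D.c₂) * h0
    -- x need not be S-integral. Working modulo NM keeps X₂ = xy divisible by N.
    obtain ⟨M, hM, hM0, hMx⟩ := exists_common_denominator {x} (Set.finite_singleton x)
    have hMx' := mem_integer_of_isIntegral S (hMx x rfl)
    have hM' := mem_integer_of_isIntegral S hM
    -- The residual conic translated so that its point (X₀, y) = (t, 0) on the line becomes the
    -- origin.
    have hconic := infinite_integral_points_conic S (a := 1) (b := β) (c := κ) (d := 2 * t + b)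
      (e := β * t + γ) (N := N * M) (by simpa using hΔsq) (by simpa using hΔsp) hd
      (mul_ne_zero hN hM0)
    have hline : ∀ r : MvPolynomial (Fin 3) K, ∃ ρ : Polynomial K, ∀ y : K,
        ρ.eval y = MvPolynomial.eval ![l, l * (x * y), l * y] r := by
      intro r
      refine ⟨MvPolynomial.aeval ![Polynomial.C l, Polynomial.C (l * x) * Polynomial.X,
        Polynomial.C l * Polynomial.X] r, fun y => ?_⟩
      have : (Polynomial.aeval y : Polynomial K →ₐ[K] K) (MvPolynomial.aeval
          ![Polynomial.C l, Polynomial.C (l * x) * Polynomial.X, Polynomial.C l * Polynomial.X] r) =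
          MvPolynomial.aeval ![l, l * (x * y), l * y] r := by
        rw [← AlgHom.comp_apply, MvPolynomial.comp_aeval]
        congr 2
        funext i
        fin_cases i <;> simp [mul_assoc]
      simpa [Polynomial.coe_aeval_eq_eval, MvPolynomial.aeval_eq_eval] using this
    obtain ⟨ρ₁, hρ₁⟩ := hline r₁
    obtain ⟨ρ₀, hρ₀⟩ := hline r₀
    have hzero := eq_zero_of_vanishing_on_conic (b := b) (β := β) (c := c) (γ := γ) (κ := κ)
      hΔsq (Polynomial.C l * ρ₁) ρ₀ _
      (hconic.image (f := fun z => (t + z.1, z.2)) (by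
        rintro ⟨z₁, z₂⟩ _ ⟨z₁', z₂'⟩ _ h
        simpa using h)) (by
        rintro _ ⟨z, ⟨-, -, hz⟩, rfl⟩
        simp only
        linear_combination hz + htbc) (by
        rintro _ ⟨z, ⟨hz1, hz2, hz⟩, rfl⟩
        have hz2' : z.2 / N ∈ S.integer K := by
          have : z.2 / N = M * (z.2 / (N * M)) := by field_simp
          rw [this]; exact mul_mem hM' hz2
        have := hrem l (t + z.1) (x * z.2) z.2 ?_ ?_ hz2' ?_
        · simp only [Polynomial.eval_mul, Polynomial.eval_C, hρ₁, hρ₀]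
          linear_combination this
        · have e : (t + z.1) / N = t / N + M * (z.1 / (N * M)) := by field_simp
          rw [e]; exact add_mem htN (mul_mem hM' hz1)
        · have e : x * z.2 / N = M * x * (z.2 / (N * M)) := by field_simp
          rw [e]; exact mul_mem hMx' hz2
        · simp only [form, Algebra.algebraMap_self, RingHom.id_apply, Matrix.cons_val]
          rw [hb] at hz htbc
          rw [hβ, hγ, hκ] at hz
          rw [hc] at htbc
          linear_combination z.2 * (hz + htbc))
    rw [← hρ₁, ← hρ₀, hzero.2]
    refine ⟨?_, by simp⟩
    have := hzero.1
    rw [mul_eq_zero, Polynomial.C_eq_zero] at this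
    rw [this.resolve_left hl, Polynomial.eval_zero]
  have hr₁ : r₁ = 0 := eq_zero_of_vanishing_on_pencil r₁ _ hξinf
    fun x hx y l hl => (hrzero x hx y l hl).1
  have hr₀ : r₀ = 0 := eq_zero_of_vanishing_on_pencil r₀ _ hξinf
    fun x hx y l hl => (hrzero x hx y l hl).2
  have hdvd : D.form MvPolynomial.X ∣ (X 3 : MvPolynomial (Fin 4) K) ^ k * g := by
    refine ⟨(MvPolynomial.finSuccEquiv K 3).symm A, ?_⟩
    apply (MvPolynomial.finSuccEquiv K 3).injective
    have h3 := MvPolynomial.finSuccEquiv_X_succ (R := K) (n := 3) (j := 2)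
    change MvPolynomial.finSuccEquiv K 3 (X 3) = Polynomial.C (X 2) at h3
    rw [map_mul, map_pow, h3, hpd, hr₁, hr₀, map_mul, AlgEquiv.apply_symm_apply]
    simp
  exact dvd_of_dvd_prime_pow_mul MvPolynomial.X_prime (D.not_X_dvd_form hbc) k hdvd

end Density

end LineCubic

end CubicDensity

/-! ### When the discriminant along the line is a square -/

namespace CubicDensity

/-- An element of an integrally closed domain
which is a square in the fraction field is a square. -/
lemma isSquare_of_isSquare_algebraMap {R F : Type*} [CommRing R] [IsDomain R]
    [IsIntegrallyClosed R] [Field F] [Algebra R F] [IsFractionRing R F] {a : R}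
    (h : IsSquare (algebraMap R F a)) : IsSquare a := by
  obtain ⟨z, hz⟩ := h
  have hint : IsIntegral R z :=
    ⟨Polynomial.X ^ 2 - Polynomial.C a, Polynomial.monic_X_pow_sub_C a two_ne_zero, by
      simp [hz, sq]⟩
  obtain ⟨y, rfl⟩ := IsIntegrallyClosed.isIntegral_iff.mp hint
  exact ⟨y, IsFractionRing.injective R F (by rw [hz, map_mul])⟩

/-- An element which becomes a square after adjoining a square root of `d` is a square, or is
`d` times a square. -/
lemma isSquare_or_isSquare_mul {k : Type*} [Field k] [NeZero (2 : k)] {a d : k}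
    (h : IsSquare (algebraMap k (QuadraticAlgebra k d 0) a)) : IsSquare a ∨ IsSquare (a * d) := by
  obtain ⟨z, hz⟩ := h
  have h1 := congrArg QuadraticAlgebra.re hz
  have h2 := congrArg QuadraticAlgebra.im hz
  simp at h1 h2
  have h3 : z.re * z.im = 0 := by
    have : (2 : k) * (z.re * z.im) = 0 := by linear_combination -h2
    exact (mul_eq_zero.mp this).resolve_left two_ne_zero
  rcases mul_eq_zero.mp h3 with h | h
  · exact Or.inr ⟨z.im * d, by rw [h1, h]; ring⟩
  · exact Or.inl ⟨z.re, by rw [h1, h]; ring⟩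

namespace LineCubic

section Discriminants

variable {K : Type*} [Field K] (D : LineCubic K)

/-- The discriminant of the projection of the boundary from the point `X₁ = X₂ = X₃ = 0`. -/
noncomputable def boundaryDisc : Polynomial K :=
  (Polynomial.C D.β₀ * Polynomial.X ^ 2 + Polynomial.C D.β₁ * Polynomial.X
      + Polynomial.C D.β₂) ^ 2
    - 4 * (Polynomial.C D.κ₀ * Polynomial.X ^ 3 + Polynomial.C D.κ₁ * Polynomial.X ^ 2
      + Polynomial.C D.κ₂ * Polynomial.X + Polynomial.C D.κ₃)

/-- The discriminant of the map from the line to the pencil of planes containing it. -/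
noncomputable def lineDisc : Polynomial K :=
  (Polynomial.C D.b₂ * Polynomial.X + Polynomial.C D.b₃) ^ 2
    - 4 * (Polynomial.C D.c₂ * Polynomial.X + Polynomial.C D.c₃)

/-- Over a field where `lineDisc` is a square, the residual conic in the generic plane x meets the
line in a rational point t. There disc(t) = A(t)⁴ · boundaryDisc(x), so a square root of `disc`
yields one of `boundaryDisc`. -/
lemma isSquare_boundaryDisc_of_isSquare_lineDisc [CharZero K] (hbc : D.b₂ ≠ 0 ∨ D.c₂ ≠ 0)
    (hsq : IsSquare D.disc) {F : Type*} [Field F] [Algebra (Polynomial K) F]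
    (hinj : Function.Injective (algebraMap (Polynomial K) F))
    (h : IsSquare (algebraMap (Polynomial K) F D.lineDisc)) :
    IsSquare (algebraMap (Polynomial K) F D.boundaryDisc) := by
  obtain ⟨i, hi⟩ : ∃ i : K →+* F, i = (algebraMap (Polynomial K) F).comp Polynomial.C := ⟨_, rfl⟩
  obtain ⟨x, hx⟩ : ∃ x : F, x = algebraMap (Polynomial K) F Polynomial.X := ⟨_, rfl⟩
  have hiC : ∀ a, algebraMap (Polynomial K) F (Polynomial.C a) = i a := fun a => by simp [hi]
  have htr : ∀ a : K, x ≠ i a := by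
    intro a hxa
    rw [hx, ← hiC] at hxa
    exact Polynomial.X_ne_C a (hinj hxa)
  have hchar : (2 : F) ≠ 0 := by
    have : i 2 ≠ 0 := (map_ne_zero i).mpr two_ne_zero
    rwa [map_ofNat] at this
  obtain ⟨z, hz⟩ := h
  simp only [lineDisc, map_sub, map_add, map_mul, map_pow, map_ofNat, hiC, ← hx] at hz
  obtain ⟨P, hP⟩ := hsq
  have key : ∀ t : F, t ^ 2 + (i D.b₂ * x + i D.b₃) * t + (i D.c₂ * x + i D.c₃) = 0 →
      i D.b₂ * t + i D.c₂ ≠ 0 → IsSquare (algebraMap (Polynomial K) F D.boundaryDisc) := by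
    intro t ht hA
    have h1 := congrArg (Polynomial.eval₂ i t) hP
    have hB : Polynomial.eval₂ i t D.lineB = -(x * (i D.b₂ * t + i D.c₂)) := by
      simp only [lineB, Polynomial.eval₂_add, Polynomial.eval₂_mul, Polynomial.eval₂_pow,
        Polynomial.eval₂_C, Polynomial.eval₂_X]
      linear_combination ht
    have hA' : Polynomial.eval₂ i t D.lineA = i D.b₂ * t + i D.c₂ := by
      simp [lineA]
    have h4 : Polynomial.eval₂ i t (4 : Polynomial K) = 4 := by
      rw [← Polynomial.coe_eval₂RingHom, map_ofNat]
    simp only [disc, Polynomial.eval₂_add, Polynomial.eval₂_sub, Polynomial.eval₂_mul,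
      Polynomial.eval₂_pow, Polynomial.eval₂_C, Polynomial.eval₂_neg, h4, hA', hB] at h1
    refine ⟨Polynomial.eval₂ i t P / (i D.b₂ * t + i D.c₂) ^ 2, ?_⟩
    simp only [boundaryDisc, map_sub, map_add, map_mul, map_pow, map_ofNat, hiC, ← hx]
    rw [div_mul_div_comm, eq_div_iff (mul_ne_zero (pow_ne_zero 2 hA) (pow_ne_zero 2 hA))]
    linear_combination h1
  have hroot : ((-(i D.b₂ * x + i D.b₃) + z) / 2) ^ 2 +
      (i D.b₂ * x + i D.b₃) * ((-(i D.b₂ * x + i D.b₃) + z) / 2) + (i D.c₂ * x + i D.c₃) = 0 := by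
    field_simp
    linear_combination -hz
  generalize (-(i D.b₂ * x + i D.b₃) + z) / 2 = t at hroot
  -- If A vanishes at t, take the other root. Vanishing at both would give x a value in K, but x is
  -- transcendental over K.
  by_cases hA : i D.b₂ * t + i D.c₂ = 0
  · have hb : D.b₂ ≠ 0 := by
      rintro hb
      rw [hb, map_zero, zero_mul, zero_add, map_eq_zero] at hA
      rcases hbc with h | h
      · exact h hb
      · exact h hA
    have hib : i D.b₂ ≠ 0 := (map_ne_zero i).mpr hb
    refine key (-(i D.b₂ * x + i D.b₃) - t) (by linear_combination hroot) fun hA2 => ?_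
    apply htr ((2 * D.c₂ - D.b₂ * D.b₃) / D.b₂ ^ 2)
    rw [map_div₀, eq_div_iff (by simpa using hb)]
    simp only [map_sub, map_mul, map_pow, map_ofNat]
    linear_combination -hA2 - hA
  · exact key t hroot hA

/-- If the discriminant along the line is a square, then the discriminant of the boundary is a
square or agrees with that of the line up to squares. -/
theorem isSquare_boundaryDisc_or [CharZero K] (hbc : D.b₂ ≠ 0 ∨ D.c₂ ≠ 0)
    (hsq : IsSquare D.disc) : IsSquare D.boundaryDisc ∨
      (¬ IsSquare D.lineDisc ∧ IsSquare (D.boundaryDisc * D.lineDisc)) := by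
  have hinj := IsFractionRing.injective (Polynomial K) (RatFunc K)
  by_cases hl : IsSquare D.lineDisc
  · exact Or.inl (isSquare_of_isSquare_algebraMap (F := RatFunc K)
      (D.isSquare_boundaryDisc_of_isSquare_lineDisc hbc hsq hinj (hl.map _)))
  · have hl' : ¬ IsSquare (algebraMap (Polynomial K) (RatFunc K) D.lineDisc) :=
      fun h => hl (isSquare_of_isSquare_algebraMap h)
    obtain ⟨d, hd⟩ : ∃ d, d = algebraMap (Polynomial K) (RatFunc K) D.lineDisc := ⟨_, rfl⟩
    rw [← hd] at hl'
    -- This makes K(x)(√lineDisc) a field, namely the function field of L over that of the pencil.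
    have : Fact (∀ r : RatFunc K, r ^ 2 ≠ d + 0 * r) :=
      ⟨fun r hr => hl' ⟨r, by rw [← sq, hr]; ring⟩⟩
    have hcomp : ∀ p : Polynomial K, algebraMap (Polynomial K) (QuadraticAlgebra (RatFunc K) d 0) p =
        algebraMap (RatFunc K) (QuadraticAlgebra (RatFunc K) d 0)
          (algebraMap (Polynomial K) (RatFunc K) p) := fun p =>
      IsScalarTower.algebraMap_apply _ _ _ p
    have hinj' : Function.Injective
        (algebraMap (Polynomial K) (QuadraticAlgebra (RatFunc K) d 0)) := by
      intro p p' h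
      rw [hcomp, hcomp] at h
      exact hinj ((algebraMap (RatFunc K) (QuadraticAlgebra (RatFunc K) d 0)).injective h)
    have h := D.isSquare_boundaryDisc_of_isSquare_lineDisc hbc hsq hinj' (by
      rw [hcomp, ← hd]
      exact ⟨QuadraticAlgebra.omega, by
        ext <;> simp [QuadraticAlgebra.omega]⟩)
    rw [hcomp] at h
    rcases isSquare_or_isSquare_mul h with h | h
    · exact Or.inl (isSquare_of_isSquare_algebraMap h)
    · rw [hd, ← map_mul] at h
      exact Or.inr ⟨hl, isSquare_of_isSquare_algebraMap h⟩

end Discriminants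

/-! ### Degree and leading coefficient of the discriminant -/

section Degree

variable {K : Type*} [Field K] (D : LineCubic K)

/-- B is monic quadratic and A at most linear, so β₀²B⁴ dominates. -/
lemma natDegree_disc_of_ne_zero (h : D.β₀ ≠ 0) :
    D.disc.natDegree = 8 ∧ D.disc.leadingCoeff = D.β₀ ^ 2 := by
  have h1 : D.disc.natDegree ≤ 8 := by
    unfold disc lineA lineB; compute_degree
  have h2 : D.disc.coeff 8 = D.β₀ ^ 2 := by
    unfold disc lineA lineB; compute_degree!
  have h3 := Polynomial.natDegree_eq_of_le_of_coeff_ne_zero h1 (h2 ▸ pow_ne_zero 2 h)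
  exact ⟨h3, by rw [Polynomial.leadingCoeff, h3, h2]⟩

lemma coeff_lineB_pow_three : ((Polynomial.X ^ 2 + Polynomial.C D.b₃ * Polynomial.X
    + Polynomial.C D.c₃) ^ 3).coeff 6 = 1 := by
  compute_degree!

/-- Once β₀ = 0 the dominant term is 4κ₀AB³, here with A of degree one. -/
lemma natDegree_disc_of_flex [CharZero K] (h : D.β₀ = 0) (hκ : D.κ₀ ≠ 0) (hb : D.b₂ ≠ 0) :
    D.disc.natDegree = 7 := by
  have h1 : D.disc.natDegree ≤ 7 := by
    unfold disc lineA lineB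
    simp only [h, map_zero, zero_mul, zero_sub]
    compute_degree
  have h2 : D.disc.coeff 7 = 4 * D.b₂ * D.κ₀ := by
    unfold disc lineA lineB
    simp only [h, map_zero, zero_mul, zero_sub]
    compute_degree!
    left
    rw [D.coeff_lineB_pow_three]
    ring
  exact Polynomial.natDegree_eq_of_le_of_coeff_ne_zero h1
    (h2 ▸ mul_ne_zero (mul_ne_zero (by norm_num) hb) hκ)

/-- The same dominant term 4κ₀AB³, with A the constant c₂. -/
lemma natDegree_disc_of_flex_of_eq_zero [CharZero K] (h : D.β₀ = 0) (hκ : D.κ₀ ≠ 0) (hb : D.b₂ = 0)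
    (hc : D.c₂ ≠ 0) :
    D.disc.natDegree = 6 ∧ D.disc.leadingCoeff = 4 * D.c₂ * D.κ₀ := by
  have h1 : D.disc.natDegree ≤ 6 := by
    unfold disc lineA lineB
    simp only [h, hb, map_zero, zero_mul, zero_sub, zero_add]
    compute_degree
  have h2 : D.disc.coeff 6 = 4 * D.c₂ * D.κ₀ := by
    unfold disc lineA lineB
    simp only [h, hb, map_zero, zero_mul, zero_sub, zero_add]
    compute_degree!
    left
    rw [D.coeff_lineB_pow_three]
    ring
  have h3 := Polynomial.natDegree_eq_of_le_of_coeff_ne_zero h1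
    (h2 ▸ mul_ne_zero (mul_ne_zero (by norm_num) hc) hκ)
  exact ⟨h3, by rw [Polynomial.leadingCoeff, h3, h2]⟩

/-- Now A² splits off; the cofactor is led by (β₁² - 4κ₁)B², of degree four. -/
lemma natDegree_disc_of_line (h : D.β₀ = 0) (hκ : D.κ₀ = 0) (hδ : D.β₁ ^ 2 - 4 * D.κ₁ ≠ 0)
    (hbc : D.b₂ ≠ 0 ∨ D.c₂ ≠ 0) :
    Even D.disc.natDegree ∧ ∃ a ≠ 0, D.disc.leadingCoeff = a ^ 2 * (D.β₁ ^ 2 - 4 * D.κ₁) := by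
  have hdisc : D.disc = D.lineA ^ 2 * ((Polynomial.C D.β₁ * D.lineB - Polynomial.C D.β₂ * D.lineA) ^ 2
      - 4 * (Polynomial.C D.κ₁ * D.lineB ^ 2 - Polynomial.C D.κ₂ * D.lineB * D.lineA
        + Polynomial.C D.κ₃ * D.lineA ^ 2)) := by
    rw [disc, h, hκ]
    simp only [map_zero]
    ring
  have hA : D.lineA ≠ 0 := by
    intro h0
    have e1 := congrArg (fun P => Polynomial.coeff P 1) h0
    have e0 := congrArg (fun P => Polynomial.coeff P 0) h0
    simp [lineA] at e0 e1
    tauto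
  obtain ⟨P, hP⟩ : ∃ P, P = (Polynomial.C D.β₁ * D.lineB - Polynomial.C D.β₂ * D.lineA) ^ 2
      - 4 * (Polynomial.C D.κ₁ * D.lineB ^ 2 - Polynomial.C D.κ₂ * D.lineB * D.lineA
        + Polynomial.C D.κ₃ * D.lineA ^ 2) := ⟨_, rfl⟩
  rw [← hP] at hdisc
  have h1 : P.natDegree ≤ 4 := by
    rw [hP]; unfold lineA lineB
    compute_degree
  have h2 : P.coeff 4 = D.β₁ ^ 2 - 4 * D.κ₁ := by
    rw [hP]; unfold lineA lineB
    compute_degree!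
  have h3 := Polynomial.natDegree_eq_of_le_of_coeff_ne_zero h1 (h2 ▸ hδ)
  have hP0 : P ≠ 0 := by
    rintro rfl
    simp at h3
  refine ⟨?_, D.lineA.leadingCoeff, Polynomial.leadingCoeff_ne_zero.mpr hA, ?_⟩
  · rw [hdisc, Polynomial.natDegree_mul (pow_ne_zero 2 hA) hP0, Polynomial.natDegree_pow, h3]
    exact (even_two_mul _).add (by decide)
  · rw [hdisc, Polynomial.leadingCoeff_mul, Polynomial.leadingCoeff_pow]
    congr 1
    rw [Polynomial.leadingCoeff, h3, h2]

end Degree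

end LineCubic

end CubicDensity

namespace CubicDensity

/-! ### Directional derivatives -/

section DirDeriv

variable {K : Type*} [Field K] {A : Type*} [CommRing A] [Algebra K A]

lemma dirDeriv_C (a : K) (x w : Fin 4 → A) : dirDeriv (C a) x w = 0 := by
  simp [dirDeriv]

lemma dirDeriv_X (i : Fin 4) (x w : Fin 4 → A) : dirDeriv (X i : MvPolynomial (Fin 4) K) x w = w i := by
  simp [dirDeriv, MvPolynomial.pderiv_X, Pi.single_apply, apply_ite]

lemma dirDeriv_add (f g : MvPolynomial (Fin 4) K) (x w : Fin 4 → A) :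
    dirDeriv (f + g) x w = dirDeriv f x w + dirDeriv g x w := by
  simp [dirDeriv, add_mul, Finset.sum_add_distrib]

lemma dirDeriv_mul (f g : MvPolynomial (Fin 4) K) (x w : Fin 4 → A) :
    dirDeriv (f * g) x w = dirDeriv f x w * aeval x g + aeval x f * dirDeriv g x w := by
  simp only [dirDeriv, MvPolynomial.pderiv_mul, map_add, map_mul, Finset.sum_mul, Finset.mul_sum,
    ← Finset.sum_add_distrib]
  exact Finset.sum_congr rfl fun i _ => by ring

lemma dirDeriv_sum {ι : Type*} (s : Finset ι) (f : ι → MvPolynomial (Fin 4) K) (x w : Fin 4 → A) :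
    dirDeriv (∑ i ∈ s, f i) x w = ∑ i ∈ s, dirDeriv (f i) x w := by
  classical
  induction s using Finset.induction_on with
  | empty => simp [dirDeriv]
  | insert a s ha ih => rw [Finset.sum_insert ha, Finset.sum_insert ha, dirDeriv_add, ih]

lemma dirDeriv_linear (a : Fin 4 → K) (x w : Fin 4 → A) :
    dirDeriv (∑ i, C (a i) * X i) x w = ∑ i, algebraMap K A (a i) * w i := by
  rw [dirDeriv_sum]
  exact Finset.sum_congr rfl fun i _ => by
    rw [dirDeriv_mul, dirDeriv_C, dirDeriv_X, zero_mul, zero_add, aeval_C]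

/-- The chain rule. -/
lemma dirDeriv_aeval (g : Fin 4 → MvPolynomial (Fin 4) K) (f : MvPolynomial (Fin 4) K)
    (x w : Fin 4 → A) : dirDeriv (aeval g f) x w =
      dirDeriv f (fun i => aeval x (g i)) (fun i => dirDeriv (g i) x w) := by
  induction f using MvPolynomial.induction_on with
  | C a => rw [aeval_C, MvPolynomial.algebraMap_eq, dirDeriv_C, dirDeriv_C]
  | add p q hp hq => rw [map_add, dirDeriv_add, dirDeriv_add, hp, hq]
  | mul_X p i hp =>
    rw [map_mul, aeval_X, dirDeriv_mul, dirDeriv_mul, hp, dirDeriv_X, aeval_X,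
      ← AlgHom.comp_apply, MvPolynomial.comp_aeval]

lemma dirDeriv_add_right (f : MvPolynomial (Fin 4) K) (x w w' : Fin 4 → A) :
    dirDeriv f x (w + w') = dirDeriv f x w + dirDeriv f x w' := by
  simp [dirDeriv, mul_add, Finset.sum_add_distrib]

lemma dirDeriv_smul_right (f : MvPolynomial (Fin 4) K) (x w : Fin 4 → A) (a : A) :
    dirDeriv f x (a • w) = a * dirDeriv f x w := by
  simp only [dirDeriv, Finset.mul_sum, Pi.smul_apply, smul_eq_mul]
  exact Finset.sum_congr rfl fun i _ => by ring

lemma dirDeriv_self {f : MvPolynomial (Fin 4) K} {n : ℕ} (hf : f.IsHomogeneous n) (x : Fin 4 → A) :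
    dirDeriv f x x = n * aeval x f := by
  have := congrArg (aeval x) hf.sum_X_mul_pderiv
  simp only [map_sum, map_mul, aeval_X, nsmul_eq_mul, map_natCast] at this
  rw [← this, dirDeriv]
  exact Finset.sum_congr rfl fun i _ => mul_comm _ _

end DirDeriv

/-! ### Expanding a cubic form into the normal form -/

section Expansion

variable {K : Type*} [Field K]

lemma exists_linear_coefficients {l : MvPolynomial (Fin 4) K} (hl : l.IsHomogeneous 1) :
    ∃ a : Fin 4 → K, l = ∑ i, C (a i) * X i := by
  refine ⟨fun i => coeff 0 (pderiv i l), ?_⟩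
  have h := hl.sum_X_mul_pderiv
  rw [one_smul] at h
  refine h.symm.trans (Finset.sum_congr rfl fun i _ => ?_)
  have h0 : (pderiv i l).IsHomogeneous 0 := hl.pderiv
  rw [← MvPolynomial.totalDegree_zero_iff_isHomogeneous,
    MvPolynomial.totalDegree_eq_zero_iff_eq_C] at h0
  rw [mul_comm]
  exact congrArg (· * X i) h0

variable [CharZero K]

/-- Euler's identity applied three times; the factor 3! = 6 is invertible in characteristic zero. -/
lemma exists_cubic_coefficients {f : MvPolynomial (Fin 4) K} (hf : f.IsHomogeneous 3) :
    ∃ c : Fin 4 → Fin 4 → Fin 4 → K, f = ∑ i, ∑ j, ∑ k, C (c i j k) * X i * X j * X k := by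
  have h2 : ∀ i, (pderiv i f).IsHomogeneous 2 := fun i => hf.pderiv
  have h1 : ∀ i j, (pderiv j (pderiv i f)).IsHomogeneous 1 := fun i j => (h2 i).pderiv
  choose c hc using fun i j => exists_linear_coefficients (h1 i j)
  refine ⟨fun i j k => 6⁻¹ * c i j k, ?_⟩
  have e3 := hf.sum_X_mul_pderiv
  have e2 := fun i => (h2 i).sum_X_mul_pderiv
  have e6 : (6 : MvPolynomial (Fin 4) K) * f = ∑ i, ∑ j, ∑ k, C (c i j k) * X i * X j * X k := by
    have : (6 : MvPolynomial (Fin 4) K) * f = 2 * (3 • f) := by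
      rw [nsmul_eq_mul]; push_cast; ring
    rw [this, ← e3, Finset.mul_sum]
    refine Finset.sum_congr rfl fun i _ => ?_
    have h : (2 : MvPolynomial (Fin 4) K) * (X i * pderiv i f) = X i * (2 • pderiv i f) := by
      rw [nsmul_eq_mul]; push_cast; ring
    rw [h, ← e2, Finset.mul_sum]
    refine Finset.sum_congr rfl fun j _ => ?_
    rw [hc, Finset.mul_sum, Finset.mul_sum]
    exact Finset.sum_congr rfl fun k _ => by ring
  have h6 : (C (6⁻¹ : K) : MvPolynomial (Fin 4) K) * 6 = 1 := by
    rw [← map_ofNat (C : K →+* MvPolynomial (Fin 4) K), ← map_mul, inv_mul_cancel₀ (by norm_num),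
      map_one]
  rw [← one_mul f, ← h6, mul_assoc, e6, Finset.mul_sum]
  refine Finset.sum_congr rfl fun i _ => ?_
  rw [Finset.mul_sum]
  refine Finset.sum_congr rfl fun j _ => ?_
  rw [Finset.mul_sum]
  refine Finset.sum_congr rfl fun k _ => ?_
  rw [map_mul]; ring

/-- A cubic form which vanishes on the line `X₂ = X₃ = 0`, with tangent plane `X₃ = 0` at
`(1 : 0 : 0 : 0)`. -/
lemma exists_lineCubic {P : MvPolynomial (Fin 4) K} (hP : P.IsHomogeneous 3)
    (hline : ∀ s t : K, aeval ![s, t, 0, 0] P = 0)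
    (hm : dirDeriv P ![(1 : K), 0, 0, 0] ![0, 0, 1, 0] = 0)
    (hn : dirDeriv P ![(1 : K), 0, 0, 0] ![0, 0, 0, 1] = 1) :
    ∃ D : LineCubic K, P = D.form X := by
  -- Four points of the line determine the four coefficients in X₀, X₁ alone. The two derivatives
  -- give those of X₀²X₂ and X₀²X₃.
  obtain ⟨c, rfl⟩ := exists_cubic_coefficients hP
  have l1 := hline 1 0
  have l2 := hline 0 1
  have l3 := hline 1 1
  have l4 := hline 1 (-1)
  simp only [Fin.sum_univ_four, map_add, map_mul, aeval_C, aeval_X, Matrix.cons_val,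
    Algebra.algebraMap_self, RingHom.id_apply] at l1 l2 l3 l4
  simp only [Fin.sum_univ_four, dirDeriv_add, dirDeriv_mul, dirDeriv_C, dirDeriv_X,
    map_mul, aeval_C, aeval_X, Matrix.cons_val,
    Algebra.algebraMap_self, RingHom.id_apply] at hm hn
  ring_nf at l1 l2 l3 l4 hm hn
  have hC : ∀ a : K, algebraMap K (MvPolynomial (Fin 4) K) a = C a := fun _ => rfl
  have k1 := congrArg (C : K → MvPolynomial (Fin 4) K) l1
  have k2 := congrArg (C : K → MvPolynomial (Fin 4) K) l2
  have k3 : C (c 0 0 1 + c 0 1 0 + c 1 0 0) = (0 : MvPolynomial (Fin 4) K) := by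
    rw [← map_zero C]; congr 1; linear_combination (l3 - l4) / 2 - l2
  have k4 : C (c 0 1 1 + c 1 0 1 + c 1 1 0) = (0 : MvPolynomial (Fin 4) K) := by
    rw [← map_zero C]; congr 1; linear_combination (l3 + l4) / 2 - l1
  have k5 := congrArg (C : K → MvPolynomial (Fin 4) K) hm
  have k6 := congrArg (C : K → MvPolynomial (Fin 4) K) hn
  refine ⟨⟨c 0 1 2 + c 0 2 1 + c 1 0 2 + c 1 2 0 + c 2 0 1 + c 2 1 0,
    c 0 1 3 + c 0 3 1 + c 1 0 3 + c 1 3 0 + c 3 0 1 + c 3 1 0,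
    c 1 1 2 + c 1 2 1 + c 2 1 1, c 1 1 3 + c 1 3 1 + c 3 1 1,
    c 0 2 2 + c 2 0 2 + c 2 2 0, c 0 2 3 + c 0 3 2 + c 2 0 3 + c 2 3 0 + c 3 0 2 + c 3 2 0,
    c 0 3 3 + c 3 0 3 + c 3 3 0,
    c 1 2 2 + c 2 1 2 + c 2 2 1, c 1 2 3 + c 1 3 2 + c 2 1 3 + c 2 3 1 + c 3 1 2 + c 3 2 1,
    c 1 3 3 + c 3 1 3 + c 3 3 1,
    c 2 2 2, c 2 2 3 + c 2 3 2 + c 3 2 2, c 2 3 3 + c 3 2 3 + c 3 3 2, c 3 3 3⟩, ?_⟩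
  simp only [map_add, map_zero, map_one] at k1 k2 k3 k4 k5 k6
  simp only [LineCubic.form, hC, Fin.sum_univ_four, map_add]
  linear_combination X 0 ^ 3 * k1 + X 1 ^ 3 * k2 + X 0 ^ 2 * X 1 * k3 + X 0 * X 1 ^ 2 * k4
    + X 0 ^ 2 * X 2 * k5 + X 0 ^ 2 * X 3 * k6

end Expansion

end CubicDensity

/-! ### Adapted coordinates -/

namespace CubicDensity

universe u

/-- A basis of `K⁴`, given by the rows of `e`, with dual basis given by the columns of `z`, in
which the cubic surface, its plane section and its line have a normal form. -/
structure AdaptedFrame {K : Type u} [Field K] (T : CubicWithLine K) where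
  D : LineCubic K
  e : Matrix (Fin 4) (Fin 4) K
  z : Matrix (Fin 4) (Fin 4) K
  e_mul_z : e * z = 1
  z_mul_e : z * e = 1
  row_zero : e 0 = T.q
  μ : K
  μ_ne : μ ≠ 0
  f_eq : T.f = D.form (fun j => ∑ i, C (z i j) * X i)
  h_eq : T.h = C μ * ∑ i, C (z i 1) * X i
  mem_L : ∀ x ∈ T.L, x = (∑ i, z i 0 * x i) • e 0 + (∑ i, z i 1 * x i) • e 1

namespace LineCubic

variable {K : Type*} [CommRing K] (D : LineCubic K) {A : Type*} [CommRing A] [Algebra K A]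

/-- The differential of `D.form`. -/
def dform (x w : Fin 4 → A) : A :=
  2 * x 3 * x 0 * w 0 + x 0 ^ 2 * w 3
    + (x 0 * w 1 + w 0 * x 1) * (algebraMap K A D.b₂ * x 2 + algebraMap K A D.b₃ * x 3)
    + x 0 * x 1 * (algebraMap K A D.b₂ * w 2 + algebraMap K A D.b₃ * w 3)
    + w 0 * (algebraMap K A D.β₀ * x 2 ^ 2 + algebraMap K A D.β₁ * x 2 * x 3
        + algebraMap K A D.β₂ * x 3 ^ 2)
    + x 0 * (2 * algebraMap K A D.β₀ * x 2 * w 2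
        + algebraMap K A D.β₁ * (x 2 * w 3 + w 2 * x 3) + 2 * algebraMap K A D.β₂ * x 3 * w 3)
    + 2 * x 1 * w 1 * (algebraMap K A D.c₂ * x 2 + algebraMap K A D.c₃ * x 3)
    + x 1 ^ 2 * (algebraMap K A D.c₂ * w 2 + algebraMap K A D.c₃ * w 3)
    + w 1 * (algebraMap K A D.γ₀ * x 2 ^ 2 + algebraMap K A D.γ₁ * x 2 * x 3
        + algebraMap K A D.γ₂ * x 3 ^ 2)
    + x 1 * (2 * algebraMap K A D.γ₀ * x 2 * w 2
        + algebraMap K A D.γ₁ * (x 2 * w 3 + w 2 * x 3) + 2 * algebraMap K A D.γ₂ * x 3 * w 3)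
    + 3 * algebraMap K A D.κ₀ * x 2 ^ 2 * w 2
    + algebraMap K A D.κ₁ * (2 * x 2 * w 2 * x 3 + x 2 ^ 2 * w 3)
    + algebraMap K A D.κ₂ * (w 2 * x 3 ^ 2 + 2 * x 2 * x 3 * w 3)
    + 3 * algebraMap K A D.κ₃ * x 3 ^ 2 * w 3

end LineCubic

namespace AdaptedFrame

variable {K : Type u} [Field K] {T : CubicWithLine K} (Φ : AdaptedFrame T)
  {A : Type*} [CommRing A] [Algebra K A]

/-- The coordinates of a vector with respect to the frame. -/
def coord (x : Fin 4 → A) (j : Fin 4) : A := ∑ i, algebraMap K A (Φ.z i j) * x i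

/-- The vector with given coordinates with respect to the frame. -/
def vec (y : Fin 4 → A) (i : Fin 4) : A := ∑ j, algebraMap K A (Φ.e j i) * y j

lemma coord_vec (y : Fin 4 → A) : Φ.coord (Φ.vec y) = y := by
  funext j
  simp only [coord, vec, Finset.mul_sum]
  rw [Finset.sum_comm]
  have h : ∀ k, ∑ i, algebraMap K A (Φ.z i j) * (algebraMap K A (Φ.e k i) * y k) =
      (if k = j then y k else 0) := by
    intro k
    have h1 := congrFun (congrFun Φ.e_mul_z k) j
    rw [Matrix.mul_apply, Matrix.one_apply] at h1
    have h2 := congrArg (algebraMap K A) h1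
    rw [map_sum] at h2
    have h3 : ∑ i, algebraMap K A (Φ.z i j) * (algebraMap K A (Φ.e k i) * y k) =
        (∑ i, algebraMap K A (Φ.e k i * Φ.z i j)) * y k := by
      rw [Finset.sum_mul]
      exact Finset.sum_congr rfl fun i _ => by rw [map_mul]; ring
    rw [h3, h2]
    split_ifs <;> simp
  simp [h]

lemma vec_coord (x : Fin 4 → A) : Φ.vec (Φ.coord x) = x := by
  funext j
  simp only [coord, vec, Finset.mul_sum]
  rw [Finset.sum_comm]
  have h : ∀ k, ∑ i, algebraMap K A (Φ.e i j) * (algebraMap K A (Φ.z k i) * x k) =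
      (if k = j then x k else 0) := by
    intro k
    have h1 := congrFun (congrFun Φ.z_mul_e k) j
    rw [Matrix.mul_apply, Matrix.one_apply] at h1
    have h2 := congrArg (algebraMap K A) h1
    rw [map_sum] at h2
    have h3 : ∑ i, algebraMap K A (Φ.e i j) * (algebraMap K A (Φ.z k i) * x k) =
        (∑ i, algebraMap K A (Φ.z k i * Φ.e i j)) * x k := by
      rw [Finset.sum_mul]
      exact Finset.sum_congr rfl fun i _ => by rw [map_mul]; ring
    rw [h3, h2]
    split_ifs <;> simp
  simp [h]

lemma coord_add (x y : Fin 4 → A) : Φ.coord (x + y) = Φ.coord x + Φ.coord y := by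
  funext j
  simp [coord, mul_add, Finset.sum_add_distrib]

lemma coord_smul (a : A) (x : Fin 4 → A) : Φ.coord (a • x) = a • Φ.coord x := by
  funext j
  simp only [coord, Pi.smul_apply, smul_eq_mul, Finset.mul_sum]
  exact Finset.sum_congr rfl fun i _ => by ring

lemma coord_q : Φ.coord T.q = ![1, 0, 0, 0] := by
  have h : T.q = Φ.vec ![(1 : K), 0, 0, 0] := by
    funext i
    simp [vec, Fin.sum_univ_four, ← Φ.row_zero]
  rw [h, coord_vec]

lemma coord_map {B : Type*} [CommRing B] [Algebra K B] (φ : A →ₐ[K] B) (x : Fin 4 → A) (j : Fin 4) :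
    Φ.coord (fun i => φ (x i)) j = φ (Φ.coord x j) := by
  simp [coord]

lemma coord_algebraMap (x : Fin 4 → K) (j : Fin 4) :
    Φ.coord (fun i => algebraMap K A (x i)) j = algebraMap K A (Φ.coord x j) :=
  Φ.coord_map (Algebra.ofId K A) x j

lemma coord_of_mem {x : Fin 4 → K} (hx : x ∈ T.L) : Φ.coord x 2 = 0 ∧ Φ.coord x 3 = 0 := by
  have h : x = Φ.vec ![∑ i, Φ.z i 0 * x i, ∑ i, Φ.z i 1 * x i, 0, 0] := by
    conv_lhs => rw [Φ.mem_L x hx]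
    funext i
    simp [vec, Fin.sum_univ_four, mul_comm]
  rw [h, coord_vec]
  simp

lemma aeval_f (x : Fin 4 → A) : aeval x T.f = Φ.D.form (Φ.coord x) := by
  rw [Φ.f_eq, Φ.D.map_form]
  congr 1
  funext j
  simp [coord]

lemma aeval_h (x : Fin 4 → A) : aeval x T.h = algebraMap K A Φ.μ * Φ.coord x 1 := by
  rw [Φ.h_eq]
  simp [coord]

lemma aeval_h_eq_zero {F : Type*} [Field F] [Algebra K F] {x : Fin 4 → F} :
    aeval x T.h = 0 ↔ Φ.coord x 1 = 0 := by
  rw [Φ.aeval_h, mul_eq_zero, map_eq_zero_iff _ (algebraMap K F).injective]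
  simp [Φ.μ_ne]

lemma dirDeriv_f (x w : Fin 4 → A) : dirDeriv T.f x w = Φ.D.dform (Φ.coord x) (Φ.coord w) := by
  have hC : ∀ a : K, algebraMap K (MvPolynomial (Fin 4) K) a = C a := fun _ => rfl
  have h1 : ∀ j, aeval x (∑ i, C (Φ.z i j) * X i) = Φ.coord x j := fun j => by simp [coord]
  have h2 : ∀ j, dirDeriv (∑ i, C (Φ.z i j) * X i) x w = Φ.coord w j :=
    fun j => dirDeriv_linear _ x w
  rw [Φ.f_eq, LineCubic.form, LineCubic.dform]
  simp only [hC, dirDeriv_add, dirDeriv_mul, dirDeriv_C, h1, h2, map_add, map_mul,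
    pow_succ, pow_zero, one_mul, aeval_C]
  ring

end AdaptedFrame

section Existence

variable {K : Type u} [Field K] [CharZero K] (T : CubicWithLine K)

/-- The basis is q₁, p, m, n with m, n in the plane h = 0: nonsingularity of D₁ at q₁ provides n
with df_{q₁}(n) = 1, and m spans the tangent line together with q₁. That p is free is essential,
since it will be an integral point. -/
theorem exists_adaptedFrame (hq : T.BoundaryNonsingularAt T.q) {p : Fin 4 → K} (hp : p ∈ T.L)
    (hph : aeval p T.h ≠ 0) : ∃ Φ : AdaptedFrame T, Φ.e 1 = p ∧ Φ.μ = aeval p T.h := by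
  obtain ⟨a, ha⟩ := exists_linear_coefficients T.h_hom
  have haeval : ∀ x : Fin 4 → K, aeval x T.h = ∑ i, a i * x i := fun x => by
    rw [ha]; simp
  have hadd : ∀ x y : Fin 4 → K, aeval (x + y) T.h = aeval x T.h + aeval y T.h := fun x y => by
    simp only [haeval, Pi.add_apply, mul_add, Finset.sum_add_distrib]
  have hsmul : ∀ (c : K) (x : Fin 4 → K), aeval (c • x) T.h = c * aeval x T.h := fun c x => by
    simp only [haeval, Pi.smul_apply, smul_eq_mul, Finset.mul_sum]
    exact Finset.sum_congr rfl fun i _ => by ring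
  obtain ⟨n', hn'h, hn'q⟩ := hq
  obtain ⟨n, hnh, hnq⟩ : ∃ n, aeval n T.h = 0 ∧ dirDeriv T.f T.q n = 1 :=
    ⟨(dirDeriv T.f T.q n')⁻¹ • n', by rw [hsmul, hn'h, mul_zero], by
      rw [dirDeriv_smul_right, inv_mul_cancel₀ hn'q]⟩
  have hqq : dirDeriv T.f T.q T.q = 0 := by
    rw [dirDeriv_self T.f_hom, T.L_sub _ T.q_mem, mul_zero]
  obtain ⟨m, hmh, hmq, hm⟩ : ∃ m, aeval m T.h = 0 ∧ dirDeriv T.f T.q m = 0 ∧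
      m ∉ Submodule.span K {T.q} := by
    -- Its kernel has dimension at least two, so it is not contained in the line spanned by q₁.
    let φ : (Fin 4 → K) →ₗ[K] K × K :=
      { toFun := fun x => (aeval x T.h, dirDeriv T.f T.q x)
        map_add' := fun x y => by rw [hadd, dirDeriv_add_right]; rfl
        map_smul' := fun c x => by rw [hsmul, dirDeriv_smul_right]; rfl }
    by_contra! hcon
    have hle : LinearMap.ker φ ≤ Submodule.span K {T.q} := by
      intro x hx
      rw [LinearMap.mem_ker] at hx
      exact hcon x (congrArg Prod.fst hx) (congrArg Prod.snd hx)
    have h1 := Submodule.finrank_mono hle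
    rw [finrank_span_singleton T.q_ne] at h1
    have h2 := LinearMap.finrank_range_add_finrank_ker φ
    have h3 := Submodule.finrank_le (LinearMap.range φ)
    rw [Module.finrank_prod, Module.finrank_self] at h3
    rw [Module.finrank_fin_fun] at h2
    omega
  have hli : LinearIndependent K ![T.q, p, m, n] := by
    rw [Fintype.linearIndependent_iff]
    intro g hg
    simp only [Fin.sum_univ_four, Matrix.cons_val] at hg
    have e1 := congrArg (fun x => aeval x T.h) hg
    have e2 := congrArg (fun x => dirDeriv T.f T.q x) hg
    have h0 : aeval (0 : Fin 4 → K) T.h = 0 := by rw [haeval]; simp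
    have h0' : dirDeriv T.f T.q (0 : Fin 4 → K) = 0 := by simp [dirDeriv]
    simp only [hadd, hsmul, T.q_plane, hmh, hnh, h0, mul_zero, zero_add, add_zero] at e1
    have g1 : g 1 = 0 := (mul_eq_zero.mp e1).resolve_right hph
    simp only [dirDeriv_add_right, dirDeriv_smul_right, hqq, hmq, hnq, g1, h0', mul_zero,
      zero_mul, zero_add, mul_one] at e2
    rw [g1, e2, zero_smul, zero_smul, add_zero, add_zero] at hg
    have g2 : g 2 = 0 := by
      by_contra h
      refine hm (Submodule.mem_span_singleton.mpr ⟨-(g 2)⁻¹ * g 0, ?_⟩)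
      rw [neg_mul, neg_smul, mul_smul, ← smul_neg, ← eq_neg_of_add_eq_zero_right hg, smul_smul,
        inv_mul_cancel₀ h, one_smul]
    have g0 : g 0 = 0 := by
      rw [g2, zero_smul, add_zero] at hg
      exact (smul_eq_zero.mp hg).resolve_right T.q_ne
    intro i
    fin_cases i
    · exact g0
    · exact g1
    · exact g2
    · exact e2
  obtain ⟨e, he⟩ : ∃ e : Matrix (Fin 4) (Fin 4) K, e = Matrix.of ![T.q, p, m, n] := ⟨_, rfl⟩
  have hunit : IsUnit e := by
    rw [← Matrix.linearIndependent_rows_iff_isUnit, he]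
    exact hli
  have hdet : IsUnit e.det := (Matrix.isUnit_iff_isUnit_det e).mp hunit
  have hze : e⁻¹ * e = 1 := Matrix.nonsing_inv_mul e hdet
  have hez : e * e⁻¹ = 1 := Matrix.mul_nonsing_inv e hdet
  obtain ⟨g, hg⟩ : ∃ g : Fin 4 → MvPolynomial (Fin 4) K, g = fun i => ∑ j, C (e j i) * X j :=
    ⟨_, rfl⟩
  have hgh : ∀ i, (g i).IsHomogeneous 1 := by
    intro i
    rw [hg]
    refine IsHomogeneous.sum _ _ _ fun j _ => ?_
    simpa using (isHomogeneous_C (Fin 4) (e j i)).mul (isHomogeneous_X K j)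
  have hgx : ∀ x : Fin 4 → K, (fun i => aeval x (g i)) =
      x 0 • T.q + x 1 • p + x 2 • m + x 3 • n := by
    intro x
    funext i
    simp [hg, he, Fin.sum_univ_four, mul_comm]
  have hgw : ∀ x w : Fin 4 → K, (fun i => dirDeriv (g i) x w) =
      w 0 • T.q + w 1 • p + w 2 • m + w 3 • n := by
    intro x w
    rw [← hgx w]
    funext i
    simp only [hg, dirDeriv_linear]
    simp
  obtain ⟨D, hD⟩ := exists_lineCubic (P := aeval g T.f) (by simpa using T.f_hom.aeval g hgh)
    (by
      intro s t
      rw [← AlgHom.comp_apply, MvPolynomial.comp_aeval, hgx]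
      refine T.L_sub _ ?_
      simp only [Matrix.cons_val, zero_smul, add_zero]
      exact T.L.add_mem (T.L.smul_mem _ T.q_mem) (T.L.smul_mem _ hp))
    (by
      rw [dirDeriv_aeval, hgx, hgw]
      simpa using hmq)
    (by
      rw [dirDeriv_aeval, hgx, hgw]
      simpa using hnq)
  have hsub : ∀ i, aeval (fun j => ∑ k, C (e⁻¹ k j) * X k) (g i) = (X i : MvPolynomial (Fin 4) K) := by
    intro i
    simp only [hg, map_sum, map_mul, aeval_C, aeval_X, Finset.mul_sum]
    rw [Finset.sum_comm]
    have h : ∀ k, ∑ j, algebraMap K (MvPolynomial (Fin 4) K) (e j i) * (C (e⁻¹ k j) * X k) =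
        (if k = i then X k else 0) := by
      intro k
      have h1 := congrFun (congrFun hze k) i
      rw [Matrix.mul_apply, Matrix.one_apply] at h1
      have h2 := congrArg (C : K →+* MvPolynomial (Fin 4) K) h1
      rw [map_sum] at h2
      have h3 : ∑ j, algebraMap K (MvPolynomial (Fin 4) K) (e j i) * (C (e⁻¹ k j) * X k) =
          (∑ j, C (e⁻¹ k j * e j i)) * X k := by
        rw [Finset.sum_mul]
        exact Finset.sum_congr rfl fun j _ => by rw [map_mul, MvPolynomial.algebraMap_eq]; ring
      rw [h3, h2]
      split_ifs <;> simp
    simp only [h, Finset.sum_ite_eq', Finset.mem_univ, if_true]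
  have hback : ∀ r : MvPolynomial (Fin 4) K,
      aeval (fun j => ∑ k, C (e⁻¹ k j) * X k) (aeval g r) = r := by
    intro r
    rw [← AlgHom.comp_apply, MvPolynomial.comp_aeval]
    simp only [hsub]
    exact MvPolynomial.aeval_X_left_apply r
  have hspan : T.L = Submodule.span K {T.q, p} := by
    symm
    refine Submodule.eq_of_le_of_finrank_eq ?_ ?_
    · rw [Submodule.span_le]
      rintro x (rfl | rfl)
      · exact T.q_mem
      · exact hp
    · have h2 : LinearIndependent K ![T.q, p] := by
        have := hli.comp ![(0 : Fin 4), 1] (by decide)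
        convert this using 1
        funext i
        fin_cases i <;> rfl
      have := finrank_span_eq_card h2
      have hr : Set.range ![T.q, p] = {T.q, p} := by
        ext x
        simp only [Set.mem_range, Fin.exists_fin_two, Matrix.cons_val, Set.mem_insert_iff,
          Set.mem_singleton_iff, eq_comm]
      rw [T.L_rank, ← hr]
      simpa using this
  have hcoord : ∀ (s t : K) (j : Fin 4), ∑ i, e⁻¹ i j * (s • T.q + t • p) i =
      s * (if 0 = j then 1 else 0) + t * (if 1 = j then 1 else 0) := by
    intro s t j
    have h1 := congrFun (congrFun hez 0) j
    have h2 := congrFun (congrFun hez 1) j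
    rw [Matrix.mul_apply, Matrix.one_apply] at h1 h2
    rw [← h1, ← h2, Finset.mul_sum, Finset.mul_sum, ← Finset.sum_add_distrib]
    refine Finset.sum_congr rfl fun i _ => ?_
    simp only [he, Matrix.of_apply, Matrix.cons_val, Pi.add_apply, Pi.smul_apply, smul_eq_mul]
    ring
  have he0 : e 0 = T.q := by rw [he]; rfl
  have he1 : e 1 = p := by rw [he]; rfl
  refine ⟨⟨D, e, e⁻¹, hez, hze, he0, aeval p T.h, hph, ?_, ?_, ?_⟩, he1, rfl⟩
  · have := congrArg (aeval (fun j => ∑ k, C (e⁻¹ k j) * X k)) hD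
    rw [hback, D.map_form] at this
    simpa using this
  · have hgT : aeval g T.h = C (aeval p T.h) * X 1 := by
      have hl : (aeval g T.h).IsHomogeneous 1 := by simpa using T.h_hom.aeval g hgh
      obtain ⟨b, hb⟩ := exists_linear_coefficients hl
      have hev : ∀ x : Fin 4 → K, ∑ i, b i * x i = aeval (x 0 • T.q + x 1 • p + x 2 • m + x 3 • n) T.h := by
        intro x
        rw [← hgx, ← MvPolynomial.comp_aeval, AlgHom.comp_apply, hb]
        simp
      simp only [hadd, hsmul, T.q_plane, hmh, hnh, mul_zero, add_zero, zero_add] at hev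
      have hbi : ∀ i, b i = if i = 1 then aeval p T.h else 0 := by
        intro i
        have := hev (Pi.single i 1)
        simp only [Pi.single_apply, mul_ite, mul_one, mul_zero, Finset.sum_ite_eq', Finset.mem_univ,
          if_true] at this
        rw [this]
        fin_cases i <;> simp
      rw [hb]
      simp [hbi, apply_ite, ite_mul]
    have := congrArg (aeval (fun j => ∑ k, C (e⁻¹ k j) * X k)) hgT
    rw [hback] at this
    refine this.trans ?_
    simp
  · intro x hx
    rw [hspan, Submodule.mem_span_pair] at hx
    obtain ⟨s, t, rfl⟩ := hx
    rw [hcoord, hcoord, he0, he1]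
    simp

end Existence

end CubicDensity

/-! ### Finiteness, flexes and singularities in adapted coordinates -/

namespace CubicDensity

universe u

namespace AdaptedFrame

variable {K : Type u} [Field K] {T : CubicWithLine K} (Φ : AdaptedFrame T)

/-- If both vanished, the plane X₃ = 0 would be tangent along the whole line: on it the
X₂-derivative of the cubic is X₁(b₂X₀ + c₂X₁). -/
lemma ne_zero_of_finiteOnLine (hfin : T.FiniteOnLine) : Φ.D.b₂ ≠ 0 ∨ Φ.D.c₂ ≠ 0 := by
  have hm : Φ.vec ![(0 : K), 0, 1, 0] ∉ T.L := fun h => by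
    simpa [Φ.coord_vec] using (Φ.coord_of_mem h).1
  obtain ⟨x, hx, hne⟩ := hfin _ hm
  obtain ⟨h2, h3⟩ := Φ.coord_of_mem hx
  rw [Φ.dirDeriv_f, Φ.coord_vec] at hne
  simp only [LineCubic.dform, h2, h3, Matrix.cons_val, Algebra.algebraMap_self,
    RingHom.id_apply] at hne
  by_contra! h
  rw [h.1, h.2] at hne
  exact hne (by ring)

lemma coord_of_mem_tangentLine {w : Fin 4 → K} (hw : w ∈ T.tangentLine) :
    Φ.coord w 1 = 0 ∧ Φ.coord w 3 = 0 := by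
  obtain ⟨h1, h2⟩ := hw
  rw [Φ.aeval_h_eq_zero] at h1
  rw [Φ.dirDeriv_f, Φ.coord_q] at h2
  simp only [LineCubic.dform, Matrix.cons_val, Algebra.algebraMap_self, RingHom.id_apply, h1] at h2
  exact ⟨h1, by linear_combination h2⟩

/-- On the tangent line X₁ = X₃ = 0 the cubic is X₂²(β₀X₀ + κ₀X₂). -/
lemma isFlex_of_eq_zero (h : Φ.D.β₀ = 0) : T.IsFlex := by
  intro w hw
  obtain ⟨h1, h3⟩ := Φ.coord_of_mem_tangentLine hw
  have hc : ∀ j, Φ.coord (fun i => Polynomial.C (T.q i) + Polynomial.C (w i) * Polynomial.X) j =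
      Polynomial.C (Φ.coord T.q j) + Polynomial.C (Φ.coord w j) * Polynomial.X := by
    intro j
    simp only [coord, map_sum, Finset.sum_mul, ← Finset.sum_add_distrib]
    exact Finset.sum_congr rfl fun i _ => by
      rw [Polynomial.algebraMap_eq, Algebra.algebraMap_self, RingHom.id_apply, map_mul, map_mul]
      ring
  rw [Φ.aeval_f]
  refine ⟨Polynomial.C (Φ.D.κ₀ * Φ.coord w 2 ^ 3), ?_⟩
  simp only [LineCubic.form, hc, Φ.coord_q, h1, h3, h, Matrix.cons_val, map_zero, map_one,
    Polynomial.algebraMap_eq, map_mul, map_pow]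
  ring

/-- The `j`-th coordinate with respect to the frame as a linear form. -/
noncomputable def Z (j : Fin 4) : MvPolynomial (Fin 4) K := ∑ i, C (Φ.z i j) * X i

lemma aeval_Z {A : Type*} [CommRing A] [Algebra K A] (x : Fin 4 → A) (j : Fin 4) :
    aeval x (Φ.Z j) = Φ.coord x j := by
  simp [Z, coord]

lemma Z_isHomogeneous (j : Fin 4) : (Φ.Z j).IsHomogeneous 1 :=
  IsHomogeneous.sum _ _ _ fun i _ => by
    simpa using (isHomogeneous_C (Fin 4) (Φ.z i j)).mul (isHomogeneous_X K i)

lemma f_eq_form_Z : T.f = Φ.D.form Φ.Z := Φ.f_eq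

lemma h_eq_Z : T.h = C Φ.μ * Φ.Z 1 := Φ.h_eq

lemma Z_mem_span_h : Φ.Z 1 ∈ Ideal.span {T.h} := by
  rw [Ideal.mem_span_singleton]
  refine ⟨C (Φ.μ)⁻¹, ?_⟩
  rw [Φ.h_eq_Z, mul_right_comm, ← map_mul, mul_inv_cancel₀ Φ.μ_ne, map_one, one_mul]

/-- With β₀ = κ₀ = 0 the tangent line X₃ = 0 splits off from D₁, against primality; it must be
checked that neither factor lies in the boundary ideal. -/
lemma ne_zero_of_boundaryIrreducible (hirr : T.BoundaryIrreducible) (h : Φ.D.β₀ = 0) :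
    Φ.D.κ₀ ≠ 0 := by
  intro hκ
  obtain ⟨R, hR⟩ : ∃ R, R = Φ.Z 0 ^ 2 + Φ.Z 0 * (C Φ.D.β₁ * Φ.Z 2 + C Φ.D.β₂ * Φ.Z 3)
    + C Φ.D.κ₁ * Φ.Z 2 ^ 2 + C Φ.D.κ₂ * Φ.Z 2 * Φ.Z 3 + C Φ.D.κ₃ * Φ.Z 3 ^ 2 := ⟨_, rfl⟩
  have hle : Ideal.span {T.h} ≤ T.boundaryIdeal := Ideal.span_mono (by simp)
  have hf : T.f ∈ T.boundaryIdeal := Ideal.subset_span (by simp)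
  have hmem : Φ.Z 3 * R ∈ T.boundaryIdeal := by
    have hC : ∀ a : K, algebraMap K (MvPolynomial (Fin 4) K) a = C a := fun _ => rfl
    have : Φ.Z 3 * R = T.f - Φ.Z 1 * (Φ.Z 0 * (C Φ.D.b₂ * Φ.Z 2 + C Φ.D.b₃ * Φ.Z 3)
        + Φ.Z 1 * (C Φ.D.c₂ * Φ.Z 2 + C Φ.D.c₃ * Φ.Z 3)
        + (C Φ.D.γ₀ * Φ.Z 2 ^ 2 + C Φ.D.γ₁ * Φ.Z 2 * Φ.Z 3 + C Φ.D.γ₂ * Φ.Z 3 ^ 2)) := by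
      rw [Φ.f_eq_form_Z, hR]
      simp only [LineCubic.form, hC, h, hκ, map_zero]
      ring
    rw [this]
    exact sub_mem hf (Ideal.mul_mem_right _ _ (hle Φ.Z_mem_span_h))
  have key : ∀ {A : Type u} [CommRing A] [Algebra K A] (y : Fin 4 → A), y 1 = 0 → Φ.D.form y = 0 →
      ∀ P ∈ T.boundaryIdeal, aeval (Φ.vec y) P = 0 := by
    intro A _ _ y h1 hy P hP
    obtain ⟨a, b, rfl⟩ := Ideal.mem_span_pair.mp hP
    rw [map_add, map_mul, map_mul, Φ.aeval_f, Φ.aeval_h, Φ.coord_vec, hy, h1]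
    simp
  rcases hirr.mem_or_mem hmem with h3 | h3
  -- The point (0, 0, 0, ε) kills the boundary ideal because ε³ = 0, but X₃ = ε ≠ 0 there.
  · have := key (A := DualNumber K) ![0, 0, 0, DualNumber.eps] (by simp) (by
      simp only [LineCubic.form, Matrix.cons_val]
      linear_combination (algebraMap K (DualNumber K) Φ.D.κ₃ * DualNumber.eps) *
        DualNumber.eps_mul_eps (R := K)) _ h3
    rw [Φ.aeval_Z, Φ.coord_vec] at this
    have h4 := congrArg TrivSqZeroExt.snd this
    simp at h4
  · have := key (A := K) ![1, 0, 0, 0] (by simp) (by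
      simp [LineCubic.form]) _ h3
    rw [hR] at this
    simp only [map_add, map_mul, map_pow, Φ.aeval_Z, Φ.coord_vec, Matrix.cons_val] at this
    simp at this

lemma coord_of_mem_lineBar {p : Fin 4 → AlgebraicClosure K} (hp : p ∈ T.lineBar) :
    Φ.coord p 2 = 0 ∧ Φ.coord p 3 = 0 := by
  induction hp using Submodule.span_induction with
  | mem x hx =>
    obtain ⟨y, hy, rfl⟩ := hx
    obtain ⟨h2, h3⟩ := Φ.coord_of_mem hy
    rw [Φ.coord_algebraMap, Φ.coord_algebraMap, h2, h3, map_zero]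
    simp
  | zero => simp [coord]
  | add x y _ _ hx hy =>
    simp [Φ.coord_add, hx.1, hx.2, hy.1, hy.2]
  | smul a x _ hx =>
    simp [Φ.coord_smul, hx.1, hx.2]

/-- A singular point on the line is a common zero of A and B other than q₁, so A has the root -c₂/b₂
and the second relation is b₂²B(-c₂/b₂) = 0. -/
lemma of_singularAlongLine (hbc : Φ.D.b₂ ≠ 0 ∨ Φ.D.c₂ ≠ 0) (hs : T.SingularAlongLine) :
    Φ.D.b₂ ≠ 0 ∧ Φ.D.c₂ ^ 2 - Φ.D.b₂ * Φ.D.b₃ * Φ.D.c₂ + Φ.D.b₂ ^ 2 * Φ.D.c₃ = 0 := by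
  obtain ⟨p, hp, hp0, -, hd⟩ := hs
  obtain ⟨h2, h3⟩ := Φ.coord_of_mem_lineBar hp
  have hder : ∀ w, Φ.D.dform (Φ.coord p) (Φ.coord w) = 0 := by
    intro w
    rw [← Φ.dirDeriv_f, dirDeriv]
    simp [hd]
  have e1 := hder (Φ.vec ![0, 0, 1, 0])
  have e2 := hder (Φ.vec ![0, 0, 0, 1])
  simp only [Φ.coord_vec, LineCubic.dform, h2, h3, Matrix.cons_val] at e1 e2
  obtain ⟨i, hi⟩ : ∃ i, i = algebraMap K (AlgebraicClosure K) := ⟨_, rfl⟩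
  have hinj : Function.Injective i := hi ▸ (algebraMap K (AlgebraicClosure K)).injective
  rw [← hi] at e1 e2
  have e1' : Φ.coord p 1 * (Φ.coord p 0 * i Φ.D.b₂ + Φ.coord p 1 * i Φ.D.c₂) = 0 := by
    linear_combination e1
  have e2' : Φ.coord p 0 ^ 2 + Φ.coord p 0 * Φ.coord p 1 * i Φ.D.b₃
      + Φ.coord p 1 ^ 2 * i Φ.D.c₃ = 0 := by
    linear_combination e2
  have ht : Φ.coord p 1 ≠ 0 := by
    intro h1
    rw [h1] at e2'
    have h0 : Φ.coord p 0 = 0 := by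
      have : Φ.coord p 0 ^ 2 = 0 := by linear_combination e2'
      exact pow_eq_zero_iff two_ne_zero |>.mp this
    apply hp0
    rw [← Φ.vec_coord p]
    funext j
    simp [vec, Fin.sum_univ_four, h0, h1, h2, h3]
  have e3 := (mul_eq_zero.mp e1').resolve_left ht
  have hb : Φ.D.b₂ ≠ 0 := by
    intro hb
    rw [hb, map_zero, mul_zero, zero_add, mul_eq_zero, or_iff_right ht, ← map_zero i] at e3
    rcases hbc with h | h
    · exact h hb
    · exact h (hinj e3)
  refine ⟨hb, hinj ?_⟩
  simp only [map_add, map_sub, map_mul, map_pow, map_zero]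
  refine (mul_eq_zero.mp ?_).resolve_left (pow_ne_zero 2 ht)
  linear_combination i Φ.D.b₂ ^ 2 * e2' + (Φ.coord p 1 * i Φ.D.c₂ - Φ.coord p 0 * i Φ.D.b₂
    - Φ.coord p 1 * i Φ.D.b₂ * i Φ.D.b₃) * e3

/-- The residual conics all meet the line in the singular point t = -c₂/b₂, so the remaining
intersection is rational in x; the square root is the difference of the two. -/
lemma isSquare_lineDisc_of_singularAlongLine (hbc : Φ.D.b₂ ≠ 0 ∨ Φ.D.c₂ ≠ 0)
    (hs : T.SingularAlongLine) : IsSquare Φ.D.lineDisc := by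
  obtain ⟨hb, hc⟩ := Φ.of_singularAlongLine hbc hs
  refine ⟨Polynomial.C Φ.D.b₂ * Polynomial.X +
    Polynomial.C (Φ.D.b₃ - 2 * Φ.D.c₂ / Φ.D.b₂), ?_⟩
  have hc3 : Φ.D.c₃ = (Φ.D.b₂ * Φ.D.b₃ * Φ.D.c₂ - Φ.D.c₂ ^ 2) / Φ.D.b₂ ^ 2 := by
    field_simp
    linear_combination hc
  have hz : ∀ z : K, z = Φ.D.c₂ / Φ.D.b₂ → Φ.D.c₂ = Φ.D.b₂ * z ∧ Φ.D.c₃ = Φ.D.b₃ * z - z ^ 2 ∧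
      2 * Φ.D.c₂ / Φ.D.b₂ = 2 * z := by
    rintro z rfl
    rw [hc3]
    refine ⟨?_, ?_, ?_⟩ <;> field_simp
  obtain ⟨e1, e2, e3⟩ := hz _ rfl
  rw [e3, LineCubic.lineDisc, e2]
  generalize Φ.D.c₂ / Φ.D.b₂ = z at *
  rw [e1]
  simp only [map_sub, map_mul, map_pow, map_ofNat]
  ring

end AdaptedFrame

end CubicDensity

/-! ### The hypotheses AA2 and GA3 in adapted coordinates -/

namespace CubicDensity

universe u

namespace AdaptedFrame

variable {K : Type u} [Field K] {T : CubicWithLine K} (Φ : AdaptedFrame T)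

lemma ext_coord {A : Type*} [CommRing A] [Algebra K A] {v w : Fin 4 → A}
    (h : ∀ j, Φ.coord v j = Φ.coord w j) : v = w := by
  rw [← Φ.vec_coord v, funext h, Φ.vec_coord]

lemma coord_zero {A : Type*} [CommRing A] [Algebra K A] : Φ.coord (0 : Fin 4 → A) = 0 := by
  funext j
  simp [coord]

lemma coord_of_isPlaneFrame {p w : Fin 4 → K} (hpw : T.IsPlaneFrame p w) :
    (Φ.coord p 2 = 0 ∧ Φ.coord p 3 = 0) ∧ (Φ.coord w 1 = 0 ∧ Φ.coord w 3 = 0) ∧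
      Φ.coord p 1 ≠ 0 ∧ Φ.coord w 2 ≠ 0 := by
  obtain ⟨hli, hp, hw⟩ := hpw
  obtain ⟨hp2, hp3⟩ := Φ.coord_of_mem hp
  obtain ⟨hw1, hw3⟩ := Φ.coord_of_mem_tangentLine hw
  have hli' := Fintype.linearIndependent_iff.mp hli
  refine ⟨⟨hp2, hp3⟩, ⟨hw1, hw3⟩, fun hp1 => ?_, fun hw2 => ?_⟩
  · have := hli' ![-(Φ.coord p 0), 1, 0] (Φ.ext_coord fun j => ?_) 1
    · simp at this
    · simp only [Fin.sum_univ_three, Matrix.cons_val, Φ.coord_add, Φ.coord_smul, Φ.coord_q,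
        Φ.coord_zero, Pi.add_apply, Pi.smul_apply, smul_eq_mul, Pi.zero_apply]
      fin_cases j <;> simp [hp1, hp2, hp3]
  · have := hli' ![-(Φ.coord w 0), 0, 1] (Φ.ext_coord fun j => ?_) 2
    · simp at this
    · simp only [Fin.sum_univ_three, Matrix.cons_val, Φ.coord_add, Φ.coord_smul, Φ.coord_q,
        Φ.coord_zero, Pi.add_apply, Pi.smul_apply, smul_eq_mul, Pi.zero_apply]
      fin_cases j <;> simp [hw1, hw2, hw3]

lemma planeRestriction_eq {p w : Fin 4 → K} (hp : Φ.coord p 2 = 0 ∧ Φ.coord p 3 = 0)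
    (hw : Φ.coord w 1 = 0 ∧ Φ.coord w 3 = 0) : T.planeRestriction p w =
      Φ.D.form ![X 0 + C (Φ.coord p 0) * X 1 + C (Φ.coord w 0) * X 2, C (Φ.coord p 1) * X 1,
        C (Φ.coord w 2) * X 2, 0] := by
  have hc : ∀ j, Φ.coord (fun i => C (T.q i) * X 0 + C (p i) * X 1 + C (w i) * X 2 :
      Fin 4 → MvPolynomial (Fin 3) K) j =
      C (Φ.coord T.q j) * X 0 + C (Φ.coord p j) * X 1 + C (Φ.coord w j) * X 2 := by
    intro j
    simp only [coord, map_sum, Finset.sum_mul, ← Finset.sum_add_distrib]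
    exact Finset.sum_congr rfl fun i _ => by
      rw [MvPolynomial.algebraMap_eq, Algebra.algebraMap_self, RingHom.id_apply, map_mul, map_mul,
        map_mul]
      ring
  rw [CubicWithLine.planeRestriction, Φ.aeval_f]
  congr 1
  funext j
  rw [hc]
  fin_cases j <;> simp [Φ.coord_q, hp.1, hp.2, hw.1, hw.2]

/-- If b₂ = β₀ = 0, the residual conic in the plane X₃ = 0 does not involve X₀ and is a cone with
vertex q₁. -/
lemma ne_zero_of_AA2c (hβ : Φ.D.β₀ = 0) (h : T.AA2c) : Φ.D.b₂ ≠ 0 := by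
  intro hb
  obtain ⟨-, -, p, w, hpw, M, -, hM, hns⟩ := h
  obtain ⟨hp, hw, -, -⟩ := Φ.coord_of_isPlaneFrame hpw
  rw [Φ.planeRestriction_eq hp hw] at hM
  have hM' : M = C (Φ.coord w 2) * (C Φ.D.c₂ * C (Φ.coord p 1) ^ 2 * X 1 ^ 2
      + C Φ.D.γ₀ * C (Φ.coord p 1) * C (Φ.coord w 2) * X 1 * X 2
      + C Φ.D.κ₀ * C (Φ.coord w 2) ^ 2 * X 2 ^ 2) := by
    refine mul_left_cancel₀ (MvPolynomial.X_ne_zero (R := K) (2 : Fin 3)) ?_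
    rw [← hM]
    simp only [LineCubic.form, Matrix.cons_val, hb, hβ, map_zero, MvPolynomial.algebraMap_eq]
    ring
  obtain ⟨i, hi⟩ := hns ![1, 0, 0] (by
    intro h0
    simpa using congrFun h0 0) (by rw [hM']; simp)
  apply hi
  rw [hM']
  simp

/-- In the plane X₃ = 0 the residual conic is c₂X₁² + γ₀X₁X₂ + κ₀X₂². Rescaling coordinates changes
the product of its outer coefficients only by a square. -/
lemma isSquare_of_AA2d [CharZero K] (hβ : Φ.D.β₀ = 0) (hb : Φ.D.b₂ = 0) {E : Type u} [Field E]
    [Algebra K E] (h : T.AA2d E) : IsSquare (algebraMap K E (4 * Φ.D.c₂ * Φ.D.κ₀)) := by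
  obtain ⟨-, -, p, w, hpw, a, b, c, hM, hsq⟩ := h
  obtain ⟨hp, hw, hp1, hw2⟩ := Φ.coord_of_isPlaneFrame hpw
  rw [Φ.planeRestriction_eq hp hw] at hM
  have hev : ∀ s t : K, Φ.coord w 2 * t * (Φ.D.c₂ * Φ.coord p 1 ^ 2 * s ^ 2
      + Φ.D.γ₀ * Φ.coord p 1 * Φ.coord w 2 * s * t + Φ.D.κ₀ * Φ.coord w 2 ^ 2 * t ^ 2) =
      t * (a * t ^ 2 + c * (t * s) + b * s ^ 2) := by
    intro s t
    have h1 := congrArg (aeval ![0, s, t]) hM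
    rw [Φ.D.map_form] at h1
    simp only [LineCubic.form, Fin.isValue, map_mul, map_add, map_pow, aeval_X, aeval_C,
      Matrix.cons_val, hb, hβ, map_zero, Algebra.algebraMap_self, RingHom.id_apply] at h1
    linear_combination h1
  have h1 := hev 0 1
  have h2 := hev 1 1
  have h3 := hev (-1) 1
  have ea : a = Φ.coord w 2 ^ 3 * Φ.D.κ₀ := by linear_combination -h1
  have eb : b = Φ.coord w 2 * Φ.coord p 1 ^ 2 * Φ.D.c₂ := by
    linear_combination h1 - (h2 + h3) / 2
  obtain ⟨y, hy⟩ := hsq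
  have hne : Φ.coord w 2 ^ 2 * Φ.coord p 1 ≠ 0 := mul_ne_zero (pow_ne_zero 2 hw2) hp1
  refine ⟨algebraMap K E (2 / (Φ.coord w 2 ^ 2 * Φ.coord p 1)) * y, ?_⟩
  have : 4 * Φ.D.c₂ * Φ.D.κ₀ = (2 / (Φ.coord w 2 ^ 2 * Φ.coord p 1)) ^ 2 * (a * b) := by
    rw [ea, eb]
    field_simp
    ring
  rw [this, map_mul, hy, map_pow]
  ring

/-- By GA3 the conic avoids q₁, so the line passes through q₁ and is the tangent X₃ = 0 there,
giving β₀ = κ₀ = 0. The conic meets it where X₀² + β₁X₀X₂ + κ₁X₂² = 0, a quadratic with two distinct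
roots in E. -/
lemma isSquare_of_AA2e (hGA3 : T.GA3) {E : Type u} [Field E]
    [Algebra K E] (h : T.AA2e E) : Φ.D.β₀ = 0 ∧ Φ.D.κ₀ = 0 ∧ Φ.D.β₁ ^ 2 - 4 * Φ.D.κ₁ ≠ 0 ∧
      IsSquare (algebraMap K E (Φ.D.β₁ ^ 2 - 4 * Φ.D.κ₁)) := by
  obtain ⟨l, c, hl, hc, hlc, -, x, y, hli, ⟨hxh, hxl, hxc⟩, ⟨hyh, hyl, hyc⟩⟩ := h
  have hq : aeval T.q c ≠ 0 := fun h0 => hGA3 ⟨l, c, hl, hc, hlc, h0⟩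
  obtain ⟨g, hg⟩ := Ideal.mem_span_singleton.mp hlc
  have hf : T.f = l * c + T.h * g := by linear_combination hg
  obtain ⟨a, ha⟩ := exists_linear_coefficients hl
  -- the restriction of the cubic and its differential to the plane
  have hval : ∀ {A : Type u} [CommRing A] [Algebra K A] (v : Fin 4 → A), v 1 = 0 →
      Φ.D.form v = aeval (Φ.vec v) l * aeval (Φ.vec v) c := by
    intro A _ _ v hv
    have := Φ.aeval_f (Φ.vec v)
    rw [Φ.coord_vec, hf, map_add, map_mul, map_mul, Φ.aeval_h, Φ.coord_vec, hv] at this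
    rw [← this]; ring
  have hder : ∀ {A : Type u} [CommRing A] [Algebra K A] (v w : Fin 4 → A), v 1 = 0 → w 1 = 0 →
      Φ.D.dform v w = aeval (Φ.vec w) l * aeval (Φ.vec v) c
        + aeval (Φ.vec v) l * dirDeriv c (Φ.vec v) (Φ.vec w) := by
    intro A _ _ v w hv hw
    have := Φ.dirDeriv_f (Φ.vec v) (Φ.vec w)
    rw [Φ.coord_vec, Φ.coord_vec, hf, dirDeriv_add, dirDeriv_mul, dirDeriv_mul, Φ.aeval_h,
      Φ.coord_vec, hv, Φ.h_eq, dirDeriv_mul, dirDeriv_C, dirDeriv_linear] at this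
    have hw' : ∑ i, algebraMap K A (Φ.z i 1) * Φ.vec w i = 0 := by
      have := congrFun (Φ.coord_vec w) 1
      rw [hw] at this
      exact this
    have hl' : dirDeriv l (Φ.vec v) (Φ.vec w) = aeval (Φ.vec w) l := by
      rw [ha, dirDeriv_linear]; simp
    rw [hw', hl'] at this
    rw [← this]; ring
  have hqv : T.q = Φ.vec ![(1 : K), 0, 0, 0] := by rw [← Φ.coord_q, Φ.vec_coord]
  obtain ⟨l₀, hl₀⟩ : ∃ b, b = ∑ i, a i * Φ.e 0 i := ⟨_, rfl⟩
  obtain ⟨l₁, hl₁⟩ : ∃ b, b = ∑ i, a i * Φ.e 1 i := ⟨_, rfl⟩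
  obtain ⟨l₂, hl₂⟩ : ∃ b, b = ∑ i, a i * Φ.e 2 i := ⟨_, rfl⟩
  obtain ⟨l₃, hl₃⟩ : ∃ b, b = ∑ i, a i * Φ.e 3 i := ⟨_, rfl⟩
  have hlv : ∀ {A : Type u} [CommRing A] [Algebra K A] (v : Fin 4 → A), aeval (Φ.vec v) l =
      algebraMap K A l₀ * v 0 + algebraMap K A l₁ * v 1 + algebraMap K A l₂ * v 2
        + algebraMap K A l₃ * v 3 := by
    intro A _ _ v
    rw [ha, hl₀, hl₁, hl₂, hl₃]
    simp only [vec, Fin.sum_univ_four, map_add, map_mul, aeval_C, aeval_X]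
    ring
  have h0 : l₀ = 0 := by
    have := hval (A := K) ![1, 0, 0, 0] (by simp)
    rw [← hqv, hqv, hlv, ← hqv] at this
    simp only [LineCubic.form, Matrix.cons_val, Algebra.algebraMap_self, RingHom.id_apply] at this
    have h1 : l₀ * aeval T.q c = 0 := by linear_combination -this
    exact (mul_eq_zero.mp h1).resolve_right hq
  have h2 : l₂ = 0 := by
    have := hder (A := K) ![1, 0, 0, 0] ![0, 0, 1, 0] (by simp) (by simp)
    rw [hlv, hlv, ← hqv, h0] at this
    simp only [LineCubic.dform, Matrix.cons_val, Algebra.algebraMap_self, RingHom.id_apply] at this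
    have h1 : l₂ * aeval T.q c = 0 := by linear_combination -this
    exact (mul_eq_zero.mp h1).resolve_right hq
  have h3 : l₃ ≠ 0 := by
    intro h3
    have := hder (A := K) ![1, 0, 0, 0] ![0, 0, 0, 1] (by simp) (by simp)
    rw [hlv, hlv, ← hqv, h0, h3] at this
    simp [LineCubic.dform] at this
  have hβκ : ∀ s : K, Φ.D.β₀ * s + Φ.D.κ₀ = 0 := by
    intro s
    have := hval (A := K) ![s, 0, 1, 0] (by simp)
    rw [hlv, h0, h2] at this
    simp only [LineCubic.form, Matrix.cons_val, Algebra.algebraMap_self, RingHom.id_apply] at this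
    linear_combination this
  have hκ : Φ.D.κ₀ = 0 := by linear_combination hβκ 0
  have hβ : Φ.D.β₀ = 0 := by linear_combination hβκ 1 - hκ
  obtain ⟨i, hi⟩ : ∃ i, i = algebraMap K E := ⟨_, rfl⟩
  have hpt : ∀ x : Fin 4 → E, aeval x T.h = 0 → aeval x l = 0 → aeval x c = 0 →
      Φ.coord x 1 = 0 ∧ Φ.coord x 3 = 0 ∧ Φ.coord x 0 ^ 2 + i Φ.D.β₁ * Φ.coord x 0 * Φ.coord x 2
        + i Φ.D.κ₁ * Φ.coord x 2 ^ 2 = 0 := by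
    intro x hxh hxl hxc
    have h1 : Φ.coord x 1 = 0 := Φ.aeval_h_eq_zero.mp hxh
    have h3' : Φ.coord x 3 = 0 := by
      have := hlv (Φ.coord x)
      rw [Φ.vec_coord, hxl, h0, h1, h2] at this
      have h4 : algebraMap K E l₃ * Φ.coord x 3 = 0 := by
        rw [map_zero] at this
        linear_combination -this
      exact (mul_eq_zero.mp h4).resolve_left (by simpa using h3)
    refine ⟨h1, h3', ?_⟩
    -- Where line and conic both vanish, the restricted cubic has zero derivative. On X₁ = X₃ = 0
    -- its X₃-derivative is the quadratic wanted.
    have := hder (Φ.coord x) ![0, 0, 0, 1] h1 (by simp)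
    rw [Φ.vec_coord, hxc, hxl] at this
    simp only [LineCubic.dform, Matrix.cons_val, h1, h3', ← hi] at this
    linear_combination this
  obtain ⟨hx1, hx3, hx⟩ := hpt x hxh hxl hxc
  obtain ⟨hy1, hy3, hy⟩ := hpt y hyh hyl hyc
  have hnz : ∀ v : Fin 4 → E, v ≠ 0 → Φ.coord v 1 = 0 → Φ.coord v 3 = 0 → Φ.coord v 0 ^ 2 +
      i Φ.D.β₁ * Φ.coord v 0 * Φ.coord v 2 + i Φ.D.κ₁ * Φ.coord v 2 ^ 2 = 0 →
      Φ.coord v 2 ≠ 0 := by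
    intro v hv h1 h3 h h2
    rw [h2] at h
    have h0 : Φ.coord v 0 = 0 := by
      have : Φ.coord v 0 ^ 2 = 0 := by linear_combination h
      exact pow_eq_zero_iff two_ne_zero |>.mp this
    refine hv (Φ.ext_coord fun j => ?_)
    rw [Φ.coord_zero]
    fin_cases j <;> assumption
  have hx2 := hnz x (hli.ne_zero 0) hx1 hx3 hx
  have hy2 := hnz y (hli.ne_zero 1) hy1 hy3 hy
  have hdet : Φ.coord x 0 * Φ.coord y 2 - Φ.coord y 0 * Φ.coord x 2 ≠ 0 := by
    intro hdet
    have := (LinearIndependent.pair_iff.mp hli) (Φ.coord y 2) (-Φ.coord x 2) (by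
      refine Φ.ext_coord fun j => ?_
      rw [Φ.coord_add, Φ.coord_smul, Φ.coord_smul, Φ.coord_zero]
      fin_cases j
      · simp only [Fin.zero_eta, Pi.add_apply, Pi.smul_apply, smul_eq_mul, Pi.zero_apply]
        linear_combination hdet
      · simp [hx1, hy1]
      · simp only [Fin.reduceFinMk, Pi.add_apply, Pi.smul_apply, smul_eq_mul, Pi.zero_apply]
        ring
      · simp [hx3, hy3])
    exact hy2 this.1
  -- the two roots determine the quadratic polynomial
  obtain ⟨r, hr⟩ : ∃ r, r = Φ.coord x 0 / Φ.coord x 2 := ⟨_, rfl⟩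
  obtain ⟨s, hs⟩ : ∃ s, s = Φ.coord y 0 / Φ.coord y 2 := ⟨_, rfl⟩
  have hxr : Φ.coord x 0 = r * Φ.coord x 2 := by rw [hr]; field_simp
  have hys : Φ.coord y 0 = s * Φ.coord y 2 := by rw [hs]; field_simp
  rw [hxr] at hx hdet
  rw [hys] at hy hdet
  have hrs : r - s ≠ 0 := by
    intro h
    exact hdet (by linear_combination Φ.coord x 2 * Φ.coord y 2 * h)
  have er : r ^ 2 + i Φ.D.β₁ * r + i Φ.D.κ₁ = 0 := by
    refine (mul_eq_zero.mp ?_).resolve_left (pow_ne_zero 2 hx2)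
    linear_combination hx
  have es : s ^ 2 + i Φ.D.β₁ * s + i Φ.D.κ₁ = 0 := by
    refine (mul_eq_zero.mp ?_).resolve_left (pow_ne_zero 2 hy2)
    linear_combination hy
  have hb : i Φ.D.β₁ = -(r + s) := by
    have : (r - s) * (i Φ.D.β₁ + (r + s)) = 0 := by linear_combination er - es
    linear_combination (mul_eq_zero.mp this).resolve_left hrs
  have hk : i Φ.D.κ₁ = r * s := by
    rw [hb] at er
    linear_combination er
  have hsq : i (Φ.D.β₁ ^ 2 - 4 * Φ.D.κ₁) = (r - s) * (r - s) := by
    rw [map_sub, map_mul, map_pow, map_ofNat, hb, hk]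
    ring
  refine ⟨hβ, hκ, fun h0 => ?_, r - s, ?_⟩
  · rw [h0, map_zero] at hsq
    exact mul_ne_zero hrs hrs hsq.symm
  · rw [← hi, hsq]

/-- Let F be the equation of D₁ in its plane, and β, η the homogenized quadratics. If the
discriminant is η², then 4X₃F = (2X₃X₀ + β - η)(2X₃X₀ + β + η). When β and η have the same leading
coefficient, X₃ divides the first factor, and D₁ becomes a line and a conic through q₁. -/
lemma not_isSquare_boundaryDisc [CharZero K] (hGA3 : T.GA3) : ¬ IsSquare Φ.D.boundaryDisc := by
  rintro ⟨η, hη⟩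
  have hdeg : η.natDegree ≤ 2 := by
    have h1 : Φ.D.boundaryDisc.natDegree ≤ 4 := by
      unfold LineCubic.boundaryDisc; compute_degree
    rw [hη, ← sq, Polynomial.natDegree_pow] at h1
    omega
  obtain ⟨η₀, η₁, η₂, hη'⟩ : ∃ η₀ η₁ η₂ : K, ∀ x, η.eval x = η₀ * x ^ 2 + η₁ * x + η₂ := by
    refine ⟨η.coeff 2, η.coeff 1, η.coeff 0, fun x => ?_⟩
    rw [Polynomial.eval_eq_sum_range' (n := 3) (by omega)]
    simp only [Finset.sum_range_succ, Finset.sum_range_zero]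
    ring
  have hev : ∀ x : K, (Φ.D.β₀ * x ^ 2 + Φ.D.β₁ * x + Φ.D.β₂) ^ 2
      - 4 * (Φ.D.κ₀ * x ^ 3 + Φ.D.κ₁ * x ^ 2 + Φ.D.κ₂ * x + Φ.D.κ₃) =
      (η₀ * x ^ 2 + η₁ * x + η₂) ^ 2 := by
    intro x
    have := congrArg (Polynomial.eval x) hη
    rw [Polynomial.eval_mul, hη'] at this
    simp only [LineCubic.boundaryDisc, Polynomial.eval_add, Polynomial.eval_sub,
      Polynomial.eval_mul, Polynomial.eval_pow, Polynomial.eval_C, Polynomial.eval_X,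
      Polynomial.eval_ofNat] at this
    linear_combination this
  have main : ∀ η₀ η₁ η₂ : K, (∀ x : K, (Φ.D.β₀ * x ^ 2 + Φ.D.β₁ * x + Φ.D.β₂) ^ 2
      - 4 * (Φ.D.κ₀ * x ^ 3 + Φ.D.κ₁ * x ^ 2 + Φ.D.κ₂ * x + Φ.D.κ₃) =
      (η₀ * x ^ 2 + η₁ * x + η₂) ^ 2) → Φ.D.β₀ = η₀ → False := by
    intro η₀ η₁ η₂ hev h0
    -- Interpolation at 0, ±1, ±2 recovers the coefficients of the quartic identity.
    have v0 := hev 0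
    have v1 := hev 1
    have v2 := hev (-1)
    have v3 := hev 2
    have v4 := hev (-2)
    have k3 : 4 * Φ.D.κ₃ = (Φ.D.β₂ - η₂) * (Φ.D.β₂ + η₂) := by linear_combination -v0
    have k1 : 4 * Φ.D.κ₁ = (Φ.D.β₁ - η₁) * (Φ.D.β₁ + η₁) + (Φ.D.β₂ - η₂) * (Φ.D.β₀ + η₀) := by
      linear_combination (v3 + v4) / 24 - 2 / 3 * (v1 + v2) + 5 / 4 * v0 + (Φ.D.β₂ + η₂) * h0
    have k0 : 4 * Φ.D.κ₀ = (Φ.D.β₁ - η₁) * (Φ.D.β₀ + η₀) := by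
      linear_combination -(v3 - v4) / 12 + (v1 - v2) / 6 + (Φ.D.β₁ + η₁) * h0
    have k2 : 4 * Φ.D.κ₂ = (Φ.D.β₁ - η₁) * (Φ.D.β₂ + η₂) + (Φ.D.β₂ - η₂) * (Φ.D.β₁ + η₁) := by
      linear_combination (v3 - v4) / 12 - 2 / 3 * (v1 - v2)
    refine hGA3 ⟨2 * Φ.Z 0 + C (Φ.D.β₁ - η₁) * Φ.Z 2 + C (Φ.D.β₂ - η₂) * Φ.Z 3,
      C 4⁻¹ * (2 * Φ.Z 3 * Φ.Z 0 + C (Φ.D.β₀ + η₀) * Φ.Z 2 ^ 2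
        + C (Φ.D.β₁ + η₁) * Φ.Z 2 * Φ.Z 3 + C (Φ.D.β₂ + η₂) * Φ.Z 3 ^ 2), ?_, ?_, ?_, ?_⟩
    · have h2 : (2 : MvPolynomial (Fin 4) K) = C 2 := (map_ofNat C 2).symm
      rw [h2]
      exact (((Φ.Z_isHomogeneous 0).C_mul _).add ((Φ.Z_isHomogeneous 2).C_mul _)).add
        ((Φ.Z_isHomogeneous 3).C_mul _)
    · have h2 : (2 : MvPolynomial (Fin 4) K) = C 2 := (map_ofNat C 2).symm
      rw [h2]
      exact ((((((Φ.Z_isHomogeneous 3).C_mul _).mul (Φ.Z_isHomogeneous 0)).add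
        (((Φ.Z_isHomogeneous 2).pow 2).C_mul _)).add
        (((Φ.Z_isHomogeneous 2).C_mul _).mul (Φ.Z_isHomogeneous 3))).add
        (((Φ.Z_isHomogeneous 3).pow 2).C_mul _)).C_mul _
    · have hC : ∀ a : K, algebraMap K (MvPolynomial (Fin 4) K) a = C a := fun _ => rfl
      have e4 : (C 4⁻¹ : MvPolynomial (Fin 4) K) * 4 = 1 := by
        rw [← map_ofNat (C : K →+* MvPolynomial (Fin 4) K), ← map_mul,
          inv_mul_cancel₀ (by norm_num), map_one]
      have c0 := congrArg (C : K →+* MvPolynomial (Fin 4) K) h0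
      have c1 := congrArg (C : K →+* MvPolynomial (Fin 4) K) k0
      have c2 := congrArg (C : K →+* MvPolynomial (Fin 4) K) k1
      have c3 := congrArg (C : K →+* MvPolynomial (Fin 4) K) k2
      have c4 := congrArg (C : K →+* MvPolynomial (Fin 4) K) k3
      simp only [map_mul, map_add, map_sub, map_ofNat] at c0 c1 c2 c3 c4
      convert Ideal.mul_mem_right (Φ.Z 0 * (C Φ.D.b₂ * Φ.Z 2 + C Φ.D.b₃ * Φ.Z 3)
        + Φ.Z 1 * (C Φ.D.c₂ * Φ.Z 2 + C Φ.D.c₃ * Φ.Z 3)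
        + (C Φ.D.γ₀ * Φ.Z 2 ^ 2 + C Φ.D.γ₁ * Φ.Z 2 * Φ.Z 3 + C Φ.D.γ₂ * Φ.Z 3 ^ 2)) _
        Φ.Z_mem_span_h using 1
      rw [Φ.f_eq_form_Z]
      simp only [LineCubic.form, hC, map_add, map_sub]
      linear_combination -(Φ.Z 3 * Φ.Z 0 ^ 2 + Φ.Z 0 * (C Φ.D.β₀ * Φ.Z 2 ^ 2
        + C Φ.D.β₁ * Φ.Z 2 * Φ.Z 3 + C Φ.D.β₂ * Φ.Z 3 ^ 2) + C Φ.D.κ₀ * Φ.Z 2 ^ 3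
        + C Φ.D.κ₁ * Φ.Z 2 ^ 2 * Φ.Z 3 + C Φ.D.κ₂ * Φ.Z 2 * Φ.Z 3 ^ 2 + C Φ.D.κ₃ * Φ.Z 3 ^ 3) * e4
        + C 4⁻¹ * (2 * Φ.Z 0 * Φ.Z 2 ^ 2 * c0 + Φ.Z 2 ^ 3 * c1 + Φ.Z 2 ^ 2 * Φ.Z 3 * c2
          + Φ.Z 2 * Φ.Z 3 ^ 2 * c3 + Φ.Z 3 ^ 3 * c4)
    · simp only [map_mul, map_add, map_pow, Φ.aeval_Z, Φ.coord_q, Matrix.cons_val]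
      ring
  have v0 : Φ.D.β₀ ^ 2 = η₀ ^ 2 := by
    have v0 := hev 0
    have v1 := hev 1
    have v2 := hev (-1)
    have v3 := hev 2
    have v4 := hev (-2)
    linear_combination (v3 + v4) / 24 - (v1 + v2) / 6 + v0 / 4
  -- The sign of η is free, so its leading coefficient may be taken equal to β₀.
  rcases sq_eq_sq_iff_eq_or_eq_neg.mp v0 with h | h
  · exact main η₀ η₁ η₂ hev h
  · exact main (-η₀) (-η₁) (-η₂) (fun x => by rw [hev]; ring) h

end AdaptedFrame

end CubicDensity

/-! ### Branch loci and the hypotheses GA4a, GA4b -/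

namespace CubicDensity

universe u

lemma prime_linearForm {F : Type*} [Field F] {p : Fin 2 → F} (hp : p ≠ 0) :
    Prime (C (p 1) * X 0 - C (p 0) * X 1 : MvPolynomial (Fin 2) F) := by
  have h : (C (p 1) * X 0 - C (p 0) * X 1 : MvPolynomial (Fin 2) F) =
      sumSMulX (Finsupp.equivFunOnFinite.symm ![p 1, -p 0]) := by
    rw [sumSMulX, Finsupp.linearCombination_apply, Finsupp.sum_fintype _ _ (by simp)]
    simp [Fin.sum_univ_two, smul_eq_C_mul, sub_eq_add_neg]
  obtain ⟨i, hi⟩ : ∃ i, (![p 1, -p 0] : Fin 2 → F) i ≠ 0 := by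
    by_contra! h0
    apply hp
    funext i
    fin_cases i
    · simpa using h0 1
    · simpa using h0 0
  rw [h]
  refine (irreducible_sumSMulX _ ⟨i, ?_⟩ fun r hr => ?_).prime
  · simpa using hi
  · refine isUnit_iff_ne_zero.mpr fun h0 => ?_
    have := hr i
    rw [h0, zero_dvd_iff] at this
    exact hi (by simpa using this)

/-- If the product of two discriminants is a square, their multiplicities along any linear form have
the same parity. -/
lemma branchLocus_subset {K : Type*} [Field K] {a b c a' b' c' : MvPolynomial (Fin 2) K}
    (h : b ^ 2 - 4 * a * c ≠ 0) (h' : b' ^ 2 - 4 * a' * c' ≠ 0)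
    (hsq : IsSquare ((b ^ 2 - 4 * a * c) * (b' ^ 2 - 4 * a' * c'))) :
    branchLocus a b c ⊆ branchLocus a' b' c' := by
  rintro p ⟨hp, k, hk, hmul⟩
  have hprime := prime_linearForm hp
  have hinj := MvPolynomial.map_injective (σ := Fin 2) (algebraMap K (AlgebraicClosure K))
    (algebraMap K (AlgebraicClosure K)).injective
  obtain ⟨r, hr⟩ := hsq
  have hr0 : r ≠ 0 := by
    rintro rfl
    rw [mul_zero] at hr
    exact mul_ne_zero h h' hr
  have hfin : ∀ s : MvPolynomial (Fin 2) K, s ≠ 0 → ∃ n : ℕ,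
      emultiplicity (C (p 1) * X 0 - C (p 0) * X 1)
        (MvPolynomial.map (algebraMap K (AlgebraicClosure K)) s) = n := by
    intro s hs
    exact ⟨_, (FiniteMultiplicity.of_prime_left hprime
      ((map_ne_zero_iff _ hinj).mpr hs)).emultiplicity_eq_multiplicity⟩
  obtain ⟨k', hk'⟩ := hfin _ h'
  obtain ⟨n, hn⟩ := hfin _ hr0
  refine ⟨hp, k', ?_, hk'⟩
  have := congrArg (fun s => emultiplicity (C (p 1) * X 0 - C (p 0) * X 1)
        (MvPolynomial.map (algebraMap K (AlgebraicClosure K)) s)) hr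
  simp only [map_mul (MvPolynomial.map (algebraMap K (AlgebraicClosure K))) r r,
    map_mul (MvPolynomial.map (algebraMap K (AlgebraicClosure K))) (b ^ 2 - 4 * a * c)] at this
  rw [emultiplicity_mul hprime, emultiplicity_mul hprime, hmul, hk', hn] at this
  have hnat : k + k' = n + n := by exact_mod_cast this
  rw [Nat.odd_iff] at hk ⊢
  omega

namespace AdaptedFrame

variable {K : Type u} [Field K] {T : CubicWithLine K} (Φ : AdaptedFrame T)

lemma coord_of_isFrame {p m n : Fin 4 → K} (h : T.IsFrame p m n) :
    (Φ.coord p 2 = 0 ∧ Φ.coord p 3 = 0) ∧ Φ.coord m 1 = 0 ∧ Φ.coord n 1 = 0 ∧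
      Φ.coord p 1 ≠ 0 ∧ Φ.coord m 2 * Φ.coord n 3 - Φ.coord m 3 * Φ.coord n 2 ≠ 0 := by
  obtain ⟨hli, hp, hm, hn⟩ := h
  obtain ⟨hp2, hp3⟩ := Φ.coord_of_mem hp
  rw [Φ.aeval_h_eq_zero] at hm hn
  have hli' := Fintype.linearIndependent_iff.mp hli
  refine ⟨⟨hp2, hp3⟩, hm, hn, fun hp1 => ?_, fun hdet => ?_⟩
  · have := hli' ![-(Φ.coord p 0), 1, 0, 0] (Φ.ext_coord fun j => ?_) 1
    · simp at this
    · simp only [Fin.sum_univ_four, Matrix.cons_val, Φ.coord_add, Φ.coord_smul, Φ.coord_q,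
        Φ.coord_zero, Pi.add_apply, Pi.smul_apply, smul_eq_mul, Pi.zero_apply]
      fin_cases j <;> simp [hp1, hp2, hp3]
  · have key : ∀ s t : K, s * Φ.coord m 2 + t * Φ.coord n 2 = 0 →
        s * Φ.coord m 3 + t * Φ.coord n 3 = 0 → s = 0 ∧ t = 0 := by
      intro s t h2 h3
      have := hli' ![-(s * Φ.coord m 0 + t * Φ.coord n 0), 0, s, t] (Φ.ext_coord fun j => ?_)
      · exact ⟨by simpa using this 2, by simpa using this 3⟩
      · simp only [Fin.sum_univ_four, Matrix.cons_val, Φ.coord_add, Φ.coord_smul, Φ.coord_q,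
          Φ.coord_zero, Pi.add_apply, Pi.smul_apply, smul_eq_mul, Pi.zero_apply]
        fin_cases j
        · simp
        · simp [hm, hn]
        · simpa using h2
        · simpa using h3
    have k1 := key (Φ.coord n 3) (-Φ.coord m 3) (by linear_combination hdet) (by ring)
    have k2 := key (Φ.coord n 2) (-Φ.coord m 2) (by ring) (by linear_combination -hdet)
    have k3 := key 1 0 (by rw [neg_eq_zero.mp k2.2]; ring) (by rw [neg_eq_zero.mp k1.2]; ring)
    exact one_ne_zero k3.1

lemma coord_pencil (m n : Fin 4 → K) (j : Fin 4) : Φ.coord (CubicWithLine.pencil m n) j =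
    C (Φ.coord m j) * X 0 + C (Φ.coord n j) * X 1 := by
  simp only [coord, CubicWithLine.pencil, map_sum, Finset.sum_mul, ← Finset.sum_add_distrib]
  exact Finset.sum_congr rfl fun i _ => by
    rw [MvPolynomial.algebraMap_eq, Algebra.algebraMap_self, RingHom.id_apply, map_mul, map_mul]
    ring

lemma coord_const (x : Fin 4 → K) (j : Fin 4) : Φ.coord (CubicWithLine.const x) j =
    C (Φ.coord x j) :=
  Φ.coord_algebraMap x j

/-- If the discriminants of boundary and line agree up to squares, the branch loci coincide. -/
lemma not_GA4a (hδ : Φ.D.boundaryDisc ≠ 0) (hlne : Φ.D.lineDisc ≠ 0)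
    (hsq : IsSquare (Φ.D.boundaryDisc * Φ.D.lineDisc)) : ¬ T.GA4a := by
  rintro ⟨p, m, n, hframe, hne⟩
  apply hne
  obtain ⟨⟨hp2, hp3⟩, hm1, hn1, hp1, hdet⟩ := Φ.coord_of_isFrame hframe
  obtain ⟨x, hx⟩ : ∃ x : MvPolynomial (Fin 2) K, x = C (Φ.coord m 2) * X 0 + C (Φ.coord n 2) * X 1 :=
    ⟨_, rfl⟩
  obtain ⟨y, hy⟩ : ∃ y : MvPolynomial (Fin 2) K, y = C (Φ.coord m 3) * X 0 + C (Φ.coord n 3) * X 1 :=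
    ⟨_, rfl⟩
  obtain ⟨δ, hδ'⟩ : ∃ δ, δ = (C Φ.D.β₀ * x ^ 2 + C Φ.D.β₁ * x * y + C Φ.D.β₂ * y ^ 2) ^ 2
    - 4 * y * (C Φ.D.κ₀ * x ^ 3 + C Φ.D.κ₁ * x ^ 2 * y + C Φ.D.κ₂ * x * y ^ 2
      + C Φ.D.κ₃ * y ^ 3) := ⟨_, rfl⟩
  obtain ⟨l, hl⟩ : ∃ l, l = (C Φ.D.b₂ * x + C Φ.D.b₃ * y) ^ 2
    - 4 * y * (C Φ.D.c₂ * x + C Φ.D.c₃ * y) := ⟨_, rfl⟩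
  -- dehomogenization
  obtain ⟨σ, hσ⟩ : ∃ σ : MvPolynomial (Fin 2) K →ₐ[K] Polynomial K, σ = aeval
      ![Polynomial.C (Φ.coord m 2 * Φ.coord n 3 - Φ.coord m 3 * Φ.coord n 2)⁻¹ *
          (Polynomial.C (Φ.coord n 3) * Polynomial.X - Polynomial.C (Φ.coord n 2)),
        Polynomial.C (Φ.coord m 2 * Φ.coord n 3 - Φ.coord m 3 * Φ.coord n 2)⁻¹ *
          (-Polynomial.C (Φ.coord m 3) * Polynomial.X + Polynomial.C (Φ.coord m 2))] := ⟨_, rfl⟩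
  have hdetC : Polynomial.C (Φ.coord m 2 * Φ.coord n 3 - Φ.coord m 3 * Φ.coord n 2)⁻¹ *
      (Polynomial.C (Φ.coord m 2) * Polynomial.C (Φ.coord n 3)
        - Polynomial.C (Φ.coord m 3) * Polynomial.C (Φ.coord n 2)) = 1 := by
    rw [← map_mul, ← map_mul, ← map_sub, ← map_mul, inv_mul_cancel₀ hdet, map_one]
  have hσx : σ x = Polynomial.X := by
    rw [hx, hσ]
    simp only [map_add, map_mul, aeval_C, aeval_X, Matrix.cons_val, Polynomial.algebraMap_eq]
    linear_combination Polynomial.X * hdetC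
  have hσy : σ y = 1 := by
    rw [hy, hσ]
    simp only [map_add, map_mul, aeval_C, aeval_X, Matrix.cons_val, Polynomial.algebraMap_eq]
    linear_combination hdetC
  have hσC : ∀ a, σ (C a) = Polynomial.C a := fun a => by
    rw [hσ, aeval_C, Polynomial.algebraMap_eq]
  have hδ0 : δ ≠ 0 := by
    intro h0
    have := congrArg σ h0
    rw [hδ'] at this
    simp only [map_sub, map_add, map_mul, map_pow, map_ofNat, hσC, hσx, hσy, map_zero] at this
    apply hδ
    rw [LineCubic.boundaryDisc, ← this]
    ring
  have hl0 : l ≠ 0 := by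
    intro h0
    have := congrArg σ h0
    rw [hl] at this
    simp only [map_sub, map_add, map_mul, map_pow, map_ofNat, hσC, hσx, hσy, map_zero] at this
    apply hlne
    rw [LineCubic.lineDisc, ← this]
    ring
  have hy0 : y ≠ 0 := by
    rintro rfl
    rw [map_zero] at hσy
    exact zero_ne_one hσy
  -- Homogenization: the total degree 4 + 2 is even, so δl = (y³W(x/y))² in the fraction field. A
  -- square root in the fraction field is already a polynomial.
  have hsq' : IsSquare (δ * l) := by
    refine isSquare_of_isSquare_algebraMap (F := FractionRing (MvPolynomial (Fin 2) K)) ?_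
    obtain ⟨W, hW⟩ := hsq
    obtain ⟨i, hi⟩ : ∃ i, i = algebraMap (MvPolynomial (Fin 2) K)
      (FractionRing (MvPolynomial (Fin 2) K)) := ⟨_, rfl⟩
    have hiy : i y ≠ 0 := by
      rw [hi]
      exact (map_ne_zero_iff _ (IsFractionRing.injective _ _)).mpr hy0
    have := congrArg (Polynomial.eval₂ (i.comp C) (i x / i y)) hW
    have h4 : Polynomial.eval₂ (i.comp C) (i x / i y) (4 : Polynomial K) = 4 := by
      rw [← Polynomial.coe_eval₂RingHom, map_ofNat]
    simp only [LineCubic.boundaryDisc, LineCubic.lineDisc, Polynomial.eval₂_mul,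
      Polynomial.eval₂_sub, Polynomial.eval₂_add, Polynomial.eval₂_pow, Polynomial.eval₂_C,
      Polynomial.eval₂_X, h4, RingHom.comp_apply] at this
    refine ⟨i y ^ 3 * Polynomial.eval₂ (i.comp C) (i x / i y) W, ?_⟩
    rw [← hi, mul_mul_mul_comm, ← this, hδ', hl]
    simp only [map_sub, map_add, map_mul, map_pow, map_ofNat]
    field_simp
  have hu : (C (Φ.coord p 1) : MvPolynomial (Fin 2) K) ≠ 0 := by simpa using hp1
  have eB : dirDeriv T.f (CubicWithLine.pencil m n) (CubicWithLine.const T.q) ^ 2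
      - 4 * dirDeriv T.f (CubicWithLine.const T.q) (CubicWithLine.pencil m n)
        * aeval (CubicWithLine.pencil m n) T.f = δ := by
    rw [Φ.dirDeriv_f, Φ.dirDeriv_f, Φ.aeval_f, hδ']
    simp only [LineCubic.dform, LineCubic.form, Φ.coord_pencil, Φ.coord_const, Φ.coord_q, hm1, hn1,
      Matrix.cons_val, ← hx, ← hy, map_zero, map_one, MvPolynomial.algebraMap_eq]
    ring
  -- An arbitrary frame changes the discriminant of the line only by the square of the X₁-coordinate
  -- of p.
  have eL : (dirDeriv T.f (CubicWithLine.const (T.q + p)) (CubicWithLine.pencil m n)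
        - dirDeriv T.f (CubicWithLine.const T.q) (CubicWithLine.pencil m n)
        - dirDeriv T.f (CubicWithLine.const p) (CubicWithLine.pencil m n)) ^ 2
      - 4 * dirDeriv T.f (CubicWithLine.const T.q) (CubicWithLine.pencil m n)
        * dirDeriv T.f (CubicWithLine.const p) (CubicWithLine.pencil m n) =
      C (Φ.coord p 1) ^ 2 * l := by
    rw [Φ.dirDeriv_f, Φ.dirDeriv_f, Φ.dirDeriv_f, hl]
    simp only [LineCubic.dform, Φ.coord_pencil, Φ.coord_const, Φ.coord_add, Pi.add_apply,
      Φ.coord_q, hm1, hn1, hp2, hp3, Matrix.cons_val, ← hx, ← hy, map_add, map_zero, map_one,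
      MvPolynomial.algebraMap_eq]
    ring
  have hB := eB ▸ hδ0
  have hL := eL ▸ mul_ne_zero (pow_ne_zero 2 hu) hl0
  have hprod : IsSquare (δ * (C (Φ.coord p 1) ^ 2 * l)) := by
    obtain ⟨r, hr⟩ := hsq'
    exact ⟨C (Φ.coord p 1) * r, by linear_combination C (Φ.coord p 1) ^ 2 * hr⟩
  refine Set.Subset.antisymm (branchLocus_subset hB hL ?_) (branchLocus_subset hL hB ?_)
  · rw [eB, eL]
    exact hprod
  · rw [eB, eL, mul_comm]
    exact hprod

/-- A double root x would make D₁ singular at (-β(x)/2 : 0 : x : 1), the double point of D₁ on the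
line through q₁ with parameter x. -/
lemma squarefree_boundaryDisc [CharZero K] (h : T.GA4b) : Squarefree Φ.D.boundaryDisc := by
  refine Polynomial.Separable.squarefree ?_
  rw [Polynomial.separable_def,
    Polynomial.isCoprime_iff_aeval_ne_zero_of_isAlgClosed K (AlgebraicClosure K)]
  intro x
  by_contra! hx
  obtain ⟨h1, h2⟩ := hx
  simp only [LineCubic.boundaryDisc, Polynomial.derivative_mul,
    Polynomial.derivative_pow, Polynomial.derivative_C,
    Polynomial.derivative_X, Polynomial.derivative_ofNat, map_sub, map_add, map_mul, map_pow,
    Polynomial.aeval_X, Polynomial.aeval_C, map_ofNat, map_zero, map_one, map_natCast] at h1 h2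
  obtain ⟨i, hi⟩ : ∃ i, i = algebraMap K (AlgebraicClosure K) := ⟨_, rfl⟩
  rw [← hi] at h1 h2
  obtain ⟨t, ht⟩ : ∃ t, t = -(i Φ.D.β₀ * x ^ 2 + i Φ.D.β₁ * x + i Φ.D.β₂) / 2 := ⟨_, rfl⟩
  obtain ⟨w, hw1, hw⟩ := h (Φ.vec ![t, 0, x, 1]) (by
    intro h0
    have := Φ.coord_vec ![t, 0, x, 1]
    rw [h0, Φ.coord_zero] at this
    simpa using congrFun this 3) (by
    rw [Φ.aeval_f, Φ.coord_vec]
    simp only [LineCubic.form, Matrix.cons_val, ← hi]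
    rw [ht]
    linear_combination -h1 / 4) (by
    rw [Φ.aeval_h_eq_zero, Φ.coord_vec]; simp)
  apply hw
  rw [Φ.aeval_h_eq_zero] at hw1
  rw [Φ.dirDeriv_f, Φ.coord_vec]
  simp only [LineCubic.dform, Matrix.cons_val, ← hi, hw1]
  rw [ht]
  push_cast at h2
  linear_combination (-(Φ.coord w 2 - x * Φ.coord w 3) / 4) * h2 - 3 / 4 * Φ.coord w 3 * h1

/-- The coefficient in degree four is β₀². If it vanishes, the next is -4κ₀; if both vanish, D₁
contains the line X₃ = 0 and is singular where the residual conic meets it. -/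
lemma natDegree_boundaryDisc [CharZero K] (h : T.GA4b) : 3 ≤ Φ.D.boundaryDisc.natDegree := by
  by_cases hβ : Φ.D.β₀ = 0
  · have hκ : Φ.D.κ₀ ≠ 0 := by
      intro hκ
      obtain ⟨i, hi⟩ : ∃ i, i = algebraMap K (AlgebraicClosure K) := ⟨_, rfl⟩
      obtain ⟨t, ht⟩ : ∃ t, t ^ 2 + i Φ.D.β₁ * t + i Φ.D.κ₁ = 0 := by
        obtain ⟨s, hs⟩ := IsAlgClosed.exists_pow_nat_eq (i Φ.D.β₁ ^ 2 - 4 * i Φ.D.κ₁) two_pos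
        exact ⟨(-i Φ.D.β₁ + s) / 2, by linear_combination hs / 4⟩
      obtain ⟨w, hw1, hw⟩ := h (Φ.vec ![t, 0, 1, 0]) (by
        intro h0
        have := Φ.coord_vec ![t, 0, 1, 0]
        rw [h0, Φ.coord_zero] at this
        simpa using congrFun this 2) (by
        rw [Φ.aeval_f, Φ.coord_vec]
        simp [LineCubic.form, hβ, hκ]) (by
        rw [Φ.aeval_h_eq_zero, Φ.coord_vec]; simp)
      apply hw
      rw [Φ.aeval_h_eq_zero] at hw1
      rw [Φ.dirDeriv_f, Φ.coord_vec]
      simp only [LineCubic.dform, Matrix.cons_val, ← hi, hw1, hβ, hκ, map_zero]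
      linear_combination Φ.coord w 3 * ht
    have h2 : Φ.D.boundaryDisc.coeff 3 = -(4 * Φ.D.κ₀) := by
      unfold LineCubic.boundaryDisc
      simp only [hβ, map_zero, zero_mul, zero_add]
      compute_degree!
    exact Polynomial.le_natDegree_of_ne_zero
      (h2 ▸ neg_ne_zero.mpr (mul_ne_zero (by norm_num) hκ))
  · have h2 : Φ.D.boundaryDisc.coeff 4 = Φ.D.β₀ ^ 2 := by
      unfold LineCubic.boundaryDisc
      compute_degree!
    exact le_trans (by norm_num) (Polynomial.le_natDegree_of_ne_zero (h2 ▸ pow_ne_zero 2 hβ))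

/-- A squarefree polynomial of degree at least three cannot agree up to squares with a nonzero one
of degree at most two. -/
lemma not_GA4b [CharZero K] (hlne : ¬ IsSquare Φ.D.lineDisc)
    (hsq : IsSquare (Φ.D.boundaryDisc * Φ.D.lineDisc)) : ¬ T.GA4b := by
  intro h
  have hsf := Φ.squarefree_boundaryDisc h
  have hdeg := Φ.natDegree_boundaryDisc h
  have hδ : Φ.D.boundaryDisc ≠ 0 := hsf.ne_zero
  obtain ⟨W, hW⟩ := hsq
  obtain ⟨V, hV⟩ : Φ.D.boundaryDisc ∣ W :=
    hsf.isRadical 2 W ⟨Φ.D.lineDisc, by rw [sq, hW]⟩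
  have hl : Φ.D.lineDisc = Φ.D.boundaryDisc * V ^ 2 := by
    refine mul_left_cancel₀ hδ ?_
    rw [hW, hV]
    ring
  have hV0 : V ≠ 0 := by
    rintro rfl
    exact hlne ⟨0, by rw [hl]; ring⟩
  have h2 : Φ.D.lineDisc.natDegree ≤ 2 := by
    unfold LineCubic.lineDisc; compute_degree
  rw [hl, Polynomial.natDegree_mul hδ (pow_ne_zero 2 hV0)] at h2
  omega

end AdaptedFrame

end CubicDensity

/-! ### Integral models and congruences -/

namespace CubicDensity

universe u

/-- The Gauss lemma for products with a linear form. -/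
lemma valuation_mul_coeff_le_one {K Γ₀ : Type*} [Field K] [LinearOrderedCommGroupWithZero Γ₀]
    (w : Valuation K Γ₀) (a : Fin 4 → K) (P : MvPolynomial (Fin 4) K)
    (hint : ∀ d, w (coeff d ((∑ j, C (a j) * X j) * P)) ≤ 1) (j : Fin 4) (d : Fin 4 →₀ ℕ) :
    w (a j * coeff d P) ≤ 1 := by
  classical
  by_cases hP : P = 0
  · simp [hP]
  obtain ⟨j₀, hj₀⟩ := Finite.exists_max fun j => w (a j)
  by_cases ha : a j₀ = 0
  · have : a j = 0 := by
      have h := hj₀ j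
      simp only [ha, map_zero] at h
      exact (map_eq_zero w).mp (le_antisymm h zero_le)
    simp [this]
  obtain ⟨d₁, hd₁, hmax⟩ := P.support.exists_max_image (fun d => w (coeff d P))
    (MvPolynomial.support_nonempty.mpr hP)
  have hle : ∀ d, w (coeff d P) ≤ w (coeff d₁ P) := by
    intro d
    by_cases hd : d ∈ P.support
    · exact hmax d hd
    · rw [MvPolynomial.notMem_support_iff.mp hd, map_zero]
      exact zero_le
  -- Among the monomials of P with largest coefficient, take one of largest degree in X_{j₀}. In the
  -- product with the linear form, the coefficient at X_{j₀} times it is then dominated by a single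
  -- term.
  obtain ⟨d₀, hd₀, hmax₀⟩ := (P.support.filter fun d => w (coeff d P) = w (coeff d₁ P)).exists_max_image
    (fun d => d j₀) ⟨d₁, by simp [MvPolynomial.mem_support_iff.mp hd₁]⟩
  rw [Finset.mem_filter] at hd₀
  have hd₁0 : 0 < w (coeff d₁ P) := by
    rw [Valuation.pos_iff]
    exact MvPolynomial.mem_support_iff.mp hd₁
  have ha0 : 0 < w (a j₀) := (Valuation.pos_iff w).mpr ha
  have hmain : w (a j₀ * coeff d₀ P) ≤ 1 := by
    have h := hint (Finsupp.single j₀ 1 + d₀)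
    rw [Finset.sum_mul, MvPolynomial.coeff_sum, ← Finset.add_sum_erase _ _ (Finset.mem_univ j₀)] at h
    have e0 : coeff (Finsupp.single j₀ 1 + d₀) (C (a j₀) * X j₀ * P) = a j₀ * coeff d₀ P := by
      rw [mul_assoc, MvPolynomial.coeff_C_mul, MvPolynomial.coeff_X_mul]
    rw [e0, w.map_add_eq_of_lt_left] at h
    · exact h
    · rw [map_mul, hd₀.2]
      refine w.map_sum_lt (mul_pos ha0 hd₁0).ne' fun k hk => ?_
      have hkj : k ≠ j₀ := Finset.ne_of_mem_erase hk
      rw [mul_assoc, MvPolynomial.coeff_C_mul, MvPolynomial.coeff_X_mul', map_mul]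
      split_ifs with hks
      · refine mul_lt_mul_of_le_of_lt_of_nonneg_of_pos (hj₀ k) ?_ zero_le ha0
        refine lt_of_le_of_ne (hle _) fun heq => ?_
        have hmem : Finsupp.single j₀ 1 + d₀ - Finsupp.single k 1 ∈
            P.support.filter fun d => w (coeff d P) = w (coeff d₁ P) := by
          rw [Finset.mem_filter, MvPolynomial.mem_support_iff, ← (map_ne_zero w), heq]
          exact ⟨hd₁0.ne', rfl⟩
        have := hmax₀ _ hmem
        simp [hkj] at this
      · rw [map_zero, mul_zero]
        exact mul_pos ha0 hd₁0
  refine le_trans ?_ hmain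
  rw [map_mul, map_mul, hd₀.2]
  exact mul_le_mul' (hj₀ j) (hle d)

lemma valuation_aeval_le {K Γ₀ : Type*} [Field K] [LinearOrderedCommGroupWithZero Γ₀]
    (w : Valuation K Γ₀) (P : MvPolynomial (Fin 4) K) {x : Fin 4 → K} (hx : ∀ i, w (x i) ≤ 1) {r : Γ₀}
    (hr : ∀ d, w (coeff d P) ≤ r) : w (aeval x P) ≤ r := by
  rw [MvPolynomial.aeval_def, MvPolynomial.eval₂_eq]
  refine w.map_sum_le fun d _ => ?_
  rw [map_mul, map_prod]
  refine (mul_le_of_le_one_right' (Finset.prod_le_one' fun i _ => ?_)).trans (hr d)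
  rw [map_pow]
  exact pow_le_one' (hx i) _

section Integral

variable {K : Type u} [Field K] [NumberField K] (S : Set (HeightOneSpectrum (𝓞 K)))
  (T : CubicWithLine K)

lemma aeval_eq_aeval_map (x : Fin 4 → K) (G : MvPolynomial (Fin 4) (S.integer K)) :
    aeval x G = aeval x (MvPolynomial.map (algebraMap (S.integer K) K) G) :=
  (MvPolynomial.aeval_map_algebraMap K x G).symm

/-- A linear form separating x from the line lies in the model once its denominators are cleared. -/
lemma mem_L_of_lineModel {x : Fin 4 → K} (hx : ∀ G ∈ T.lineModel S, aeval x G = 0) : x ∈ T.L := by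
  by_contra hxL
  obtain ⟨φ, hφx, hφL⟩ := Submodule.exists_le_ker_of_notMem hxL
  obtain ⟨b, -, hb0, hb⟩ := exists_common_denominator
    (Set.range fun i => φ (Pi.single i 1)) (Set.finite_range _)
  have hφ : ∀ y : Fin 4 → K, φ y = ∑ i, φ (Pi.single i 1) * y i := by
    intro y
    conv_lhs => rw [pi_eq_sum_univ' y]
    simp [map_sum, mul_comm]
  obtain ⟨G, hG⟩ : ∃ G : MvPolynomial (Fin 4) (S.integer K), ∀ y : Fin 4 → K,
      aeval y G = b * φ y := by
    refine ⟨∑ i, C ⟨b * φ (Pi.single i 1), mem_integer_of_isIntegral S (hb _ ⟨i, rfl⟩)⟩ * X i,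
      fun y => ?_⟩
    rw [hφ, map_sum, Finset.mul_sum]
    refine Finset.sum_congr rfl fun i _ => ?_
    rw [map_mul, aeval_C, aeval_X, ← mul_assoc]
    rfl
  have hGmem : G ∈ T.lineModel S := by
    simp only [CubicWithLine.lineModel, flatModel, Ideal.mem_comap, Ideal.mem_iInf]
    intro y hy
    rw [RingHom.mem_ker, ← aeval_eq_aeval_map, hG, hφL hy, mul_zero]
  have := hx G hGmem
  rw [hG] at this
  exact mul_ne_zero hb0 hφx this

/-- At an integral point of the line, the complement of the boundary is detected by an integral
multiple of the linear form `h`. -/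
lemma exists_integral_multiple {x : Fin 4 → K}
    (hx : IsIntegralPoint S (T.lineModel S) (T.boundaryModel S ⊔ T.lineModel S) x)
    {a : Fin 4 → K} (ha : T.h = ∑ i, C (a i) * X i) {v : HeightOneSpectrum (𝓞 K)} (hv : v ∉ S) :
    ∃ c r : K, (∀ i, v.valuation K (c * x i) ≤ 1) ∧ (∀ i, r * a i ∈ S.integer K) ∧
      v.valuation K (r * (c * aeval x T.h)) = 1 := by
  have hxL := mem_L_of_lineModel S T hx.2.1
  obtain ⟨c, ⟨hc, -⟩, G, hG, hvG⟩ := hx.2.2 v hv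
  have hcL : c • x ∈ T.L := T.L.smul_mem c hxL
  obtain ⟨G', hG', G₃, hG₃, rfl⟩ := Submodule.mem_sup.mp hG
  obtain ⟨G₁, hG₁, G₂, hG₂, rfl⟩ := Submodule.mem_sup.mp hG'
  have e1 : aeval (c • x) G₁ = 0 := by
    obtain ⟨P, hP⟩ := Ideal.mem_span_singleton.mp hG₁
    rw [aeval_eq_aeval_map, hP, map_mul, T.L_sub _ hcL, zero_mul]
  have e3 : aeval (c • x) G₃ = 0 := by
    simp only [CubicWithLine.lineModel, flatModel, Ideal.mem_comap, Ideal.mem_iInf] at hG₃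
    have := hG₃ _ hcL
    rwa [RingHom.mem_ker, ← aeval_eq_aeval_map] at this
  rw [map_add (aeval (c • x)), map_add (aeval (c • x)), e1, e3, zero_add, add_zero] at hvG
  obtain ⟨P, hP⟩ := Ideal.mem_span_singleton.mp hG₂
  have hhc : aeval (c • x) T.h = c * aeval x T.h := by
    rw [aeval_smul_of_isHomogeneous T.h_hom, pow_one]
  rw [aeval_eq_aeval_map, hP, map_mul, hhc] at hvG
  have hP0 : P ≠ 0 := by
    rintro rfl
    simp at hvG
  -- Only the component hP of G survives on the line. The factor r is the v-largest coefficient of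
  -- P: the Gauss lemma makes rh integral outside S, and |P(cx)| ≤ |r| keeps its value at cx a unit.
  obtain ⟨d, hd, hmax⟩ := P.support.exists_max_image (fun d => v.valuation K (coeff d P))
    (MvPolynomial.support_nonempty.mpr hP0)
  have hle : ∀ e, v.valuation K (coeff e P) ≤ v.valuation K (coeff d P) := by
    intro e
    by_cases he : e ∈ P.support
    · exact hmax e he
    · rw [MvPolynomial.notMem_support_iff.mp he, map_zero]
      exact zero_le
  have hint : ∀ i, coeff d P * a i ∈ S.integer K := by
    intro i w hw
    rw [mul_comm]
    refine valuation_mul_coeff_le_one (w.valuation K) a P (fun e => ?_) i d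
    rw [← ha, ← hP, MvPolynomial.coeff_map]
    exact (coeff e G₂).2 w hw
  refine ⟨c, coeff d P, fun i => hc i, hint, le_antisymm ?_ ?_⟩
  · rw [← hhc, ha]
    simp only [map_sum, map_mul, aeval_C, aeval_X, Algebra.algebraMap_self, RingHom.id_apply,
      Finset.mul_sum]
    refine Valuation.map_sum_le _ fun i _ => ?_
    rw [← mul_assoc, map_mul]
    exact mul_le_one' (hint i v hv) (hc i)
  · have hPle := valuation_aeval_le (v.valuation K) P hc hle
    rw [← hvG, mul_comm (coeff d P), map_mul _ _ (aeval (c • x) P), map_mul _ _ (coeff d P)]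
    gcongr

/-- Points of the surface which are congruent to a given integral point of the line are
integral. -/
theorem isIntegralPoint_of_congruent {x : Fin 4 → K}
    (hx : IsIntegralPoint S (T.lineModel S) (T.boundaryModel S ⊔ T.lineModel S) x)
    (hxh : aeval x T.h ≠ 0) {k : Fin 4} (hk : x k ≠ 0) {y : Fin 4 → K} (hy : aeval y T.f = 0)
    (hyh : aeval y T.h = aeval x T.h) (hyx : ∀ i, (y i - x i) / x k ∈ S.integer K) :
    IsIntegralPoint S (T.surfaceModel S) (T.boundaryModel S) y := by
  obtain ⟨a, ha⟩ := exists_linear_coefficients T.h_hom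
  have hh : ∀ z : Fin 4 → K, aeval z T.h = ∑ i, a i * z i := fun z => by
    rw [ha]; simp
  refine ⟨?_, ?_, fun v hv => ?_⟩
  · rintro rfl
    rw [← hyh, hh] at hxh
    simp at hxh
  · intro G hG
    obtain ⟨P, hP⟩ := Ideal.mem_span_singleton.mp hG
    rw [aeval_eq_aeval_map, hP, map_mul, hy, zero_mul]
  · obtain ⟨c, r, hc, hr, hval⟩ := exists_integral_multiple S T hx ha hv
    -- Dividing the congruence by x_k makes it scale with the point: the scalar c that normalizes x
    -- at v also makes y integral there.
    have hcy : ∀ i, v.valuation K ((c • y) i) ≤ 1 := by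
      intro i
      have : (c • y) i = c * x i + (c * x k) * ((y i - x i) / x k) := by
        rw [Pi.smul_apply, smul_eq_mul]
        field_simp
        ring
      rw [this]
      refine Valuation.map_add_le _ (hc i) ?_
      rw [map_mul]
      exact mul_le_one' (hc k) (hyx i v hv)
    have hsum : ∑ i, (r * a i) * (c • y) i = r * (c * aeval x T.h) := by
      rw [← hyh, hh, Finset.mul_sum, Finset.mul_sum]
      exact Finset.sum_congr rfl fun i _ => by rw [Pi.smul_apply, smul_eq_mul]; ring
    refine ⟨c, ⟨hcy, ?_⟩, ∑ i, C ⟨r * a i, hr i⟩ * X i, ?_, ?_⟩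
    -- Primitivity is automatic: the integral linear form rh takes a unit value at cy.
    · by_contra! hne
      have hlt : v.valuation K (∑ i, (r * a i) * (c • y) i) < 1 := by
        refine Valuation.map_sum_lt _ one_ne_zero fun i _ => ?_
        rw [map_mul, mul_comm]
        exact mul_lt_one_of_lt_of_le (lt_of_le_of_ne (hcy i) (hne i)) (hr i v hv)
      rw [hsum, hval] at hlt
      exact lt_irrefl _ hlt
    · refine Submodule.mem_sup_right ?_
      change MvPolynomial.map _ _ ∈ Ideal.span {T.h}
      rw [Ideal.mem_span_singleton]
      refine ⟨C r, ?_⟩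
      rw [ha, map_sum, Finset.sum_mul]
      refine Finset.sum_congr rfl fun i _ => ?_
      rw [map_mul, MvPolynomial.map_C, MvPolynomial.map_X]
      change C (r * a i) * X i = _
      rw [map_mul]
      ring
    · rw [map_sum]
      simp only [map_mul, aeval_C, aeval_X]
      rw [← hval, ← hsum]
      rfl

end Integral

end CubicDensity

/-! ### Assembling the proof -/

namespace CubicDensity

universe u

lemma AtSomePlace.mono {K : Type u} [Field K] [NumberField K] {S : Set (HeightOneSpectrum (𝓞 K))}
    {P Q : ∀ (E : Type u) [Field E] [Algebra K E], Prop} (h : AtSomePlace S P)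
    (hPQ : ∀ (E : Type u) [Field E] [Algebra K E], P E → Q E) : AtSomePlace S Q := by
  rcases h with ⟨v, hv⟩ | ⟨v, hvS, hv⟩
  · exact Or.inl ⟨v, hPQ _ hv⟩
  · exact Or.inr ⟨v, hvS, hPQ _ hv⟩

lemma AtSomePlace.exists_holds {K : Type u} [Field K] [NumberField K]
    {S : Set (HeightOneSpectrum (𝓞 K))}
    {P : ∀ (E : Type u) [Field E] [Algebra K E], Prop} (h : AtSomePlace S P) :
    ∃ (E : Type u) (_ : Field E) (_ : Algebra K E), P E := by
  rcases h with ⟨v, hv⟩ | ⟨v, -, hv⟩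
  · exact ⟨_, _, _, hv⟩
  · exact ⟨_, _, _, hv⟩

lemma splitsAtPlace_sq {K : Type u} [Field K] [NumberField K] (S : Set (HeightOneSpectrum (𝓞 K)))
    {a : K} (ha : a ≠ 0) : SplitsAtPlace S (a ^ 2) := by
  refine splitsAtPlace_of_atSomePlace S (pow_ne_zero 2 ha) (Or.inl ?_)
  obtain ⟨v⟩ : Nonempty (InfinitePlace K) := inferInstance
  exact ⟨v, algebraMap K v.Completion a, by rw [map_pow, sq]⟩

namespace AdaptedFrame

variable {K : Type u} [Field K] [NumberField K] {T : CubicWithLine K} (Φ : AdaptedFrame T)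

/-- If `disc` is a square, GA3 leaves only the case where boundary and line have the same
discriminant up to squares with `lineDisc` not a square; each alternative of GA4 contradicts it. -/
lemma not_isSquare_disc (hfin : T.FiniteOnLine) (hGA3 : T.GA3)
    (hGA4 : T.GA4a ∨ T.GA4b ∨ T.GA4c) : ¬ IsSquare Φ.D.disc := by
  intro hsq
  have hbc := Φ.ne_zero_of_finiteOnLine hfin
  have hδ := Φ.not_isSquare_boundaryDisc hGA3
  rcases Φ.D.isSquare_boundaryDisc_or hbc hsq with h | ⟨hl, h⟩
  · exact hδ h
  · rcases hGA4 with h4 | h4 | h4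
    · refine Φ.not_GA4a (fun h0 => hδ ?_) (fun h0 => hl ?_) h h4
      · exact ⟨0, by rw [h0, mul_zero]⟩
      · exact ⟨0, by rw [h0, mul_zero]⟩
    · exact Φ.not_GA4b hl h h4
    · exact hl (Φ.isSquare_lineDisc_of_singularAlongLine hbc h4)

/-- For β₀ ≠ 0, in particular when q₁ is not a flex, the leading coefficient is the square β₀².
Otherwise the degree is odd if D₁ is irreducible and b₂ ≠ 0, and the remaining cases are those where
AA2d or AA2e supplies a local square. -/
lemma disc_degree (S : Set (HeightOneSpectrum (𝓞 K))) (hfin : T.FiniteOnLine) (hGA3 : T.GA3)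
    (hAA2 : T.AA2a ∨ T.AA2b ∨ T.AA2c ∨
      AtSomePlace S (fun E _ _ => T.AA2d E) ∨ AtSomePlace S (fun E _ _ => T.AA2e E)) :
    Odd Φ.D.disc.natDegree ∨
      Even Φ.D.disc.natDegree ∧ SplitsAtPlace S Φ.D.disc.leadingCoeff := by
  have hbc := Φ.ne_zero_of_finiteOnLine hfin
  by_cases hβ : Φ.D.β₀ = 0
  swap
  · obtain ⟨h1, h2⟩ := Φ.D.natDegree_disc_of_ne_zero hβ
    rw [h1, h2]
    exact Or.inr ⟨by decide, splitsAtPlace_sq S hβ⟩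
  have hodd : T.BoundaryIrreducible → Φ.D.b₂ ≠ 0 → Odd Φ.D.disc.natDegree := by
    intro hirr hb
    rw [Φ.D.natDegree_disc_of_flex hβ (Φ.ne_zero_of_boundaryIrreducible hirr hβ) hb]
    decide
  rcases hAA2 with h | h | h | h | h
  · exact absurd (Φ.isFlex_of_eq_zero hβ) h.2
  · exact Or.inl (hodd h.1 (Φ.of_singularAlongLine hbc h.2).1)
  · exact Or.inl (hodd h.1 (Φ.ne_zero_of_AA2c hβ h))
  · obtain ⟨E, _, _, hE⟩ := h.exists_holds
    by_cases hb : Φ.D.b₂ = 0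
    · have hc : Φ.D.c₂ ≠ 0 := hbc.resolve_left (not_not_intro hb)
      have hκ := Φ.ne_zero_of_boundaryIrreducible hE.1 hβ
      obtain ⟨h1, h2⟩ := Φ.D.natDegree_disc_of_flex_of_eq_zero hβ hκ hb hc
      rw [h1, h2]
      refine Or.inr ⟨by decide, splitsAtPlace_of_atSomePlace S
        (mul_ne_zero (mul_ne_zero (by norm_num) hc) hκ) ?_⟩
      exact h.mono fun E _ _ hE => Φ.isSquare_of_AA2d hβ hb hE
    · exact Or.inl (hodd hE.1 hb)
  · obtain ⟨E, _, _, hE⟩ := h.exists_holds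
    obtain ⟨-, hκ, hne, -⟩ := Φ.isSquare_of_AA2e hGA3 hE
    obtain ⟨h1, a, ha, h2⟩ := Φ.D.natDegree_disc_of_line hβ hκ hne hbc
    rw [h2]
    refine Or.inr ⟨h1, SplitsAtPlace.sq_mul (splitsAtPlace_of_atSomePlace S hne ?_) ha⟩
    exact h.mono fun E _ _ hE => (Φ.isSquare_of_AA2e hGA3 hE).2.2.2

end AdaptedFrame

theorem integralPointsDense {K : Type u} [Field K] [NumberField K]
    (S : Set (HeightOneSpectrum (𝓞 K))) (hS : S.Finite) (T : CubicWithLine K)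
    (hfin : T.FiniteOnLine) (hns : T.BoundaryNonsingularAt T.q) (hGA3 : T.GA3) (hAA1 : T.AA1 S)
    (hGA4 : T.GA4a ∨ T.GA4b ∨ T.GA4c)
    (hAA2 : T.AA2a ∨ T.AA2b ∨ T.AA2c ∨
      AtSomePlace S (fun E _ _ => T.AA2d E) ∨ AtSomePlace S (fun E _ _ => T.AA2e E)) :
    T.IntegralPointsDense S := by
  intro deg g hg hvan y hy
  obtain ⟨x, hx⟩ := hAA1
  have hxL := mem_L_of_lineModel S T hx.2.1
  have hxh : aeval x T.h ≠ 0 := by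
    -- Integrality only speaks about places outside S; as S is finite there is one, and there h does
    -- not vanish at x.
    obtain ⟨v, hv, -⟩ := exists_prime_dividing_value (Polynomial.X : Polynomial K)
      (by rw [Polynomial.degree_X]; exact zero_lt_one) S hS
    obtain ⟨a, ha⟩ := exists_linear_coefficients T.h_hom
    obtain ⟨c, r, -, -, h1⟩ := exists_integral_multiple S T hx ha hv
    intro h0
    rw [h0, mul_zero, mul_zero, map_zero] at h1
    exact zero_ne_one h1
  obtain ⟨Φ, hΦx, hΦμ⟩ := exists_adaptedFrame T hns hxL hxh
  obtain ⟨k, hk⟩ : ∃ k, x k ≠ 0 := by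
    by_contra! h
    exact hx.1 (funext h)
  -- With b clearing the denominators of the frame, coordinates divisible by x_k·b give points
  -- congruent to x modulo x_k.
  obtain ⟨b, -, hb0, hb⟩ := exists_common_denominator
    (Set.range fun p : Fin 4 × Fin 4 => Φ.e p.1 p.2) (Set.finite_range _)
  have hbe : ∀ j i, b * Φ.e j i ∈ S.integer K := fun j i =>
    mem_integer_of_isIntegral S (hb _ ⟨(j, i), rfl⟩)
  obtain ⟨G, hG⟩ : ∃ G : MvPolynomial (Fin 4) K, G = aeval (fun i => ∑ j, C (Φ.e j i) * X j) g :=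
    ⟨_, rfl⟩
  have hGhom : G.IsHomogeneous deg := by
    have := hg.aeval (fun i => ∑ j, C (Φ.e j i) * X j) (n := 1) fun i =>
      IsHomogeneous.sum _ _ _ fun j _ => (isHomogeneous_X K j).C_mul _
    rwa [one_mul, ← hG] at this
  have hGvec : ∀ {A : Type u} [CommRing A] [Algebra K A] (z : Fin 4 → A),
      aeval z G = aeval (Φ.vec z) g := by
    intro A _ _ z
    rw [hG, ← AlgHom.comp_apply, MvPolynomial.comp_aeval]
    congr 2
    funext i
    simp [AdaptedFrame.vec]
  have hdvd : Φ.D.form MvPolynomial.X ∣ G := by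
    refine Φ.D.form_dvd_of_vanishing S hS (Φ.ne_zero_of_finiteOnLine hfin)
      (Φ.not_isSquare_disc hfin hGA3 hGA4) (Φ.disc_degree S hfin hGA3 hAA2)
      (mul_ne_zero hk hb0) G hGhom ?_
    intro X₀ X₂ X₃ h0 h2 h3 hf
    rw [← MvPolynomial.coe_aeval_eq_eval, RingHom.coe_coe, hGvec]
    refine hvan _ (isIntegralPoint_of_congruent S T hx hxh hk ?_ ?_ ?_)
    · rw [Φ.aeval_f, Φ.coord_vec, hf]
    · rw [Φ.aeval_h, Φ.coord_vec, hΦμ]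
      simp
    · intro i
      have e : (Φ.vec ![X₀, 1, X₂, X₃] i - x i) / x k = X₀ / (x k * b) * (b * Φ.e 0 i)
          + X₂ / (x k * b) * (b * Φ.e 2 i) + X₃ / (x k * b) * (b * Φ.e 3 i) := by
        simp only [AdaptedFrame.vec, Fin.sum_univ_four, Matrix.cons_val, Algebra.algebraMap_self,
          RingHom.id_apply, hΦx]
        field_simp
        ring
      rw [e]
      exact add_mem (add_mem (mul_mem h0 (hbe 0 i)) (mul_mem h2 (hbe 2 i))) (mul_mem h3 (hbe 3 i))
  obtain ⟨R, hR⟩ := hdvd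
  have e1 := hGvec (Φ.coord y)
  rw [Φ.vec_coord, hR, map_mul, Φ.D.map_form] at e1
  simp only [aeval_X] at e1
  have e2 := Φ.aeval_f y
  rw [hy] at e2
  rw [← e1]
  exact mul_eq_zero_of_left e2.symm _

end CubicDensity

open CubicDensity in
theorem mainTheorem2 {K : Type*} [Field K] [NumberField K]
    (S : Set (IsDedekindDomain.HeightOneSpectrum (NumberField.RingOfIntegers K)))
    (hS : S.Finite) (T : CubicWithLine K)
    (hflat : T.BoundaryFlat S) (hfin : T.FiniteOnLine)
    (hGA1 : T.GA1) (hGA2 : T.GA2) (hGA3 : T.GA3) (hAA1 : T.AA1 S)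
    (hGA4 : T.GA4a ∨ T.GA4b ∨ T.GA4c)
    (hAA2 : T.AA2a ∨ T.AA2b ∨ T.AA2c ∨
      AtSomePlace S (fun E _ _ => T.AA2d E) ∨ AtSomePlace S (fun E _ _ => T.AA2e E)) :
    T.IntegralPointsDense S := by
  exact integralPointsDense S hS T hfin hGA1.2 hGA3 hAA1 hGA4 hAA2
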